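/- \textbf{Setting.} Let $d\in\{2,3\}$. A multipatch domain consists of $N$ pairwise disjoint patches $\Omega^{(k)}=G^{(k)}((0,1)^d)\subset\mathbb R^d$. Here $G^{(k)}=\sum_i P_i^{(k)}N^{(k)}_{i,p}$ is injective on $[0,1]^d$ and the $N^{(k)}_{i,p}$ are tensor product B-splines on open knot vectors, of degrees at least $1$ and with interior knot multiplicities at most the degree. The interfaces match geometrically: two faces (edges if $d=2$) of different patches whose relative interiors meet are equal. The meshes need not match. On each patch some faces, not shared with other patches, may be Dirichlet faces. Let $\check N^{(k)}_{i}=N^{(k)}_{i,p}\circ (G^{(k)})^{-1}$, and let $V_h^{(k)}$ be the span of those $\check N_i^{(k)}$ that vanish on the Dirichlet faces of $\Omega^{(k)}$. Let $\mathcal I^{(k)}$ be the set of all $l\neq k$ such that $\Omega^{(k)}$ and $\Omega^{(l)}$ share a face, $F^{(kl)}=F^{(lk)}$ the (closed) shared part of the boundaries, and $\Gamma^{(k)}=\bigcup_{l\in\mathcal I^{(k)}}F^{(kl)}$. Let $H^{(k)}=\operatorname{diam}\Omega^{(k)}$, let $h^{(k)}$ be the largest diameter of a mesh cell of $\Omega^{(k)}$,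 and put $h^{(kl)}=2h^{(k)}h^{(l)}/(h^{(k)}+h^{(l)})$. Put $V_{h,e}^{(k)}=V_h^{(k)}\times\prod_{l\in\mathcal I^{(k)}}V_h^{(k)}(F^{(lk)})$, where $V_h^{(k)}(F^{(lk)})$ is the span of the basis functions of $V_h^{(l)}$ that do not vanish identically on $F^{(lk)}$. Write its elements as $u=(u^{(k)},(u^{(l)})_{l\in\mathcal I^{(k)}})$. Let $W^{(k)}\subset V_{h,e}^{(k)}$ be the subspace in which $u^{(k)}$ lies in the span of the basis functions of $V_h^{(k)}$ that do not vanish identically on $\Gamma^{(k)}$. Let $V_{I,h}^{(k)}\subset V_{h,e}^{(k)}$ be the subspace of all $v$ with $v^{(k)}=0$ on $\Gamma^{(k)}$ and $v^{(l)}=0$ on $F^{(lk)}$ for all $l\in\mathcal I^{(k)}$. For constants $\alpha^{(k)}>0$ and $\delta>0$ define on $V_{h,e}^{(k)}$ (with $n$ the outer unit normal of $\Omega^{(k)}$) \begin{align*} a^{(k)}(u,v)&=\int_{\Omega^{(k)}}\alpha^{(k)}\nabla u^{(k)}\cdot\nabla v^{(k)}\,dx,\\ s^{(k)}(u,v)&=\sum_{l\in\mathcal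 I^{(k)}}\int_{F^{(kl)}}\frac{\alpha^{(k)}}2\Big(\frac{\partial u^{(k)}}{\partial n}(v^{(l)}-v^{(k)})+\frac{\partial v^{(k)}}{\partial n}(u^{(l)}-u^{(k)})\Big)ds,\\ p^{(k)}(u,v)&=\sum_{l\in\mathcal I^{(k)}}\int_{F^{(kl)}}\frac{\delta\alpha^{(k)}}{2h^{(kl)}}(u^{(l)}-u^{(k)})(v^{(l)}-v^{(k)})\,ds,\qquad a_e^{(k)}=a^{(k)}+s^{(k)}+p^{(k)}. \end{align*} For $u_{B_e}\in W^{(k)}$, a discrete harmonic extension $\mathcal H^{(k)}u_{B_e}\in V_{h,e}^{(k)}$ (respectively $\mathcal H_e^{(k)}u_{B_e}\in V_{h,e}^{(k)}$) is a function that agrees with $u_{B_e}$ on the extended interface (the $k$-component on $\Gamma^{(k)}$ and the $l$-component on $F^{(lk)}$ for all $l\in\mathcal I^{(k)}$) and satisfies $a^{(k)}(\mathcal H^{(k)}u_{B_e},v)=0$ (respectively $a_e^{(k)}(\mathcal H_e^{(k)}u_{B_e},v)=0$) for all $v\in V_{I,h}^{(k)}$. \textbf{Statement.} Let $p_{\max}\in\mathbb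 N$ and $\kappa,\theta\in\mathbb R$. There are constants $\delta_0,C_0,C_1>0$, depending only on $d,p_{\max},\kappa,\theta$, such that the following holds for every multipatch domain all of whose spline degrees are at most $p_{\max}$, which is shape regular (for all $k$, all $v\in\mathbb R^d$ and all $\xi\in[0,1]^d$ at which $G^{(k)}$ is differentiable, $H^{(k)}|v|\le\kappa|DG^{(k)}(\xi)v|$ and $|DG^{(k)}(\xi)v|\le\kappa H^{(k)}|v|$) and patchwise quasi-uniform (on each patch the lengths of any two nonempty knot spans, in whichever directions, differ at most by the factor $\theta$), for all $\alpha^{(1)},\dots,\alpha^{(N)}>0$, all $\delta\ge\delta_0$, all $k$ and all $u_{B_e}\in W^{(k)}$. Discrete harmonic extensions $\mathcal H^{(k)}u_{B_e}$ and $\mathcal H_e^{(k)}u_{B_e}$ exist, and any such extensions satisfy $$C_0\,d^{(k)}(\mathcal H^{(k)}u_{B_e},\mathcal H^{(k)}u_{B_e})\le a_e^{(k)}(\mathcal H_e^{(k)}u_{B_e},\mathcal H_e^{(k)}u_{B_e})\le C_1\,d^{(k)}(\mathcal H^{(k)}u_{B_e},\mathcal H^{(k)}u_{B_e}),$$ both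 for $d^{(k)}=a^{(k)}+2p^{(k)}$ (the contribution of the patch to the squared broken dG norm $\sum_k\big[\alpha^{(k)}\|\nabla u^{(k)}\|^2_{L^2(\Omega^{(k)})}+\sum_{l\in\mathcal I^{(k)}}\frac{\delta\alpha^{(k)}}{h^{(kl)}}\|u^{(k)}-u^{(l)}\|^2_{L^2(F^{(kl)})}\big]$) and for $d^{(k)}=a_e^{(k)}+p^{(k)}$. In particular the constants do not depend on $\delta$, the mesh sizes, the patch sizes, the coefficients, the number of patches or $u_{B_e}$. -/

import Mathlib

open MeasureTheory Set
open scoped RealInnerProductSpace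

noncomputable section

namespace DGIgA

/-! ## B-splines -/

/-- A degree `p ≥ 1` together with an open knot vector on `[0,1]` carrying `n` B-splines of degree
`p`. The knots are `t 0 ≤ ⋯ ≤ t (n + p)`, zero-based: the first and the last `p + 1` of them are `0`
and `1`, and no interior knot has multiplicity larger than `p` (so that all splines are continuous).
For convenience the sequence is continued by the value `1`. -/
structure KnotVector where
  p : ℕ
  n : ℕ
  t : ℕ → ℝ
  one_le_p : 1 ≤ p
  p_lt_n : p < n
  mono : Monotone t
  t_first : ∀ i ≤ p, t i = 0
  t_last : ∀ i, n ≤ i → t i = 1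
  mult_le : ∀ i, 1 ≤ i → i < n → t i < t (i + p)

/-- The Cox--de Boor recursion on the knots `t`, with the usual convention `x / 0 = 0`. The splines
of degree `0` are the indicator functions of the half-open knot spans, where the last nonempty span
is closed at `1`. -/
def bspline (t : ℕ → ℝ) : ℕ → ℕ → ℝ → ℝ
  | 0, i, x =>
      open Classical in
      if (t i ≤ x ∧ x < t (i + 1)) ∨ (x = 1 ∧ t i < 1 ∧ t (i + 1) = 1) then 1 else 0
  | q + 1, i, x =>
      (x - t i) / (t (i + q + 1) - t i) * bspline t q i x
        + (t (i + q + 2) - x) / (t (i + q + 2) - t (i + 1)) * bspline t q (i + 1) x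

/-! ## The parameter domain -/

/-- The space `ℝ^d` with the Euclidean norm. -/
abbrev E (d : ℕ) : Type := EuclideanSpace ℝ (Fin d)

/-- The open parameter domain `(0,1)^d`. -/
def openCube (d : ℕ) : Set (E d) := {ξ | ∀ i, ξ i ∈ Ioo (0 : ℝ) 1}

/-- The closed parameter domain `[0,1]^d`. -/
def cube (d : ℕ) : Set (E d) := {ξ | ∀ i, ξ i ∈ Icc (0 : ℝ) 1}

/-- A face (an edge if `d = 2`) of the cube: `(j, false)` is the face `ξ_j = 0`, and `(j, true)` is
the face `ξ_j = 1`. -/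
abbrev Face (d : ℕ) : Type := Fin d × Bool

/-- The value of the fixed coordinate on a face. -/
def Face.coord {d : ℕ} (f : Face d) : ℝ := if f.2 then 1 else 0

/-- The closed face as a subset of `[0,1]^d`. -/
def Face.closedSet {d : ℕ} (f : Face d) : Set (E d) := {ξ ∈ cube d | ξ f.1 = f.coord}

/-- The relative interior of a face. -/
def Face.openSet {d : ℕ} (f : Face d) : Set (E d) :=
  {ξ | ξ f.1 = f.coord ∧ ∀ i, i ≠ f.1 → ξ i ∈ Ioo (0 : ℝ) 1}

/-- The point of a face with given tangential coordinates. -/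
def Face.point {d : ℕ} (f : Face d) (η : {i : Fin d // i ≠ f.1} → ℝ) : E d :=
  WithLp.toLp 2 fun i => if h : i = f.1 then f.coord else η ⟨i, h⟩

/-- The outer unit normal of the cube on a face. -/
def Face.refNormal {d : ℕ} (f : Face d) : E d :=
  EuclideanSpace.single f.1 (if f.2 then 1 else -1)

/-! ## A single patch -/

/-- The data of a patch: one knot vector per direction, the control points of the geometrical
mapping, and the set of those faces that belong to the Dirichlet boundary. -/
structure Patch (d : ℕ) where
  knots : Fin d → KnotVector
  ctrl : ((i : Fin d) → Fin (knots i).n) → E d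
  dirichlet : Finset (Face d)

namespace Patch

variable {d : ℕ} (P : Patch d)

/-- The multi-indices of the tensor product B-splines. -/
abbrev Idx : Type := (i : Fin d) → Fin (P.knots i).n

/-- The tensor product B-spline with multi-index `i` on the parameter domain. -/
def tbspline (i : P.Idx) (ξ : E d) : ℝ :=
  ∏ j, bspline (P.knots j).t (P.knots j).p (i j) (ξ j)

/-- The geometrical mapping `G`. -/
def G (ξ : E d) : E d := ∑ i : P.Idx, P.tbspline i ξ • P.ctrl i

/-- The patch `G((0,1)^d)`. -/
def dom : Set (E d) := P.G '' openCube d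

/-- The closed patch `G([0,1]^d)`. -/
def closedDom : Set (E d) := P.G '' cube d

/-- A closed face of the physical patch. -/
def face (f : Face d) : Set (E d) := P.G '' f.closedSet

/-- The basis function `N ∘ G⁻¹` on the closed patch, continued by zero to `ℝ^d`. -/
def basis (i : P.Idx) : E d → ℝ :=
  P.closedDom.indicator fun x => P.tbspline i (Function.invFunOn P.G (cube d) x)

/-- The indices of the basis functions which vanish on the Dirichlet faces. -/
def freeIdx : Set P.Idx := {i | ∀ f ∈ P.dirichlet, ∀ x ∈ P.face f, P.basis i x = 0}

/-- The spline space of the patch, with homogeneous Dirichlet conditions on the Dirichlet faces. -/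
def V : Submodule ℝ (E d → ℝ) := Submodule.span ℝ (P.basis '' P.freeIdx)

/-- The span of those basis functions which do not vanish identically on `S`. -/
def VOn (S : Set (E d)) : Submodule ℝ (E d → ℝ) :=
  Submodule.span ℝ (P.basis '' {i ∈ P.freeIdx | ∃ x ∈ S, P.basis i x ≠ 0})

/-- The gradient of a function on the closed patch; on the boundary of the patch it is the one-sided
gradient from inside. -/
def grad (u : E d → ℝ) (x : E d) : E d :=
  gradientWithin u P.closedDom x

/-- The Jacobian of the geometrical mapping on the closed parameter domain. -/
def jac (ξ : E d) : E d →L[ℝ] E d := fderivWithin ℝ P.G (cube d) ξ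

/-- The outer unit normal of the physical patch at `G ξ`, where `ξ` lies on the face `f`: the
normalization of `DG(ξ)^{-T} n`, with `n` the outer normal of the cube. -/
def normal (f : Face d) (ξ : E d) : E d :=
  let w := ContinuousLinearMap.adjoint (ContinuousLinearMap.inverse (P.jac ξ)) f.refNormal
  ‖w‖⁻¹ • w

/-- The density of the surface measure of a physical face with respect to the tangential
coordinates: the square root of the Gram determinant of the tangent vectors. -/
def surfaceDensity (f : Face d) (ξ : E d) : ℝ :=
  Real.sqrt (Matrix.det (Matrix.of fun i j : {i : Fin d // i ≠ f.1} =>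
    ⟪P.jac ξ (EuclideanSpace.single i.1 1), P.jac ξ (EuclideanSpace.single j.1 1)⟫))

/-- The surface integral `∫ g(x, n(x)) ds` over a physical face, where `n` is the outer unit
normal. -/
def faceIntegral (f : Face d) (g : E d → E d → ℝ) : ℝ :=
  ∫ η in Set.univ.pi fun _ : {i : Fin d // i ≠ f.1} => Icc (0 : ℝ) 1,
    g (P.G (f.point η)) (P.normal f (f.point η)) * P.surfaceDensity f (f.point η)

/-- The set of the indices of the cells (products of nonempty knot spans). -/
def cellIdx : Set (Fin d → ℕ) :=
  {c | ∀ i, (P.knots i).t (c i) < (P.knots i).t (c i + 1)}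

/-- The closed cell of the parameter domain with index `c`. -/
def cell (c : Fin d → ℕ) : Set (E d) :=
  {ξ | ∀ i, ξ i ∈ Icc ((P.knots i).t (c i)) ((P.knots i).t (c i + 1))}

/-- The patch size `H`. -/
def H : ℝ := Metric.diam P.dom

/-- The mesh size `h`: the largest diameter of a physical cell. -/
def h : ℝ := sSup {r | ∃ c ∈ P.cellIdx, r = Metric.diam (P.G '' P.cell c)}

/-- Shape regularity of the patch: after scaling by the patch size `H`, the Jacobian of the
geometrical mapping and its inverse are bounded by `κ` wherever the mapping is differentiable. -/
def ShapeRegular (κ : ℝ) : Prop :=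
  ∀ ξ ∈ cube d, DifferentiableWithinAt ℝ P.G (cube d) ξ → ∀ v : E d,
    P.H * ‖v‖ ≤ κ * ‖P.jac ξ v‖ ∧ ‖P.jac ξ v‖ ≤ κ * P.H * ‖v‖

/-- Quasi-uniformity of the mesh: the lengths of any two nonempty knot spans, in whichever
directions, differ at most by the factor `θ`. -/
def QuasiUniform (θ : ℝ) : Prop :=
  ∀ (i j : Fin d) (a b : ℕ), (P.knots j).t b < (P.knots j).t (b + 1) →
    (P.knots i).t (a + 1) - (P.knots i).t a ≤ θ * ((P.knots j).t (b + 1) - (P.knots j).t b)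

end Patch

/-! ## Multipatch domains -/

/-- A decomposition into `N` non-overlapping patches with geometrically matching interfaces: two
physical faces of different patches whose relative interiors meet are equal. The meshes need not
match. Dirichlet faces are not shared with another patch. -/
structure MultiPatch (d N : ℕ) where
  patch : Fin N → Patch d
  injOn : ∀ k, InjOn (patch k).G (cube d)
  disjoint : ∀ k l, k ≠ l → Disjoint (patch k).dom (patch l).dom
  matching : ∀ k l, k ≠ l → ∀ f f' : Face d,
    (((patch k).G '' f.openSet) ∩ ((patch l).G '' f'.openSet)).Nonempty →
      (patch k).face f = (patch l).face f'
  dirichlet_boundary : ∀ k, ∀ f ∈ (patch k).dirichlet, ∀ l, l ≠ k → ∀ f' : Face d,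
    (patch k).face f ≠ (patch l).face f'

namespace MultiPatch

variable {d N : ℕ} (M : MultiPatch d N)

open Classical in
/-- The faces of the patch `k` which are shared with the patch `l`. -/
def commonFaces (k l : Fin N) : Finset (Face d) :=
  Finset.univ.filter fun f => ∃ f' : Face d, (M.patch k).face f = (M.patch l).face f'

open Classical in
/-- The set of the indices `l ≠ k` such that the patches `k` and `l` share a face. -/
def nbrs (k : Fin N) : Finset (Fin N) :=
  Finset.univ.filter fun l => l ≠ k ∧ (M.commonFaces k l).Nonempty

/-- The closed interface `F^{(kl)}` of two patches; as a set it equals `F^{(lk)}`. -/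
def interface (k l : Fin N) : Set (E d) := ⋃ f ∈ M.commonFaces k l, (M.patch k).face f

/-- The interface part of the boundary of the patch `k`. -/
def Γ (k : Fin N) : Set (E d) := ⋃ l ∈ M.nbrs k, M.interface k l

/-- The harmonic average of the mesh sizes of two patches. -/
def hAvg (k l : Fin N) : ℝ :=
  2 * (M.patch k).h * (M.patch l).h / ((M.patch k).h + (M.patch l).h)

/-! ### Spaces on the extended patch

An element `u` of the product space `V_{h,e}^{(k)}` is written as a family indexed by all the
patches: `u k` is the component on the patch `k`, `u l` is the component on the interface `F^{(lk)}`
if `l` is a neighbour of `k`, and the other components are zero. -/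

open Classical in
/-- The space `V_{h,e}^{(k)}` of the extended patch. -/
def Vext (k : Fin N) : Submodule ℝ (Fin N → E d → ℝ) :=
  Submodule.pi Set.univ fun l =>
    if l = k then (M.patch k).V
    else if l ∈ M.nbrs k then (M.patch l).VOn (M.interface l k) else ⊥

open Classical in
/-- The space `W^{(k)}`: the span of the basis functions that do not vanish on the extended
interface. -/
def W (k : Fin N) : Submodule ℝ (Fin N → E d → ℝ) :=
  Submodule.pi Set.univ fun l =>
    if l = k then (M.patch k).VOn (M.Γ k)
    else if l ∈ M.nbrs k then (M.patch l).VOn (M.interface l k) else ⊥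

/-- Two functions on the extended patch agree on the extended interface, which consists of `Γ^{(k)}`
and of the neighbouring interfaces `F^{(lk)}`. -/
def AgreeOnInterface (k : Fin N) (u v : Fin N → E d → ℝ) : Prop :=
  EqOn (u k) (v k) (M.Γ k) ∧ ∀ l ∈ M.nbrs k, EqOn (u l) (v l) (M.interface l k)

/-- The space `V_{I,h}^{(k)}`, as the set of the functions on the extended patch which vanish on the
extended interface. -/
def VI (k : Fin N) : Set (Fin N → E d → ℝ) := {v ∈ M.Vext k | M.AgreeOnInterface k v 0}

/-! ### Bilinear forms -/

/-- The form `a^{(k)}`. -/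
def a (α : Fin N → ℝ) (k : Fin N) (u v : Fin N → E d → ℝ) : ℝ :=
  ∫ x in (M.patch k).dom, α k * ⟪(M.patch k).grad (u k) x, (M.patch k).grad (v k) x⟫

/-- The form `s^{(k)}`. -/
def s (α : Fin N → ℝ) (k : Fin N) (u v : Fin N → E d → ℝ) : ℝ :=
  ∑ l ∈ M.nbrs k, ∑ f ∈ M.commonFaces k l, (M.patch k).faceIntegral f fun x ν =>
    α k / 2 * (⟪(M.patch k).grad (u k) x, ν⟫ * (v l x - v k x)
      + ⟪(M.patch k).grad (v k) x, ν⟫ * (u l x - u k x))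

/-- The penalty form `p^{(k)}`. -/
def pen (α : Fin N → ℝ) (δ : ℝ) (k : Fin N) (u v : Fin N → E d → ℝ) : ℝ :=
  ∑ l ∈ M.nbrs k, ∑ f ∈ M.commonFaces k l, (M.patch k).faceIntegral f fun x _ =>
    δ * α k / (2 * M.hAvg k l) * ((u l x - u k x) * (v l x - v k x))

/-- The form `a_e^{(k)} = a^{(k)} + s^{(k)} + p^{(k)}`. -/
def ae (α : Fin N → ℝ) (δ : ℝ) (k : Fin N) (u v : Fin N → E d → ℝ) : ℝ :=
  M.a α k u v + M.s α k u v + M.pen α δ k u v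

/-- The form `d^{(k)}` whose sum over `k` is the squared broken norm: `a^{(k)} + 2 p^{(k)}`. -/
def dNorm (α : Fin N → ℝ) (δ : ℝ) (k : Fin N) (u v : Fin N → E d → ℝ) : ℝ :=
  M.a α k u v + 2 * M.pen α δ k u v

/-- The form `a_e^{(k)} + p^{(k)}`. -/
def dPlus (α : Fin N → ℝ) (δ : ℝ) (k : Fin N) (u v : Fin N → E d → ℝ) : ℝ :=
  M.ae α δ k u v + M.pen α δ k u v

/-- `w` is the discrete harmonic extension of `u` to the extended patch `k` in the sense of the
form `B`. -/
structure IsHarmonicExt (k : Fin N) (B : (Fin N → E d → ℝ) → (Fin N → E d → ℝ) → ℝ)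
    (u w : Fin N → E d → ℝ) : Prop where
  mem : w ∈ M.Vext k
  orthogonal : ∀ v ∈ M.VI k, B w v = 0
  agree : M.AgreeOnInterface k w u

end MultiPatch

end DGIgA

end

noncomputable section

namespace DGIgA

open Polynomial Filter Topology

/-! Everything rests on one estimate: for δ large, |s(u,u)| ≤ ½ (a(u,u) + p(u,u)) on the extended
space (`abs_s_le`). It makes a_e positive semidefinite there and places its energy between ½ (a + p)
and 3/2 (a + p). A harmonic extension for a semidefinite form minimizes the energy among the
functions with the same interface values (`IsHarmonicExt.le`), and the penalty sees only these
values (`pen_congr`). So for the two extensions w and w_e one has a(w) ≤ a(w_e), a_e(w_e) ≤ a_e(w)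
and p(w) = p(w_e), whence ½ (a(w) + p(w)) ≤ a_e(w_e) ≤ 3/2 (a(w) + p(w)). Both choices of d^(k) are
comparable with a + p. Existence of the extensions needs no definiteness: by Cauchy–Schwarz the
linear system is solvable for every semidefinite form (`exists_add_orthogonal`).

The estimate of s follows from Young's inequality on each face and three facts. First, the inverse
trace inequality h ∫_F (∂u/∂n)² ≤ C ∫_Ω |∇u|² (`exists_inverse_trace`): on the parameter cube, along
lines normal to the face, the partial derivatives of a spline are polynomials on the outermost knot
span, so their end values are controlled by L² norms over that span. Fubini, shape regularity and
quasi-uniformity transfer this to the patch, and all powers of H cancel. Second, the harmonic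
average of two mesh sizes is at most twice either of them (`hAvg_le`), so the neighbour's mesh does
not enter. Third, boundedly many patches share a given face (`exists_card_le`). This is a packing
argument: near the face each of them contains a set whose volume is at least a fixed multiple of the
d-th power of the diameter of the face, and these sets are disjoint.

The analytic groundwork concerns the points where a spline is differentiable. Interior knots are
excluded, but the ends 0 and 1 are kept, so that one-sided gradients exist at almost all points of
the faces and not only inside the patch. -/

/-! ## Polynomial pieces of B-splines -/

/-- The polynomial which coincides with the B-spline `bspline t q i` on the knot span with
index `a`. -/
def bsplinePiece (t : ℕ → ℝ) (a : ℕ) : ℕ → ℕ → ℝ[X]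
  | 0, i => if i = a then 1 else 0
  | q + 1, i =>
      C (t (i + q + 1) - t i)⁻¹ * (X - C (t i)) * bsplinePiece t a q i
        + C (t (i + q + 2) - t (i + 1))⁻¹ * (C (t (i + q + 2)) - X) * bsplinePiece t a q (i + 1)

lemma natDegree_bsplinePiece_le (t : ℕ → ℝ) (a q i : ℕ) :
    (bsplinePiece t a q i).natDegree ≤ q := by
  induction q generalizing i with
  | zero => unfold bsplinePiece; split_ifs <;> simp
  | succ q ih =>
    have h1 : (X - C (t i)).natDegree ≤ 1 := natDegree_X_sub_C_le _
    have h2 : (C (t (i + q + 2)) - X : ℝ[X]).natDegree ≤ 1 := by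
      rw [← neg_sub, natDegree_neg]; exact natDegree_X_sub_C_le _
    unfold bsplinePiece
    refine natDegree_add_le_of_degree_le ?_ ?_
    · refine (natDegree_mul_le).trans ?_
      have := (natDegree_C_mul_le (t (i + q + 1) - t i)⁻¹ (X - C (t i))).trans h1
      have := ih i
      omega
    · refine (natDegree_mul_le).trans ?_
      have := (natDegree_C_mul_le (t (i + q + 2) - t (i + 1))⁻¹ (C (t (i + q + 2)) - X)).trans h2
      have := ih (i + 1)
      omega

lemma eval_bsplinePiece_succ (t : ℕ → ℝ) (a q i : ℕ) (x : ℝ) :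
    (bsplinePiece t a (q + 1) i).eval x =
      (x - t i) / (t (i + q + 1) - t i) * (bsplinePiece t a q i).eval x
        + (t (i + q + 2) - x) / (t (i + q + 2) - t (i + 1)) *
          (bsplinePiece t a q (i + 1)).eval x := by
  simp only [bsplinePiece, eval_add, eval_mul, eval_C, eval_sub, eval_X]
  ring

/-- In degree zero exactly one half-open span is active at `x`, and the two recursions agree in
higher degrees. The second alternative in `hx` reflects the convention that the last nonempty span
is closed at 1. -/
lemma bspline_eq_eval {t : ℕ → ℝ} (ht : Monotone t) (h1 : ∀ i, t i ≤ 1) {a : ℕ}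
    (ha : t a < t (a + 1)) {x : ℝ}
    (hx : (t a ≤ x ∧ x < t (a + 1)) ∨ (x = 1 ∧ t (a + 1) = 1)) (q i : ℕ) :
    bspline t q i x = (bsplinePiece t a q i).eval x := by
  induction q generalizing i with
  | zero =>
    unfold bspline bsplinePiece
    rcases lt_trichotomy i a with h | h | h
    · have h3 : t (i + 1) ≤ t a := ht h
      have h4 := h1 (a + 1)
      have h5 := h1 (i + 1)
      rw [if_neg, if_neg h.ne, eval_zero]
      rintro (⟨h6, h7⟩ | ⟨h6, h7, h8⟩)
      · rcases hx with hx | hx <;> linarith [hx.1, hx.2]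
      · linarith
    · subst h
      rw [if_pos, if_pos rfl, eval_one]
      rcases hx with hx | hx
      · exact Or.inl hx
      · exact Or.inr ⟨hx.1, by linarith [hx.2], hx.2⟩
    · have h3 : t (a + 1) ≤ t i := ht h
      have h4 := h1 (i + 1)
      have h5 := h1 (a + 1)
      rw [if_neg, if_neg h.ne', eval_zero]
      rintro (⟨h6, h7⟩ | ⟨h6, h7, h8⟩)
      · rcases hx with hx | hx <;> linarith [hx.1, hx.2]
      · rcases hx with hx | hx <;> linarith [hx.1, hx.2]
  | succ q ih =>
    rw [eval_bsplinePiece_succ, ← ih, ← ih]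
    rfl

open Classical in
/-- The jump of a B-spline at a knot: it vanishes unless the knot has full multiplicity. -/
lemma eval_bsplinePiece_jump {t : ℕ → ℝ} (ht : Monotone t) {a b : ℕ} {τ : ℝ}
    (ha : t a < τ) (ha' : t (a + 1) = τ) (hb : t b = τ) (hb' : τ < t (b + 1)) (q i : ℕ) :
    (bsplinePiece t b q i).eval τ - (bsplinePiece t a q i).eval τ =
      (if t i = τ ∧ t (i + q) = τ ∧ τ < t (i + q + 1) then 1 else 0)
        - (if t i < τ ∧ t (i + 1) = τ ∧ t (i + q + 1) = τ then 1 else 0) := by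
  induction q generalizing i with
  | zero =>
    have e1 : (t i = τ ∧ t (i + 0) = τ ∧ τ < t (i + 0 + 1)) ↔ i = b := by
      constructor
      · rintro ⟨h, -, h'⟩
        rcases lt_trichotomy i b with h2 | h2 | h2
        · have := ht (show i + 1 ≤ b from h2)
          simp only [add_zero] at h'
          linarith
        · exact h2
        · have := ht (show b + 1 ≤ i from h2)
          linarith
      · rintro rfl
        exact ⟨hb, hb, hb'⟩
    have e2 : (t i < τ ∧ t (i + 1) = τ ∧ t (i + 0 + 1) = τ) ↔ i = a := by
      constructor
      · rintro ⟨h, h', -⟩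
        rcases lt_trichotomy i a with h2 | h2 | h2
        · have := ht (show i + 1 ≤ a from h2)
          linarith
        · exact h2
        · have := ht (show a + 1 ≤ i from h2)
          linarith
      · rintro rfl
        exact ⟨ha, ha', ha'⟩
    simp only [e1, e2, bsplinePiece]
    split_ifs <;> simp
  | succ q ih =>
    have i1 := ih i
    have i2 := ih (i + 1)
    have m1 : t i ≤ t (i + 1) := ht (by omega)
    have m2 : t (i + 1) ≤ t (i + q + 1) := ht (by omega)
    have m3 : t (i + q + 1) ≤ t (i + q + 2) := ht (by omega)
    rw [show i + 1 + q = i + q + 1 by ring, show i + 1 + 1 = i + 2 by ring,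
      show i + q + 1 + 1 = i + q + 2 by ring] at i2
    rw [eval_bsplinePiece_succ, eval_bsplinePiece_succ,
      show i + (q + 1) = i + q + 1 by ring, show i + q + 1 + 1 = i + q + 2 by ring]
    have key : ∀ A B A' B' x y : ℝ, (x * A + y * B) - (x * A' + y * B')
        = x * (A - A') + y * (B - B') := by intros; ring
    rw [key, i1, i2]
    -- The weight vanishes if `t i = τ` and equals one if `t i < τ = t (i + q + 1)`, so it removes
    -- the first indicator and keeps the second. In `k2` the roles are exchanged.
    have k1 : (τ - t i) / (t (i + q + 1) - t i) *
        ((if t i = τ ∧ t (i + q) = τ ∧ τ < t (i + q + 1) then 1 else 0)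
        - (if t i < τ ∧ t (i + 1) = τ ∧ t (i + q + 1) = τ then 1 else 0))
        = - (if t i < τ ∧ t (i + 1) = τ ∧ t (i + q + 1) = τ then 1 else 0) := by
      split_ifs with h h' h'
      · exact absurd h.1 h'.1.ne
      · simp [h.1]
      · rw [h'.2.2, div_self (by linarith [h'.1])]; ring
      · simp
    have k2 : (t (i + q + 2) - τ) / (t (i + q + 2) - t (i + 1)) *
        ((if t (i + 1) = τ ∧ t (i + q + 1) = τ ∧ τ < t (i + q + 2) then 1 else 0)
        - (if t (i + 1) < τ ∧ t (i + 2) = τ ∧ t (i + q + 2) = τ then 1 else 0))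
        = (if t (i + 1) = τ ∧ t (i + q + 1) = τ ∧ τ < t (i + q + 2) then 1 else 0) := by
      split_ifs with h h' h'
      · exact absurd h.1 h'.1.ne
      · rw [h.1, div_self (by linarith [h.2.2])]; ring
      · rw [h'.2.2]; simp
      · simp
    rw [k1, k2]
    -- If the block of knots from `i + 1` to `i + q + 1` sits at `τ` and both outer knots differ
    -- from `τ`, the two contributions cancel: this is the gain of smoothness from one more degree.
    -- Otherwise an outer knot joins the block and yields the indicator for degree `q + 1`.
    by_cases c1 : t (i + 1) = τ ∧ t (i + q + 1) = τ
    · obtain ⟨c1, c2⟩ := c1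
      rcases m1.lt_or_eq with h | h
      · have hi : t i < τ := by linarith
        rcases m3.lt_or_eq with h' | h'
        · have h3 : τ < t (i + q + 2) := by linarith
          simp [c1, c2, hi, hi.ne, h3, h3.ne']
        · have h3 : t (i + q + 2) = τ := by linarith
          simp [c1, c2, hi, hi.ne, h3]
      · have hi : t i = τ := by linarith
        rcases m3.lt_or_eq with h' | h'
        · have h3 : τ < t (i + q + 2) := by linarith
          simp [c1, c2, hi, h3]
        · have h3 : t (i + q + 2) = τ := by linarith
          simp [c1, c2, hi, h3]
    · have n1 : ¬ (t (i + 1) = τ ∧ t (i + q + 1) = τ ∧ τ < t (i + q + 2)) :=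
        fun h => c1 ⟨h.1, h.2.1⟩
      have n2 : ¬ (t i < τ ∧ t (i + 1) = τ ∧ t (i + q + 1) = τ) := fun h => c1 ⟨h.2.1, h.2.2⟩
      have n3 : ¬ (t i = τ ∧ t (i + q + 1) = τ ∧ τ < t (i + q + 2)) :=
        fun h => c1 ⟨by linarith [h.1, h.2.1], h.2.1⟩
      have n4 : ¬ (t i < τ ∧ t (i + 1) = τ ∧ t (i + q + 2) = τ) :=
        fun h => c1 ⟨h.2.1, by linarith [h.2.1, h.2.2]⟩
      rw [if_neg n1, if_neg n2, if_neg n3, if_neg n4]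
      ring

/-! ### Continuity and one-sided derivatives of univariate B-splines. -/

namespace KnotVector

variable (K : KnotVector)

/-- The B-splines of a knot vector. -/
abbrev N (i : Fin K.n) : ℝ → ℝ := bspline K.t K.p i

lemma t_nonneg (i : ℕ) : 0 ≤ K.t i := by
  rw [← K.t_first 0 (Nat.zero_le _)]; exact K.mono (Nat.zero_le _)

lemma t_le_one (i : ℕ) : K.t i ≤ 1 := by
  rw [← K.t_last (max i K.n) (le_max_right _ _)]; exact K.mono (le_max_left _ _)

lemma lt_n_of_span {a : ℕ} (ha : K.t a < K.t (a + 1)) : a < K.n := by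
  by_contra h
  have := K.t_last a (by omega)
  linarith [K.t_le_one (a + 1)]

/-- The multiplicity bound at index 1, where the knot is still 0, forces the knot `p + 1` to be
positive. -/
lemma first_span : K.t K.p = 0 ∧ K.t K.p < K.t (K.p + 1) := by
  have h0 := K.t_first K.p le_rfl
  have h1 := K.t_first 1 K.one_le_p
  have := K.mult_le 1 le_rfl (lt_of_le_of_lt K.one_le_p K.p_lt_n)
  rw [add_comm 1] at this
  exact ⟨h0, by linarith⟩

lemma last_span : K.t (K.n - 1 + 1) = 1 ∧ K.t (K.n - 1) < K.t (K.n - 1 + 1) := by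
  have h2 := K.one_le_p
  have h3 := K.p_lt_n
  have h0 := K.t_last (K.n - 1 + 1) (by omega)
  have := K.mult_le (K.n - 1) (by omega) (by omega)
  rw [K.t_last (K.n - 1 + K.p) (by omega)] at this
  exact ⟨h0, by linarith⟩

lemma exists_span {x : ℝ} (h0 : 0 ≤ x) (h1 : x < 1) : ∃ a, K.t a ≤ x ∧ x < K.t (a + 1) := by
  by_contra! h
  have : ∀ a, K.t a ≤ x := by
    intro a
    induction a with
    | zero => rw [K.t_first 0 (Nat.zero_le _)]; exact h0
    | succ a ih => exact h a ih
  have := this K.n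
  rw [K.t_last _ le_rfl] at this
  linarith

/-- On every closed nonempty knot span, a B-spline is a polynomial. -/
lemma N_eq_eval (i : Fin K.n) {a : ℕ} (ha : K.t a < K.t (a + 1)) {x : ℝ}
    (hx : x ∈ Icc (K.t a) (K.t (a + 1))) :
    K.N i x = (bsplinePiece K.t a K.p i).eval x := by
  rcases hx.2.lt_or_eq with h | h
  · exact bspline_eq_eval K.mono K.t_le_one ha (Or.inl ⟨hx.1, h⟩) _ _
  rcases (K.t_le_one (a + 1)).lt_or_eq with h1 | h1
  · obtain ⟨b, hb, hb'⟩ := K.exists_span (x := x) ((K.t_nonneg _).trans hx.1) (by linarith)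
    have hab : a + 1 ≤ b := by
      by_contra hc
      have := K.mono (show b + 1 ≤ a + 1 by omega)
      linarith
    have hbx : K.t b = x := le_antisymm hb (by rw [h]; exact K.mono hab)
    -- The right end of the span belongs to the next nonempty span `b`, so the two pieces must agree
    -- there. The multiplicity bound excludes both indicators of the jump formula; the extreme
    -- indices, which it does not cover, would place the knot at 0 or 1.
    have hj := eval_bsplinePiece_jump K.mono (a := a) (b := b) (τ := x) (by linarith) h.symm hbx
      hb' K.p i
    rw [if_neg, if_neg] at hj
    · rw [KnotVector.N, bspline_eq_eval K.mono K.t_le_one (a := b) (by linarith)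
        (Or.inl ⟨hb, hb'⟩)]
      linarith
    · rintro ⟨h3, h4, h5⟩
      by_cases hi : (i : ℕ) + 1 < K.n
      · have := K.mult_le (i + 1) (by omega) hi
        rw [show (i : ℕ) + 1 + K.p = i + K.p + 1 by ring] at this
        linarith
      · have := K.t_last (i + 1) (by omega)
        linarith
    · rintro ⟨h3, h4, h5⟩
      by_cases hi : 1 ≤ (i : ℕ)
      · have := K.mult_le i hi i.2
        linarith
      · have := K.t_first i (by omega)
        linarith [K.t_nonneg a]
  · exact bspline_eq_eval K.mono K.t_le_one ha (Or.inr ⟨by linarith, h1⟩) _ _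

/-- The points of the unit interval which are not interior knots. -/
def Reg : Set ℝ := {x | x ∈ Icc (0 : ℝ) 1 ∧ ∀ a, K.t a = x → x = 0 ∨ x = 1}

lemma zero_mem_Reg : (0 : ℝ) ∈ K.Reg := ⟨by simp, fun _ _ => Or.inl rfl⟩

lemma one_mem_Reg : (1 : ℝ) ∈ K.Reg := ⟨by simp, fun _ _ => Or.inr rfl⟩

lemma exists_span_mem {x : ℝ} (hx : x ∈ Icc (0 : ℝ) 1) :
    ∃ a, K.t a < K.t (a + 1) ∧ x ∈ Icc (K.t a) (K.t (a + 1)) := by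
  rcases hx.2.lt_or_eq with h | h
  · obtain ⟨a, h1, h2⟩ := K.exists_span hx.1 h
    exact ⟨a, by linarith, h1, h2.le⟩
  · exact ⟨K.n - 1, K.last_span.2, by rw [h]; exact K.t_le_one _, by rw [h, K.last_span.1]⟩

lemma span_nhdsWithin_zero : Icc (K.t K.p) (K.t (K.p + 1)) ∈ 𝓝[Icc (0 : ℝ) 1] 0 := by
  obtain ⟨h1, h2⟩ := K.first_span
  rw [mem_nhdsWithin]
  exact ⟨Iio (K.t (K.p + 1)), isOpen_Iio, by rw [mem_Iio]; linarith,
    fun y hy => ⟨by rw [h1]; exact hy.2.1, (hy.1 : y < _).le⟩⟩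

lemma span_nhdsWithin_one : Icc (K.t (K.n - 1)) (K.t (K.n - 1 + 1)) ∈ 𝓝[Icc (0 : ℝ) 1] 1 := by
  obtain ⟨h1, h2⟩ := K.last_span
  rw [mem_nhdsWithin]
  exact ⟨Ioi (K.t (K.n - 1)), isOpen_Ioi, by rw [mem_Ioi]; linarith,
    fun y hy => ⟨(hy.1 : _ < y).le, by rw [h1]; exact hy.2.2⟩⟩

/-- A regular point is either interior to a span or an end of the unit interval, where the first or
last span is a neighbourhood relative to the interval. Hence every B-spline is a single polynomial
near it. -/
lemma exists_span_nhdsWithin {x : ℝ} (hx : x ∈ K.Reg) :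
    ∃ a, K.t a < K.t (a + 1) ∧ x ∈ Icc (K.t a) (K.t (a + 1)) ∧
      Icc (K.t a) (K.t (a + 1)) ∈ 𝓝[Icc (0 : ℝ) 1] x := by
  by_cases h1 : x = 1
  · subst h1
    exact ⟨K.n - 1, K.last_span.2, mem_of_mem_nhdsWithin (by simp) K.span_nhdsWithin_one,
      K.span_nhdsWithin_one⟩
  by_cases h0 : x = 0
  · subst h0
    exact ⟨K.p, K.first_span.2, mem_of_mem_nhdsWithin (by simp) K.span_nhdsWithin_zero,
      K.span_nhdsWithin_zero⟩
  obtain ⟨a, h2, h3⟩ := K.exists_span hx.1.1 (lt_of_le_of_ne hx.1.2 h1)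
  have h4 : K.t a ≠ x := fun h => by rcases hx.2 a h with h | h <;> contradiction
  exact ⟨a, by linarith, ⟨h2, h3.le⟩,
    mem_nhdsWithin_of_mem_nhds (Icc_mem_nhds (lt_of_le_of_ne h2 h4) h3)⟩

/-- Finitely many closed spans cover the unit interval, and polynomials on closed pieces glue
continuously. -/
lemma continuousOn_N (i : Fin K.n) : ContinuousOn (K.N i) (Icc 0 1) := by
  have hU : Icc (0 : ℝ) 1 ⊆
      ⋃ a ∈ {a | a < K.n ∧ K.t a < K.t (a + 1)}, Icc (K.t a) (K.t (a + 1)) := by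
    intro x hx
    obtain ⟨a, h1, h2⟩ := K.exists_span_mem hx
    exact mem_biUnion (x := a) ⟨K.lt_n_of_span h1, h1⟩ h2
  refine ContinuousOn.mono ?_ hU
  have hf : {a | a < K.n ∧ K.t a < K.t (a + 1)}.Finite :=
    (Set.finite_lt_nat K.n).subset fun a ha => ha.1
  rw [biUnion_eq_iUnion]
  have := hf.to_subtype
  refine LocallyFinite.continuousOn_iUnion (locallyFinite_of_finite _) (fun a => isClosed_Icc)
    fun a => ?_
  exact (Polynomial.continuous _).continuousOn.congr fun x hx => K.N_eq_eval i a.2.2 hx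

/-- The one-sided derivative of a B-spline on the unit interval. -/
def dN (i : Fin K.n) (x : ℝ) : ℝ := derivWithin (K.N i) (Icc 0 1) x

/-- The derivative is identified at all nearby points and not only at `x`, because this also gives
the continuity of `dN` at `x`. -/
lemma eventually_hasDerivWithinAt (i : Fin K.n) {x : ℝ} {a : ℕ} (ha : K.t a < K.t (a + 1))
    (hx : Icc (K.t a) (K.t (a + 1)) ∈ 𝓝[Icc (0 : ℝ) 1] x) :
    ∀ᶠ y in 𝓝[Icc (0 : ℝ) 1] x, HasDerivWithinAt (K.N i)
      ((derivative (bsplinePiece K.t a K.p i)).eval y) (Icc 0 1) y := by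
  have h1 : ∀ᶠ y in 𝓝[Icc (0 : ℝ) 1] x, ∀ᶠ z in 𝓝[Icc (0 : ℝ) 1] y,
      z ∈ Icc (K.t a) (K.t (a + 1)) := eventually_eventually_nhdsWithin.2 hx
  filter_upwards [h1, self_mem_nhdsWithin] with y hy hy1
  refine HasDerivWithinAt.congr_of_eventuallyEq
    ((bsplinePiece K.t a K.p i).hasDerivWithinAt y (Icc 0 1)) ?_ ?_
  · filter_upwards [hy] with z hz using K.N_eq_eval i ha hz
  · exact K.N_eq_eval i ha (mem_of_mem_nhdsWithin hy1 hy)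

lemma eventually_dN_eq (i : Fin K.n) {x : ℝ} {a : ℕ} (ha : K.t a < K.t (a + 1))
    (hx : Icc (K.t a) (K.t (a + 1)) ∈ 𝓝[Icc (0 : ℝ) 1] x) :
    ∀ᶠ y in 𝓝[Icc (0 : ℝ) 1] x, K.dN i y = (derivative (bsplinePiece K.t a K.p i)).eval y := by
  filter_upwards [K.eventually_hasDerivWithinAt i ha hx, self_mem_nhdsWithin] with y hy hy1
  exact hy.derivWithin (uniqueDiffOn_Icc zero_lt_one y hy1)

lemma hasDerivWithinAt_N (i : Fin K.n) {x : ℝ} (hx : x ∈ K.Reg) :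
    HasDerivWithinAt (K.N i) (K.dN i x) (Icc 0 1) x := by
  obtain ⟨a, h1, h2, h3⟩ := K.exists_span_nhdsWithin hx
  rw [(K.eventually_dN_eq i h1 h3).self_of_nhdsWithin hx.1]
  exact (K.eventually_hasDerivWithinAt i h1 h3).self_of_nhdsWithin hx.1

lemma continuousOn_dN (i : Fin K.n) : ContinuousOn (K.dN i) K.Reg := by
  intro x hx
  obtain ⟨a, h1, h2, h3⟩ := K.exists_span_nhdsWithin hx
  have h4 := K.eventually_dN_eq i h1 h3
  refine ContinuousWithinAt.mono (t := Icc 0 1) ?_ fun y hy => hy.1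
  exact (Polynomial.continuous _).continuousWithinAt.congr_of_eventuallyEq h4
    (h4.self_of_nhdsWithin hx.1)

lemma exists_bound_eval (P : ℝ[X]) : ∃ B, ∀ x ∈ Icc (0 : ℝ) 1, |P.eval x| ≤ B := by
  obtain ⟨B, hB⟩ := (isCompact_Icc (a := (0 : ℝ)) (b := 1)).exists_bound_of_continuousOn
    P.continuous.continuousOn
  exact ⟨B, hB⟩

lemma exists_bound_N (i : Fin K.n) : ∃ B, ∀ x ∈ Icc (0 : ℝ) 1, |K.N i x| ≤ B :=
  (isCompact_Icc (a := (0 : ℝ)) (b := 1)).exists_bound_of_continuousOn (K.continuousOn_N i)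

/-- The set of regular points need not be compact, so the bound is taken from the finitely many
polynomial pieces; the sum of their bounds replaces the maximum. -/
lemma exists_bound_dN (i : Fin K.n) : ∃ B, ∀ x ∈ K.Reg, |K.dN i x| ≤ B := by
  choose B hB using fun a => exists_bound_eval (derivative (bsplinePiece K.t a K.p i))
  refine ⟨∑ a ∈ Finset.range K.n, |B a|, fun x hx => ?_⟩
  obtain ⟨a, h1, h2, h3⟩ := K.exists_span_nhdsWithin hx
  rw [(K.eventually_dN_eq i h1 h3).self_of_nhdsWithin hx.1]
  exact ((hB a x hx.1).trans (le_abs_self _)).trans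
    (Finset.single_le_sum (f := fun a => |B a|) (fun _ _ => abs_nonneg _)
      (Finset.mem_range.2 (K.lt_n_of_span h1)))

/-- In the interior of a knot span all points are regular. -/
lemma mem_Reg_of_mem_Ioo {a : ℕ} {x : ℝ} (hx : x ∈ Ioo (K.t a) (K.t (a + 1))) : x ∈ K.Reg := by
  refine ⟨⟨(K.t_nonneg a).trans hx.1.le, hx.2.le.trans (K.t_le_one _)⟩, fun b hb => ?_⟩
  exfalso
  rcases Nat.lt_or_ge a b with h | h
  · linarith [K.mono (show a + 1 ≤ b from h), hx.2]
  · linarith [K.mono h, hx.1]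

lemma dN_eq_of_mem_Ioo (i : Fin K.n) {a : ℕ} {x : ℝ} (hx : x ∈ Ioo (K.t a) (K.t (a + 1))) :
    K.dN i x = (derivative (bsplinePiece K.t a K.p i)).eval x :=
  (K.eventually_dN_eq i (hx.1.trans hx.2) (mem_nhdsWithin_of_mem_nhds
    (Icc_mem_nhds hx.1 hx.2))).self_of_nhdsWithin (K.mem_Reg_of_mem_Ioo hx).1

end KnotVector

/-! ## An inverse inequality for polynomials -/

/-- Equivalence of norms in finite dimension. The squared L² norm is a continuous, 2-homogeneous
function of the coefficients and is positive off zero, so it has a positive minimum on the unit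
sphere. The values on the unit interval are at most `m + 1` times the largest coefficient. -/
lemma exists_eval_sq_le_integral_unit (m : ℕ) : ∃ C : ℝ, 0 < C ∧ ∀ P : ℝ[X], P.natDegree ≤ m →
    ∀ x ∈ Icc (0 : ℝ) 1, (P.eval x) ^ 2 ≤ C * ∫ s in (0 : ℝ)..1, (P.eval s) ^ 2 := by
  let f : (Fin (m + 1) → ℝ) → ℝ → ℝ := fun c x => ∑ i, c i * x ^ (i : ℕ)
  let Q : (Fin (m + 1) → ℝ) → ℝ := fun c => ∫ s in (0 : ℝ)..1, (f c s) ^ 2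
  have hf : Continuous (Function.uncurry f) := by
    simp only [f, Function.uncurry_def]
    fun_prop
  have hQ : Continuous Q :=
    intervalIntegral.continuous_parametric_intervalIntegral_of_continuous'
      (f := fun c s => (f c s) ^ 2) (by simp only [f, Function.uncurry_def]; fun_prop) 0 1
  have hpos : ∀ c, c ≠ 0 → 0 < Q c := by
    intro c hc
    refine intervalIntegral.integral_pos zero_lt_one
      (Continuous.continuousOn (by simp only [f]; fun_prop)) (fun x _ => sq_nonneg _) ?_
    by_contra! h
    let P : ℝ[X] := ∑ i : Fin (m + 1), C (c i) * X ^ (i : ℕ)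
    have hP : P = 0 := by
      refine Polynomial.eq_zero_of_infinite_isRoot P
        ((Icc_infinite (zero_lt_one (α := ℝ))).mono fun x hx => ?_)
      have h1 : f c x = 0 := pow_eq_zero_iff (two_ne_zero) |>.1 (le_antisymm (h x hx) (sq_nonneg _))
      simpa [P, f, eval_finsetSum] using h1
    apply hc
    funext i
    have : P.coeff i = c i := by
      simp only [P, finsetSum_coeff, coeff_C_mul_X_pow]
      rw [Finset.sum_eq_single i]
      · simp
      · intro j _ hj
        rw [if_neg (fun h => hj (Fin.ext h.symm))]
      · simp
    rw [← this, hP]; simp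
  obtain ⟨c₀, hc₀, hmin⟩ := (isCompact_sphere (0 : Fin (m + 1) → ℝ) 1).exists_isMinOn
    (NormedSpace.sphere_nonempty.2 zero_le_one) hQ.continuousOn
  have hc₀' : c₀ ≠ 0 := by
    rintro rfl
    simp at hc₀
  have hμ := hpos c₀ hc₀'
  refine ⟨(m + 1) ^ 2 / Q c₀, by positivity, fun P hP x hx => ?_⟩
  let c : Fin (m + 1) → ℝ := fun i => P.coeff i
  have hev : ∀ s, P.eval s = f c s := by
    intro s
    rw [eval_eq_sum_range' (Nat.lt_succ_of_le hP), Finset.sum_range]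
  simp only [hev]
  change _ ≤ _ * Q c
  by_cases hc : c = 0
  · have : f c x = 0 := by simp [f, hc]
    rw [this, zero_pow two_ne_zero]
    have : Q c = 0 := by simp [Q, f, hc]
    rw [this]; simp
  have hn : 0 < ‖c‖ := norm_pos_iff.2 hc
  have h1 : |f c x| ≤ (m + 1) * ‖c‖ := by
    refine (Finset.abs_sum_le_sum_abs _ _).trans ?_
    have : ∀ i ∈ (Finset.univ : Finset (Fin (m + 1))), |c i * x ^ (i : ℕ)| ≤ ‖c‖ := by
      intro i _
      rw [abs_mul, abs_pow, abs_of_nonneg hx.1]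
      have h2 : x ^ (i : ℕ) ≤ 1 := pow_le_one₀ hx.1 hx.2
      have h3 : |c i| ≤ ‖c‖ := norm_le_pi_norm c i
      have h4 : 0 ≤ x ^ (i : ℕ) := pow_nonneg hx.1 _
      nlinarith [abs_nonneg (c i)]
    refine (Finset.sum_le_card_nsmul _ _ _ this).trans ?_
    simp
  have h2 : Q c₀ * ‖c‖ ^ 2 ≤ Q c := by
    have h3 : ‖c‖⁻¹ • c ∈ Metric.sphere (0 : Fin (m + 1) → ℝ) 1 := by
      simp [norm_smul, hn.ne']
    have h4 : Q c₀ ≤ Q (‖c‖⁻¹ • c) := hmin h3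
    have h5 : Q (‖c‖⁻¹ • c) = (‖c‖⁻¹) ^ 2 * Q c := by
      have : ∀ s, f (‖c‖⁻¹ • c) s = ‖c‖⁻¹ * f c s := by
        intro s
        simp only [f, Pi.smul_apply, smul_eq_mul, Finset.mul_sum, mul_assoc]
      simp only [Q, this, mul_pow]
      exact intervalIntegral.integral_const_mul _ _
    rw [h5] at h4
    calc Q c₀ * ‖c‖ ^ 2 ≤ (‖c‖⁻¹) ^ 2 * Q c * ‖c‖ ^ 2 := by gcongr
      _ = Q c := by field_simp
  calc (f c x) ^ 2 = |f c x| ^ 2 := (sq_abs _).symm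
    _ ≤ ((m + 1) * ‖c‖) ^ 2 := by gcongr
    _ = (m + 1) ^ 2 / Q c₀ * (Q c₀ * ‖c‖ ^ 2) := by field_simp
    _ ≤ (m + 1) ^ 2 / Q c₀ * Q c := by gcongr

/-- The inverse inequality between the maximum norm and the `L²` norm of a polynomial. -/
lemma exists_eval_sq_le_integral (m : ℕ) : ∃ C : ℝ, 0 < C ∧ ∀ P : ℝ[X], P.natDegree ≤ m →
    ∀ a b : ℝ, a < b → ∀ x ∈ Icc a b,
      (b - a) * (P.eval x) ^ 2 ≤ C * ∫ s in a..b, (P.eval s) ^ 2 := by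
  obtain ⟨C₁, hC₁, h⟩ := exists_eval_sq_le_integral_unit m
  refine ⟨C₁, hC₁, fun P hP a b hab x hx => ?_⟩
  have hba : 0 < b - a := sub_pos.2 hab
  have hdeg : (P.comp (C a + C (b - a) * X)).natDegree ≤ m := by
    refine natDegree_comp_le.trans ?_
    have : (C a + C (b - a) * X : ℝ[X]).natDegree ≤ 1 := by
      rw [add_comm]; exact natDegree_linear_le
    nlinarith
  have h1 := h _ hdeg ((x - a) / (b - a))
    ⟨div_nonneg (by linarith [hx.1]) hba.le, (div_le_one hba).2 (by linarith [hx.2])⟩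
  simp only [eval_comp, eval_add, eval_C, eval_mul, eval_X] at h1
  rw [mul_div_cancel₀ _ hba.ne', add_sub_cancel] at h1
  have h2 := intervalIntegral.mul_integral_comp_add_mul (a := 0) (b := 1)
    (f := fun s => (P.eval s) ^ 2) (b - a) a
  simp only [mul_zero, add_zero, mul_one, add_sub_cancel] at h2
  rw [← h2]
  calc (b - a) * (P.eval x) ^ 2
      ≤ (b - a) * (C₁ * ∫ s in (0 : ℝ)..1, (P.eval (a + (b - a) * s)) ^ 2) := by gcongr
    _ = _ := by ring

/-! ## Bounds for determinants -/

/-- The image of the unit ball contains the ball of radius `c`; comparing volumes gives the bound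
without singular values. -/
lemma pow_le_abs_det {d : ℕ} {A : E d →L[ℝ] E d} {c : ℝ} (hc : 0 < c)
    (hA : ∀ v, c * ‖v‖ ≤ ‖A v‖) : c ^ d ≤ |A.det| := by
  have hinj : Function.Injective A := by
    refine (injective_iff_map_eq_zero A).2 fun v hv => ?_
    have := hA v
    rw [hv, norm_zero] at this
    exact norm_eq_zero.1 (le_antisymm (by nlinarith [norm_nonneg v]) (norm_nonneg v))
  have hsurj : Function.Surjective A :=
    (LinearMap.injective_iff_surjective (f := (A : E d →ₗ[ℝ] E d))).1 hinj
  have hsub : Metric.ball (0 : E d) c ⊆ A '' Metric.ball 0 1 := by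
    intro y hy
    obtain ⟨v, rfl⟩ := hsurj y
    refine ⟨v, ?_, rfl⟩
    rw [mem_ball_zero_iff] at hy ⊢
    have := hA v
    nlinarith
  have h := measure_mono (μ := volume) hsub
  rw [Measure.addHaar_image_continuousLinearMap, Measure.addHaar_ball_of_pos _ _ hc,
    finrank_euclideanSpace_fin] at h
  have hb : 0 < volume (Metric.ball (0 : E d) 1) := Metric.measure_ball_pos _ _ one_pos
  have hb' : volume (Metric.ball (0 : E d) 1) ≠ ⊤ := measure_ball_lt_top.ne
  rw [ENNReal.mul_le_mul_iff_left hb.ne' hb'] at h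
  exact (ENNReal.ofReal_le_ofReal_iff (abs_nonneg _)).1 h

lemma abs_det_le_pow {d : ℕ} {A : E d →L[ℝ] E d} {c : ℝ} (hc : 0 ≤ c)
    (hA : ∀ v, ‖A v‖ ≤ c * ‖v‖) : |A.det| ≤ c ^ d := by
  have hsub : A '' Metric.closedBall (0 : E d) 1 ⊆ Metric.closedBall 0 c := by
    rintro _ ⟨v, hv, rfl⟩
    rw [mem_closedBall_zero_iff] at hv ⊢
    have := hA v
    nlinarith
  have h := measure_mono (μ := volume) hsub
  rw [Measure.addHaar_image_continuousLinearMap, Measure.addHaar_closedBall _ _ hc,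
    Measure.addHaar_closedBall _ _ zero_le_one, one_pow, ENNReal.ofReal_one, one_mul,
    finrank_euclideanSpace_fin] at h
  have hb : 0 < volume (Metric.ball (0 : E d) 1) := Metric.measure_ball_pos _ _ one_pos
  have hb' : volume (Metric.ball (0 : E d) 1) ≠ ⊤ := measure_ball_lt_top.ne
  rw [ENNReal.mul_le_mul_iff_left hb.ne' hb'] at h
  exact (ENNReal.ofReal_le_ofReal_iff (by positivity)).1 h

/-! ## Existence of orthogonal corrections -/

/-- For a positive semidefinite symmetric form, every vector can be made orthogonal to a
finite-dimensional subspace by adding an element of this subspace. -/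
lemma exists_add_orthogonal {X : Type*} [AddCommGroup X] [Module ℝ X] (B : LinearMap.BilinForm ℝ X)
    (hs : ∀ x y, B x y = B y x) (hp : ∀ x, 0 ≤ B x x) (Y : Submodule ℝ X) [FiniteDimensional ℝ Y]
    (u : X) : ∃ y ∈ Y, ∀ v ∈ Y, B (u + y) v = 0 := by
  let T : Y →ₗ[ℝ] Module.Dual ℝ Y := (B.domRestrict₁₂ Y Y)
  -- Symmetry gives one inclusion, and the dimensions agree.
  have hrange : T.range = (LinearMap.ker T).dualAnnihilator := by
    refine Submodule.eq_of_le_of_finrank_eq ?_ ?_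
    · rintro _ ⟨y, rfl⟩
      rw [Submodule.mem_dualAnnihilator]
      intro v hv
      have h1 : T v y = 0 := by rw [LinearMap.mem_ker.1 hv]; rfl
      have h2 : T y v = T v y := hs _ _
      rw [h2, h1]
    · have h1 := LinearMap.finrank_range_add_finrank_ker T
      have h2 := Subspace.finrank_add_finrank_dualAnnihilator_eq (LinearMap.ker T)
      omega
  have hmem : (B u).domRestrict Y ∈ T.range := by
    rw [hrange, Submodule.mem_dualAnnihilator]
    intro v hv
    have h1 : B v v = 0 := by
      have h2 : T v v = 0 := by rw [LinearMap.mem_ker.1 hv]; rfl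
      exact h2
    -- Cauchy–Schwarz for a semidefinite form: a vector of zero energy is orthogonal to all of `X`,
    -- so the right-hand side annihilates the kernel and the system is solvable.
    have h2 := LinearMap.BilinForm.apply_sq_le_of_symm (B := B) hp ⟨hs⟩ u (v : X)
    rw [h1, mul_zero] at h2
    exact pow_eq_zero_iff two_ne_zero |>.1 (le_antisymm h2 (sq_nonneg _))
  obtain ⟨y, hy⟩ := hmem
  refine ⟨-(y : X), Y.neg_mem y.2, fun v hv => ?_⟩
  have h1 : B y v = B u v := LinearMap.congr_fun hy ⟨v, hv⟩
  rw [map_add, map_neg, LinearMap.add_apply, LinearMap.neg_apply, h1, add_neg_cancel]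

/-! ## Boxes -/

/-- The product of subsets of the coordinate axes. -/
def box {d : ℕ} (A : Fin d → Set ℝ) : Set (E d) := {ξ | ∀ i, ξ i ∈ A i}

section box

variable {d : ℕ}

lemma box_eq_preimage (A : Fin d → Set ℝ) :
    box A = (EuclideanSpace.equiv (Fin d) ℝ).toHomeomorph ⁻¹' Set.univ.pi A := by
  ext ξ; simp [box]

lemma closure_box (A : Fin d → Set ℝ) : closure (box A) = box fun i => closure (A i) := by
  rw [box_eq_preimage, box_eq_preimage, ← Homeomorph.preimage_closure, closure_pi_set]

lemma isOpen_box {A : Fin d → Set ℝ} (hA : ∀ i, IsOpen (A i)) : IsOpen (box A) := by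
  rw [box_eq_preimage]
  exact (isOpen_set_pi finite_univ fun i _ => hA i).preimage (Homeomorph.continuous _)

lemma isCompact_box {A : Fin d → Set ℝ} (hA : ∀ i, IsCompact (A i)) : IsCompact (box A) := by
  rw [box_eq_preimage, Homeomorph.isCompact_preimage]
  exact isCompact_univ_pi hA

lemma convex_box {A : Fin d → Set ℝ} (hA : ∀ i, Convex ℝ (A i)) : Convex ℝ (box A) := by
  intro x hx y hy a b ha hb hab i
  exact hA i (hx i) (hy i) ha hb hab

lemma box_mono {A B : Fin d → Set ℝ} (h : ∀ i, A i ⊆ B i) : box A ⊆ box B :=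
  fun _ hx i => h i (hx i)

lemma volume_box (A : Fin d → Set ℝ) : volume (box A) = ∏ i, volume (A i) := by
  have h := (EuclideanSpace.volume_preserving_symm_measurableEquiv_toLp
    (Fin d)).measure_preimage_equiv (Set.univ.pi A)
  rw [volume_pi_pi] at h
  rw [← h]
  congr 1
  ext ξ; simp [box]

lemma cube_eq_box : cube d = box fun _ => Icc 0 1 := rfl

lemma openCube_eq_box : openCube d = box fun _ => Ioo 0 1 := rfl

lemma isCompact_cube : IsCompact (cube d) := isCompact_box fun _ => isCompact_Icc

lemma measurableSet_cube : MeasurableSet (cube d) := isCompact_cube.measurableSet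

lemma isOpen_openCube : IsOpen (openCube d) := isOpen_box fun _ => isOpen_Ioo

lemma convex_cube : Convex ℝ (cube d) := convex_box fun _ => convex_Icc 0 1

lemma openCube_subset_cube : openCube d ⊆ cube d := box_mono fun _ => Ioo_subset_Icc_self

lemma closure_openCube : closure (openCube d) = cube d := by
  rw [openCube_eq_box, closure_box, closure_Ioo zero_ne_one, cube_eq_box]

lemma nonempty_openCube : (openCube d).Nonempty :=
  ⟨WithLp.toLp 2 fun _ => 1 / 2, fun i => by norm_num⟩

lemma uniqueDiffOn_cube : UniqueDiffOn ℝ (cube d) :=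
  uniqueDiffOn_convex convex_cube
    (nonempty_openCube.mono (interior_maximal openCube_subset_cube isOpen_openCube))

lemma ae_coord_ne (j : Fin d) (τ : ℝ) : ∀ᵐ ξ : E d, ξ j ≠ τ := by
  have h := (EuclideanSpace.volume_preserving_symm_measurableEquiv_toLp
    (Fin d)).quasiMeasurePreserving.ae (Measure.ae_eval_ne (μ := fun _ => volume) j τ)
  exact h

end box

namespace Patch

variable {d : ℕ} (P : Patch d)

/-! ## Regular points of the parameter domain -/

/-- The points of the cube none of whose coordinates is an interior knot. -/
def Reg : Set (E d) := {ξ | ∀ j, ξ j ∈ (P.knots j).Reg}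

/-- The union of the open cells of the parameter domain. -/
def Opn : Set (E d) := {ξ | ξ ∈ cube d ∧ ∀ j a, ξ j ≠ (P.knots j).t a}

lemma Reg_subset_cube : P.Reg ⊆ cube d := fun _ hξ i => (hξ i).1

lemma Opn_subset_cube : P.Opn ⊆ cube d := fun _ hξ => hξ.1

/-- The two sets serve different integrals: `Opn` has full measure in the cube, while `Reg` also
contains almost every point of each face, which is needed for traces of gradients. -/
lemma Opn_subset_Reg : P.Opn ⊆ P.Reg :=
  fun _ hξ j => ⟨hξ.1 j, fun a ha => absurd ha.symm (hξ.2 j a)⟩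

lemma Opn_subset_openCube : P.Opn ⊆ openCube d := fun ξ hξ j => by
  have h0 := hξ.2 j 0
  have h1 := hξ.2 j (P.knots j).n
  rw [(P.knots j).t_first 0 (Nat.zero_le _)] at h0
  rw [(P.knots j).t_last _ le_rfl] at h1
  exact ⟨lt_of_le_of_ne (hξ.1 j).1 h0.symm, lt_of_le_of_ne (hξ.1 j).2 h1⟩

lemma measurableSet_Opn : MeasurableSet P.Opn := by
  have : P.Opn = cube d ∩ ⋂ j, ⋂ a, {ξ : E d | ξ j ≠ (P.knots j).t a} := by
    ext ξ; simp [Opn]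
  rw [this]
  refine measurableSet_cube.inter (MeasurableSet.iInter fun j => MeasurableSet.iInter fun a => ?_)
  exact (isOpen_ne_fun (by fun_prop) continuous_const).measurableSet

lemma ae_mem_Opn : ∀ᵐ ξ : E d, ξ ∈ cube d → ξ ∈ P.Opn := by
  have : ∀ᵐ ξ : E d, ∀ j a, ξ j ≠ (P.knots j).t a := by
    rw [ae_all_iff]; intro j
    rw [ae_all_iff]; intro a
    exact ae_coord_ne j _
  filter_upwards [this] with ξ hξ h using ⟨h, hξ⟩

lemma volume_cube_diff_Opn : volume (cube d \ P.Opn) = 0 := by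
  rw [← nonpos_iff_eq_zero]
  refine (measure_mono ?_).trans (le_of_eq (ae_iff.1 P.ae_mem_Opn))
  intro ξ hξ h
  exact hξ.2 (h hξ.1)

lemma Opn_ae_eq_cube : P.Opn =ᵐ[volume] cube d := by
  refine eventuallyLE_antisymm_iff.2 ⟨P.Opn_subset_cube.eventuallyLE, ?_⟩
  filter_upwards [P.ae_mem_Opn] with ξ hξ using hξ

/-! ## Splines -/

variable {F : Type*} [NormedAddCommGroup F] [NormedSpace ℝ F]

/-- The spline with coefficients `c` on the parameter domain. -/
def spl (c : P.Idx → F) (ξ : E d) : F := ∑ i : P.Idx, P.tbspline i ξ • c i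

/-- The partial derivatives of the tensor product B-splines. -/
def pd (i : P.Idx) (j : Fin d) (ξ : E d) : ℝ :=
  ∏ m, if m = j then (P.knots m).dN (i m) (ξ m) else (P.knots m).N (i m) (ξ m)

/-- The derivative of a spline. -/
def dspl (c : P.Idx → F) (ξ : E d) : E d →L[ℝ] F :=
  ∑ i : P.Idx, (∑ j, P.pd i j ξ • (EuclideanSpace.proj j : E d →L[ℝ] ℝ)).smulRight (c i)

lemma hasFDerivWithinAt_tbspline (i : P.Idx) {ξ : E d} (hξ : ξ ∈ P.Reg) :
    HasFDerivWithinAt (P.tbspline i)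
      (∑ j, P.pd i j ξ • (EuclideanSpace.proj j : E d →L[ℝ] ℝ)) (cube d) ξ := by
  have h1 : ∀ j ∈ Finset.univ, HasFDerivWithinAt (fun ξ : E d => (P.knots j).N (i j) (ξ j))
      ((P.knots j).dN (i j) (ξ j) • (EuclideanSpace.proj j : E d →L[ℝ] ℝ)) (cube d) ξ := by
    intro j _
    have h2 : HasFDerivWithinAt (fun ξ : E d => ξ j) (EuclideanSpace.proj j : E d →L[ℝ] ℝ)
        (cube d) ξ := (EuclideanSpace.proj j : E d →L[ℝ] ℝ).hasFDerivWithinAt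
    exact ((P.knots j).hasDerivWithinAt_N (i j) (hξ j)).comp_hasFDerivWithinAt
      (f := fun ξ : E d => ξ j) ξ h2 (fun η hη => hη j)
  have h3 := HasFDerivWithinAt.finsetProd h1
  refine h3.congr_fderiv (Finset.sum_congr rfl fun j _ => ?_)
  rw [smul_smul]
  congr 1
  rw [pd, ← Finset.mul_prod_erase _ _ (Finset.mem_univ j), if_pos rfl, mul_comm]
  congr 1
  exact Finset.prod_congr rfl fun m hm => (if_neg (Finset.ne_of_mem_erase hm)).symm

lemma hasFDerivWithinAt_spl (c : P.Idx → F) {ξ : E d} (hξ : ξ ∈ P.Reg) :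
    HasFDerivWithinAt (P.spl c) (P.dspl c ξ) (cube d) ξ :=
  HasFDerivWithinAt.fun_sum fun i _ => (P.hasFDerivWithinAt_tbspline i hξ).smul_const (c i)

lemma continuousOn_tbspline (i : P.Idx) : ContinuousOn (P.tbspline i) (cube d) := by
  refine continuousOn_finsetProd _ fun j _ => ?_
  exact ((P.knots j).continuousOn_N (i j)).comp (Continuous.continuousOn (by fun_prop))
    fun ξ hξ => hξ j

lemma continuousOn_spl (c : P.Idx → F) : ContinuousOn (P.spl c) (cube d) :=
  continuousOn_finsetSum _ fun i _ => (P.continuousOn_tbspline i).smul continuousOn_const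

/-- The mapping is by definition the spline whose coefficients are the control points, which is why
splines take values in a general space `F`. -/
lemma continuousOn_G : ContinuousOn P.G (cube d) := P.continuousOn_spl _

lemma continuousOn_pd (i : P.Idx) (j : Fin d) : ContinuousOn (P.pd i j) P.Reg := by
  refine continuousOn_finsetProd _ fun m _ => ?_
  by_cases h : m = j
  · simp only [if_pos h]
    exact ((P.knots m).continuousOn_dN (i m)).comp (Continuous.continuousOn (by fun_prop))
      fun ξ hξ => hξ m
  · simp only [if_neg h]
    exact ((P.knots m).continuousOn_N (i m)).comp (Continuous.continuousOn (by fun_prop))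
      fun ξ hξ => (hξ m).1

lemma continuousOn_dspl (c : P.Idx → F) : ContinuousOn (P.dspl c) P.Reg := by
  have h : ∀ ξ, P.dspl c ξ = ∑ i : P.Idx, ∑ j, P.pd i j ξ •
      (EuclideanSpace.proj j : E d →L[ℝ] ℝ).smulRight (c i) := by
    intro ξ
    refine Finset.sum_congr rfl fun i _ => ?_
    ext v
    simp [Finset.sum_smul, smul_smul]
  refine ContinuousOn.congr ?_ fun ξ _ => h ξ
  exact continuousOn_finsetSum _ fun i _ => continuousOn_finsetSum _ fun j _ =>
    (P.continuousOn_pd i j).smul continuousOn_const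

lemma exists_bound_pd (i : P.Idx) (j : Fin d) : ∃ B, ∀ ξ ∈ P.Reg, |P.pd i j ξ| ≤ B := by
  choose B₁ h₁ using fun m => (P.knots m).exists_bound_N (i m)
  choose B₂ h₂ using fun m => (P.knots m).exists_bound_dN (i m)
  refine ⟨∏ m, if m = j then B₂ m else B₁ m, fun ξ hξ => ?_⟩
  rw [pd, Finset.abs_prod]
  refine Finset.prod_le_prod (fun m _ => abs_nonneg _) fun m _ => ?_
  split_ifs
  · exact h₂ m _ (hξ m)
  · exact h₁ m _ (hξ m).1

lemma dspl_apply_single (c : P.Idx → F) (ξ : E d) (j : Fin d) :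
    P.dspl c ξ (EuclideanSpace.single j 1) = ∑ i : P.Idx, P.pd i j ξ • c i := by
  simp only [dspl, _root_.sum_apply, ContinuousLinearMap.smulRight_apply]
  refine Finset.sum_congr rfl fun i _ => ?_
  congr 1
  simp

lemma exists_bound_dspl (c : P.Idx → F) : ∃ B, ∀ ξ ∈ P.Reg, ‖P.dspl c ξ‖ ≤ B := by
  choose B h using fun i j => P.exists_bound_pd i j
  refine ⟨∑ i, (∑ j, |B i j| * ‖(EuclideanSpace.proj j : E d →L[ℝ] ℝ)‖) * ‖c i‖, fun ξ hξ => ?_⟩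
  refine (norm_sum_le _ _).trans (Finset.sum_le_sum fun i _ => ?_)
  rw [ContinuousLinearMap.norm_smulRight_apply]
  refine mul_le_mul_of_nonneg_right ?_ (norm_nonneg _)
  refine (norm_sum_le _ _).trans (Finset.sum_le_sum fun j _ => ?_)
  rw [norm_smul]
  exact mul_le_mul_of_nonneg_right ((h i j ξ hξ).trans (le_abs_self _)) (norm_nonneg _)

/-! ## The cells -/

lemma cell_eq_box (c : Fin d → ℕ) :
    P.cell c = box fun i => Icc ((P.knots i).t (c i)) ((P.knots i).t (c i + 1)) := rfl

lemma cell_subset_cube (c : Fin d → ℕ) : P.cell c ⊆ cube d :=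
  box_mono fun i _ hx => ⟨((P.knots i).t_nonneg _).trans hx.1, hx.2.trans ((P.knots i).t_le_one _)⟩

lemma exists_mem_cell {ξ : E d} (hξ : ξ ∈ cube d) : ∃ c ∈ P.cellIdx, ξ ∈ P.cell c := by
  choose c h1 h2 using fun j => (P.knots j).exists_span_mem (hξ j)
  exact ⟨c, h1, h2⟩

/-- The interior of a cell. -/
def openCell (c : Fin d → ℕ) : Set (E d) :=
  box fun i => Ioo ((P.knots i).t (c i)) ((P.knots i).t (c i + 1))

lemma closure_openCell {c : Fin d → ℕ} (hc : c ∈ P.cellIdx) :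
    closure (P.openCell c) = P.cell c := by
  rw [openCell, closure_box, cell_eq_box]
  congr 1
  funext i
  exact closure_Ioo (hc i).ne

lemma openCell_subset_Reg (c : Fin d → ℕ) : P.openCell c ⊆ P.Reg :=
  fun _ hξ j => (P.knots j).mem_Reg_of_mem_Ioo (hξ j)

/-- The polynomial piece extends differentiably beyond the closed cell. Thus null sets can be mapped
cell by cell, including parts lying on interior knots, where the mapping itself may have a kink. -/
lemma exists_differentiable_eqOn_cell {c : Fin d → ℕ} (hc : c ∈ P.cellIdx) :
    ∃ g : E d → E d, Differentiable ℝ g ∧ EqOn P.G g (P.cell c) := by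
  refine ⟨fun ξ => ∑ i : P.Idx, (∏ j, (bsplinePiece (P.knots j).t (c j) (P.knots j).p (i j)).eval
    (ξ j)) • P.ctrl i, ?_, fun ξ hξ => ?_⟩
  · refine Differentiable.fun_sum fun i _ => Differentiable.smul_const ?_ _
    have h : ∀ j, Differentiable ℝ fun ξ : E d =>
        (bsplinePiece (P.knots j).t (c j) (P.knots j).p (i j)).eval (ξ j) := fun j =>
      (Polynomial.differentiable (bsplinePiece (P.knots j).t (c j) (P.knots j).p
        (i j))).comp (by fun_prop : Differentiable ℝ fun ξ : E d => ξ j)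
    exact fun ξ => (HasFDerivAt.finsetProd fun j _ => (h j ξ).hasFDerivAt).differentiableAt
  · refine Finset.sum_congr rfl fun i _ => ?_
    congr 1
    exact Finset.prod_congr rfl fun j _ => (P.knots j).N_eq_eval (i j) (hc j) (hξ j)

/-- The geometrical mapping preserves null sets. -/
lemma volume_image_G_eq_zero {Z : Set (E d)} (hZ : Z ⊆ cube d) (h0 : volume Z = 0) :
    volume (P.G '' Z) = 0 := by
  have hsub : P.G '' Z ⊆ ⋃ c ∈ P.cellIdx, P.G '' (Z ∩ P.cell c) := by
    rintro _ ⟨ξ, hξ, rfl⟩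
    obtain ⟨c, hc, h⟩ := P.exists_mem_cell (hZ hξ)
    exact mem_biUnion hc ⟨ξ, ⟨hξ, h⟩, rfl⟩
  refine measure_mono_null hsub ((measure_biUnion_null_iff (to_countable _)).2 fun c hc => ?_)
  obtain ⟨g, hg, he⟩ := P.exists_differentiable_eqOn_cell hc
  rw [(he.mono inter_subset_right).image_eq]
  exact addHaar_image_eq_zero_of_differentiableOn_of_addHaar_eq_zero _ hg.differentiableOn
    (measure_mono_null inter_subset_left h0)

/-! ## The Jacobian -/

lemma jac_eq {ξ : E d} (hξ : ξ ∈ P.Reg) : P.jac ξ = P.dspl P.ctrl ξ :=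
  (P.hasFDerivWithinAt_spl P.ctrl hξ).fderivWithin (uniqueDiffOn_cube _ (P.Reg_subset_cube hξ))

lemma hasFDerivWithinAt_G {ξ : E d} (hξ : ξ ∈ P.Reg) :
    HasFDerivWithinAt P.G (P.jac ξ) (cube d) ξ := by
  rw [jac_eq P hξ]; exact P.hasFDerivWithinAt_spl P.ctrl hξ

lemma continuousOn_jac : ContinuousOn P.jac P.Reg :=
  (P.continuousOn_dspl P.ctrl).congr fun _ hξ => P.jac_eq hξ

variable {P} {κ : ℝ}

lemma ShapeRegular.lower (hs : P.ShapeRegular κ) {ξ : E d} (hξ : ξ ∈ P.Reg) (v : E d) :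
    P.H * ‖v‖ ≤ κ * ‖P.jac ξ v‖ :=
  (hs ξ (P.Reg_subset_cube hξ) (P.hasFDerivWithinAt_G hξ).differentiableWithinAt v).1

lemma ShapeRegular.upper (hs : P.ShapeRegular κ) {ξ : E d} (hξ : ξ ∈ P.Reg) (v : E d) :
    ‖P.jac ξ v‖ ≤ κ * P.H * ‖v‖ :=
  (hs ξ (P.Reg_subset_cube hξ) (P.hasFDerivWithinAt_G hξ).differentiableWithinAt v).2

lemma isCompact_closedDom : IsCompact P.closedDom := isCompact_cube.image_of_continuousOn
  P.continuousOn_G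

lemma dom_subset_closedDom : P.dom ⊆ P.closedDom := image_mono openCube_subset_cube

lemma closedDom_subset_closure_dom : P.closedDom ⊆ closure P.dom := by
  rw [closedDom, ← closure_openCube]
  exact ContinuousOn.image_closure (by rw [closure_openCube]; exact P.continuousOn_G)

lemma diam_closedDom : Metric.diam P.closedDom = P.H := by
  refine le_antisymm ?_ (Metric.diam_mono dom_subset_closedDom isCompact_closedDom.isBounded)
  rw [H, ← Metric.diam_closure P.dom]
  exact Metric.diam_mono closedDom_subset_closure_dom
    ((isCompact_closedDom.isBounded.subset dom_subset_closedDom).closure)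

lemma diam_pos_of_injOn (hinj : InjOn P.G (cube d)) {A : Set (E d)} (hA : A ⊆ cube d)
    (hA' : A.Nontrivial) : 0 < Metric.diam (P.G '' A) := by
  obtain ⟨x, hx, y, hy, hxy⟩ := hA'
  have h1 : 0 < dist (P.G x) (P.G y) := dist_pos.2 fun h => hxy (hinj (hA hx) (hA hy) h)
  exact h1.trans_le (Metric.dist_le_diam_of_mem
    (isCompact_closedDom.isBounded.subset (image_mono hA)) ⟨x, hx, rfl⟩ ⟨y, hy, rfl⟩)

lemma H_pos (hd : 0 < d) (hinj : InjOn P.G (cube d)) : 0 < P.H := by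
  rw [← diam_closedDom]
  refine diam_pos_of_injOn hinj le_rfl ⟨WithLp.toLp 2 fun _ => 0, fun i => by simp,
    WithLp.toLp 2 fun _ => 1, fun i => by simp, fun h => ?_⟩
  have := congrArg (fun v : E d => v ⟨0, hd⟩) h
  simp at this

lemma Reg_nonempty : P.Reg.Nonempty :=
  ⟨WithLp.toLp 2 fun _ => 0, fun j => (P.knots j).zero_mem_Reg⟩

/-- Both bounds applied to one unit vector give `H ≤ κ² H`, and the lower bound forces `κ` to be
positive. -/
lemma ShapeRegular.one_le (hd : 0 < d) (hs : P.ShapeRegular κ) (hH : 0 < P.H) : 1 ≤ κ := by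
  obtain ⟨ξ, hξ⟩ := P.Reg_nonempty
  have h1 := hs.lower hξ (EuclideanSpace.single ⟨0, hd⟩ 1)
  have h2 := hs.upper hξ (EuclideanSpace.single ⟨0, hd⟩ 1)
  have hn : ‖(EuclideanSpace.single ⟨0, hd⟩ 1 : E d)‖ = 1 := by simp
  rw [hn, mul_one] at h1 h2
  set J := ‖P.jac ξ (EuclideanSpace.single ⟨0, hd⟩ 1)‖
  have hJ : 0 ≤ J := norm_nonneg _
  have hκ : 0 < κ := by
    by_contra h
    nlinarith
  have h3 : P.H ≤ κ * (κ * P.H) := h1.trans (mul_le_mul_of_nonneg_left h2 hκ.le)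
  by_contra h
  nlinarith [mul_pos hκ hH]

/-- The geometrical mapping is Lipschitz continuous on each cell. -/
lemma ShapeRegular.norm_sub_le_of_mem_cell (hs : P.ShapeRegular κ) (hκ : 0 ≤ κ)
    {c : Fin d → ℕ} (hc : c ∈ P.cellIdx) {x y : E d} (hx : x ∈ P.cell c) (hy : y ∈ P.cell c) :
    ‖P.G x - P.G y‖ ≤ κ * P.H * ‖x - y‖ := by
  have hκH : 0 ≤ κ * P.H := mul_nonneg hκ Metric.diam_nonneg
  have hsub : P.openCell c ⊆ cube d := fun ξ hξ => P.Reg_subset_cube (P.openCell_subset_Reg c hξ)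
  have h1 : LipschitzOnWith ⟨κ * P.H, hκH⟩ P.G (P.openCell c) :=
    (convex_box fun i => convex_Ioo _ _).lipschitzOnWith_of_nnnorm_hasFDerivWithin_le
      (fun ξ hξ => (P.hasFDerivWithinAt_G (P.openCell_subset_Reg c hξ)).mono hsub)
      fun ξ hξ => ContinuousLinearMap.opNorm_le_bound _ hκH
        fun v => hs.upper (P.openCell_subset_Reg c hξ) v
  -- The derivative bound is available on the open cell only; continuity extends the Lipschitz
  -- estimate to its closure.
  have h2 : LipschitzOnWith ⟨κ * P.H, hκH⟩ P.G (P.cell c) := by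
    rw [← P.closure_openCell hc]
    refine LipschitzOnWith.closure ?_ h1
    rw [P.closure_openCell hc]
    exact P.continuousOn_G.mono (P.cell_subset_cube c)
  exact h2.norm_sub_le hx hy

end Patch

/-! ### Calculus on a single shape regular patch. -/

namespace Patch

variable {d : ℕ} {P : Patch d} {κ : ℝ}

/-- The properties of a single shape regular patch. -/
structure Good (P : Patch d) (κ : ℝ) : Prop where
  d_pos : 0 < d
  inj : InjOn P.G (cube d)
  sr : P.ShapeRegular κ
  H_pos : 0 < P.H
  one_le : 1 ≤ κ

lemma Good.mk' (hd : 0 < d) (hinj : InjOn P.G (cube d)) (hs : P.ShapeRegular κ) : P.Good κ :=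
  ⟨hd, hinj, hs, Patch.H_pos hd hinj, hs.one_le hd (Patch.H_pos hd hinj)⟩

lemma Good.κ_pos (hP : P.Good κ) : 0 < κ := zero_lt_one.trans_le hP.one_le

/-! ## The inverse of the geometrical mapping -/

variable (P) in
/-- The inverse of the geometrical mapping. -/
def Ginv : E d → E d := Function.invFunOn P.G (cube d)

lemma Good.Ginv_G (hP : P.Good κ) {ξ : E d} (hξ : ξ ∈ cube d) : P.Ginv (P.G ξ) = ξ :=
  hP.inj.leftInvOn_invFunOn hξ

/-- A continuous injection on a compact set maps closed subsets to closed sets. -/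
lemma Good.continuousOn_Ginv (hP : P.Good κ) : ContinuousOn P.Ginv P.closedDom := by
  rw [continuousOn_iff_isClosed]
  intro t ht
  refine ⟨P.G '' (cube d ∩ t), ((isCompact_cube.inter_right ht).image_of_continuousOn
    (P.continuousOn_G.mono inter_subset_left)).isClosed, ?_⟩
  ext x
  constructor
  · rintro ⟨h1, ξ, hξ, rfl⟩
    rw [mem_preimage, hP.Ginv_G hξ] at h1
    exact ⟨⟨ξ, ⟨hξ, h1⟩, rfl⟩, ⟨ξ, hξ, rfl⟩⟩
  · rintro ⟨⟨ξ, ⟨hξ, h1⟩, rfl⟩, h2⟩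
    refine ⟨?_, h2⟩
    rw [mem_preimage, hP.Ginv_G hξ]
    exact h1

lemma Good.exists_equiv (hP : P.Good κ) {ξ : E d} (hξ : ξ ∈ P.Reg) :
    ∃ e : E d ≃L[ℝ] E d, (e : E d →L[ℝ] E d) = P.jac ξ := by
  have hinj : Function.Injective (P.jac ξ : E d →ₗ[ℝ] E d) := by
    refine (injective_iff_map_eq_zero _).2 fun v hv => ?_
    have h := hP.sr.lower hξ v
    have hv' : P.jac ξ v = 0 := hv
    rw [hv', norm_zero, mul_zero] at h
    have := hP.H_pos
    exact norm_eq_zero.1 (le_antisymm (by nlinarith [norm_nonneg v]) (norm_nonneg v))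
  refine ⟨(LinearEquiv.ofInjectiveEndo _ hinj).toContinuousLinearEquiv, ?_⟩
  ext v : 1
  rfl

/-- Unique differentiability passes from the cube to its image because the Jacobian is onto. It
makes the gradient within the closed patch well determined, also at boundary points. -/
lemma Good.uniqueDiffWithinAt (hP : P.Good κ) {ξ : E d} (hξ : ξ ∈ P.Reg) :
    UniqueDiffWithinAt ℝ P.closedDom (P.G ξ) := by
  obtain ⟨e, he⟩ := hP.exists_equiv hξ
  refine (P.hasFDerivWithinAt_G hξ).uniqueDiffWithinAt
    (uniqueDiffOn_cube _ (P.Reg_subset_cube hξ)) ?_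
  rw [← he]
  exact e.surjective.denseRange

lemma Good.hasFDerivWithinAt_Ginv (hP : P.Good κ) {ξ : E d} (hξ : ξ ∈ P.Reg) :
    HasFDerivWithinAt P.Ginv (P.jac ξ).inverse P.closedDom (P.G ξ) := by
  obtain ⟨e, he⟩ := hP.exists_equiv hξ
  have hc := P.Reg_subset_cube hξ
  have hm : P.G ξ ∈ P.closedDom := ⟨ξ, hc, rfl⟩
  have h1 := P.hasFDerivWithinAt_G hξ
  rw [← he] at h1 ⊢
  rw [ContinuousLinearMap.inverse_equiv]
  refine HasFDerivWithinAt.of_local_left_inverse (f := P.G) (t := cube d) ?_ ?_ hm ?_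
  · have h2 := hP.continuousOn_Ginv _ hm
    refine tendsto_nhdsWithin_iff.2 ⟨h2, ?_⟩
    filter_upwards [self_mem_nhdsWithin] with x hx
    obtain ⟨η, hη, rfl⟩ := hx
    rw [hP.Ginv_G hη]; exact hη
  · rw [hP.Ginv_G hc]; exact h1
  · filter_upwards [self_mem_nhdsWithin] with x hx
    obtain ⟨η, hη, rfl⟩ := hx
    rw [hP.Ginv_G hη]

/-! ## Splines on the physical patch -/

variable (P) in
/-- The function `u` on the physical patch is the push-forward of the spline with coefficients
`c`. -/
def Represents (c : P.Idx → ℝ) (u : E d → ℝ) : Prop := ∀ ξ ∈ cube d, u (P.G ξ) = P.spl c ξ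

/-- The coefficients range over all indices: the Dirichlet condition is forgotten, since the
estimates hold for every spline on the patch. -/
lemma Good.exists_represents (hP : P.Good κ) {u : E d → ℝ} (hu : u ∈ P.V) :
    ∃ c, P.Represents c u := by
  induction hu using Submodule.span_induction with
  | mem u hu =>
    obtain ⟨i, hi, rfl⟩ := hu
    refine ⟨Pi.single i 1, fun ξ hξ => ?_⟩
    have h1 : P.G ξ ∈ P.closedDom := ⟨ξ, hξ, rfl⟩
    have h2 : Function.invFunOn P.G (cube d) (P.G ξ) = ξ := hP.Ginv_G hξ
    rw [basis, indicator_of_mem h1, h2, spl, Finset.sum_eq_single i]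
    · simp
    · intro j _ hj
      simp [Pi.single_eq_of_ne hj]
    · simp
  | zero => exact ⟨0, fun ξ _ => by simp [spl]⟩
  | add u v _ _ hu hv =>
    obtain ⟨c, hc⟩ := hu
    obtain ⟨c', hc'⟩ := hv
    refine ⟨c + c', fun ξ hξ => ?_⟩
    rw [Pi.add_apply, hc ξ hξ, hc' ξ hξ]
    simp [spl, mul_add, Finset.sum_add_distrib]
  | smul a u _ hu =>
    obtain ⟨c, hc⟩ := hu
    refine ⟨a • c, fun ξ hξ => ?_⟩
    rw [Pi.smul_apply, hc ξ hξ]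
    simp only [spl, Pi.smul_apply, smul_eq_mul, Finset.mul_sum]
    exact Finset.sum_congr rfl fun i _ => by ring

lemma VOn_le_V (S : Set (E d)) : P.VOn S ≤ P.V :=
  Submodule.span_mono (image_mono fun _ hi => hi.1)

lemma Good.continuousOn_of_mem_V (hP : P.Good κ) {u : E d → ℝ} (hu : u ∈ P.V) :
    ContinuousOn u P.closedDom := by
  obtain ⟨c, hc⟩ := hP.exists_represents hu
  have h1 : ContinuousOn (P.spl c ∘ P.Ginv) P.closedDom := by
    refine (P.continuousOn_spl c).comp hP.continuousOn_Ginv ?_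
    rintro _ ⟨η, hη, rfl⟩
    rw [hP.Ginv_G hη]; exact hη
  refine h1.congr ?_
  rintro _ ⟨η, hη, rfl⟩
  rw [Function.comp_apply, hP.Ginv_G hη, hc η hη]

lemma Good.hasFDerivWithinAt (hP : P.Good κ) {c : P.Idx → ℝ} {u : E d → ℝ}
    (hc : P.Represents c u) {ξ : E d} (hξ : ξ ∈ P.Reg) :
    HasFDerivWithinAt u (P.dspl c ξ ∘L (P.jac ξ).inverse) P.closedDom (P.G ξ) := by
  have hcu := P.Reg_subset_cube hξ
  have h1 := P.hasFDerivWithinAt_spl c hξ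
  rw [← hP.Ginv_G hcu] at h1
  have h2 := h1.comp (P.G ξ) (hP.hasFDerivWithinAt_Ginv hξ) (t := cube d) (by
    rintro _ ⟨η, hη, rfl⟩
    rw [hP.Ginv_G hη]; exact hη)
  rw [hP.Ginv_G hcu] at h2
  refine h2.congr ?_ ?_
  · rintro _ ⟨η, hη, rfl⟩
    rw [Function.comp_apply, hP.Ginv_G hη, hc η hη]
  · rw [Function.comp_apply, hP.Ginv_G hcu, hc ξ hcu]

lemma Good.toDual_grad (hP : P.Good κ) {c : P.Idx → ℝ} {u : E d → ℝ}
    (hc : P.Represents c u) {ξ : E d} (hξ : ξ ∈ P.Reg) :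
    InnerProductSpace.toDual ℝ (E d) (P.grad u (P.G ξ)) = P.dspl c ξ ∘L (P.jac ξ).inverse := by
  rw [grad, toDual_gradientWithin]
  exact (hP.hasFDerivWithinAt hc hξ).fderivWithin (hP.uniqueDiffWithinAt hξ)

lemma Good.grad_eq (hP : P.Good κ) {c : P.Idx → ℝ} {u : E d → ℝ}
    (hc : P.Represents c u) {ξ : E d} (hξ : ξ ∈ P.Reg) :
    P.grad u (P.G ξ) =
      (InnerProductSpace.toDual ℝ (E d)).symm (P.dspl c ξ ∘L (P.jac ξ).inverse) := by
  rw [← hP.toDual_grad hc hξ, LinearIsometryEquiv.symm_apply_apply]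

lemma Good.norm_jac_inverse_le (hP : P.Good κ) {ξ : E d} (hξ : ξ ∈ P.Reg) :
    ‖(P.jac ξ).inverse‖ ≤ κ / P.H := by
  obtain ⟨e, he⟩ := hP.exists_equiv hξ
  refine ContinuousLinearMap.opNorm_le_bound _ (div_nonneg hP.κ_pos.le hP.H_pos.le) fun v => ?_
  have h := hP.sr.lower hξ ((P.jac ξ).inverse v)
  have h2 : P.jac ξ ((P.jac ξ).inverse v) = v := by
    rw [← he, ContinuousLinearMap.inverse_equiv]
    exact e.apply_symm_apply v
  rw [h2] at h
  rw [div_mul_eq_mul_div, le_div_iff₀ hP.H_pos]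
  linarith

lemma Good.norm_jac_le (hP : P.Good κ) {ξ : E d} (hξ : ξ ∈ P.Reg) : ‖P.jac ξ‖ ≤ κ * P.H :=
  ContinuousLinearMap.opNorm_le_bound _ (mul_nonneg hP.κ_pos.le hP.H_pos.le) (hP.sr.upper hξ)

lemma Good.norm_grad_le (hP : P.Good κ) {c : P.Idx → ℝ} {u : E d → ℝ}
    (hc : P.Represents c u) {ξ : E d} (hξ : ξ ∈ P.Reg) :
    ‖P.grad u (P.G ξ)‖ ≤ κ / P.H * ‖P.dspl c ξ‖ := by
  rw [hP.grad_eq hc hξ, LinearIsometryEquiv.norm_map, mul_comm]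
  exact (ContinuousLinearMap.opNorm_comp_le _ _).trans
    (mul_le_mul_of_nonneg_left (hP.norm_jac_inverse_le hξ) (norm_nonneg _))

lemma Good.norm_dspl_le (hP : P.Good κ) {c : P.Idx → ℝ} {u : E d → ℝ}
    (hc : P.Represents c u) {ξ : E d} (hξ : ξ ∈ P.Reg) :
    ‖P.dspl c ξ‖ ≤ κ * P.H * ‖P.grad u (P.G ξ)‖ := by
  obtain ⟨e, he⟩ := hP.exists_equiv hξ
  have h1 : P.dspl c ξ = InnerProductSpace.toDual ℝ (E d) (P.grad u (P.G ξ)) ∘L P.jac ξ := by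
    rw [hP.toDual_grad hc hξ, ← he, ContinuousLinearMap.inverse_equiv]
    ext v : 1
    simp
  rw [h1]
  refine (ContinuousLinearMap.opNorm_comp_le _ _).trans ?_
  rw [LinearIsometryEquiv.norm_map, mul_comm]
  exact mul_le_mul_of_nonneg_right (hP.norm_jac_le hξ) (norm_nonneg _)

lemma Good.continuousOn_jac_inverse (hP : P.Good κ) :
    ContinuousOn (fun ξ => (P.jac ξ).inverse) P.Reg := by
  intro ξ hξ
  obtain ⟨e, he⟩ := hP.exists_equiv hξ
  have h1 : ContinuousAt (ContinuousLinearMap.inverse : (E d →L[ℝ] E d) → _) (P.jac ξ) := by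
    rw [← he]
    exact (contDiffAt_map_inverse (n := 0) e).continuousAt
  exact ContinuousAt.comp_continuousWithinAt (f := P.jac) h1 (P.continuousOn_jac ξ hξ)

lemma Good.continuousOn_grad (hP : P.Good κ) {u : E d → ℝ} (hu : u ∈ P.V) :
    ContinuousOn (fun ξ => P.grad u (P.G ξ)) P.Reg := by
  obtain ⟨c, hc⟩ := hP.exists_represents hu
  refine ContinuousOn.congr ?_ fun ξ hξ => hP.grad_eq hc hξ
  exact (LinearIsometryEquiv.continuous _).comp_continuousOn
    ((P.continuousOn_dspl c).clm_comp hP.continuousOn_jac_inverse)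

lemma Good.exists_bound_grad (hP : P.Good κ) {u : E d → ℝ} (hu : u ∈ P.V) :
    ∃ B, ∀ ξ ∈ P.Reg, ‖P.grad u (P.G ξ)‖ ≤ B := by
  obtain ⟨c, hc⟩ := hP.exists_represents hu
  obtain ⟨B, hB⟩ := P.exists_bound_dspl c
  exact ⟨κ / P.H * B, fun ξ hξ => (hP.norm_grad_le hc hξ).trans
    (mul_le_mul_of_nonneg_left (hB ξ hξ) (div_nonneg hP.κ_pos.le hP.H_pos.le))⟩

lemma Good.grad_add (hP : P.Good κ) {u v : E d → ℝ} (hu : u ∈ P.V) (hv : v ∈ P.V)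
    {ξ : E d} (hξ : ξ ∈ P.Reg) :
    P.grad (u + v) (P.G ξ) = P.grad u (P.G ξ) + P.grad v (P.G ξ) := by
  obtain ⟨c, hc⟩ := hP.exists_represents hu
  obtain ⟨c', hc'⟩ := hP.exists_represents hv
  simp only [grad, gradientWithin]
  rw [fderivWithin_add (hP.uniqueDiffWithinAt hξ)
    (hP.hasFDerivWithinAt hc hξ).differentiableWithinAt
    (hP.hasFDerivWithinAt hc' hξ).differentiableWithinAt, map_add]

lemma Good.grad_smul (hP : P.Good κ) (a : ℝ) {u : E d → ℝ} (hu : u ∈ P.V)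
    {ξ : E d} (hξ : ξ ∈ P.Reg) :
    P.grad (a • u) (P.G ξ) = a • P.grad u (P.G ξ) := by
  obtain ⟨c, hc⟩ := hP.exists_represents hu
  simp only [grad, gradientWithin]
  rw [fderivWithin_const_smul (hP.uniqueDiffWithinAt hξ)
    (hP.hasFDerivWithinAt hc hξ).differentiableWithinAt a,
    map_smul]

/-! ## The change of variables -/

/-- Removing the cell boundaries costs only a null set, and the mapping preserves null sets. On the
remaining set the change of variables formula applies. -/
lemma Good.dom_ae_eq : P.dom =ᵐ[volume] P.G '' P.Opn := by
  refine eventuallyLE_antisymm_iff.2 ⟨?_, (image_mono P.Opn_subset_openCube).eventuallyLE⟩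
  rw [ae_le_set]
  refine measure_mono_null ?_ (P.volume_image_G_eq_zero sdiff_subset P.volume_cube_diff_Opn)
  rintro _ ⟨⟨ξ, hξ, rfl⟩, h⟩
  exact ⟨ξ, ⟨openCube_subset_cube hξ, fun h' => h ⟨ξ, h', rfl⟩⟩, rfl⟩

lemma hasFDerivWithinAt_G_Opn {S : Set (E d)} (hS : S ⊆ P.Opn) :
    ∀ ξ ∈ S, HasFDerivWithinAt P.G (P.jac ξ) S ξ := fun _ hξ =>
  (P.hasFDerivWithinAt_G (P.Opn_subset_Reg (hS hξ))).mono (hS.trans P.Opn_subset_cube)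

lemma Good.integral_dom (hP : P.Good κ) (g : E d → ℝ) :
    ∫ x in P.dom, g x = ∫ ξ in P.Opn, |(P.jac ξ).det| * g (P.G ξ) := by
  rw [setIntegral_congr_set Good.dom_ae_eq,
    integral_image_eq_integral_abs_det_fderiv_smul volume P.measurableSet_Opn
      (hasFDerivWithinAt_G_Opn le_rfl) (hP.inj.mono P.Opn_subset_cube)]
  rfl

lemma Good.integrableOn_dom_iff (hP : P.Good κ) (g : E d → ℝ) :
    IntegrableOn g P.dom ↔ IntegrableOn (fun ξ => |(P.jac ξ).det| * g (P.G ξ)) P.Opn := by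
  rw [integrableOn_congr_set_ae Good.dom_ae_eq,
    integrableOn_image_iff_integrableOn_abs_det_fderiv_smul volume P.measurableSet_Opn
      (hasFDerivWithinAt_G_Opn le_rfl) (hP.inj.mono P.Opn_subset_cube)]
  rfl

lemma Good.abs_det_le (hP : P.Good κ) {ξ : E d} (hξ : ξ ∈ P.Reg) :
    |(P.jac ξ).det| ≤ (κ * P.H) ^ d :=
  abs_det_le_pow (mul_nonneg hP.κ_pos.le hP.H_pos.le) (hP.sr.upper hξ)

lemma Good.le_abs_det (hP : P.Good κ) {ξ : E d} (hξ : ξ ∈ P.Reg) :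
    (P.H / κ) ^ d ≤ |(P.jac ξ).det| :=
  pow_le_abs_det (div_pos hP.H_pos hP.κ_pos) fun v => by
    rw [div_mul_eq_mul_div, div_le_iff₀ hP.κ_pos, mul_comm (‖_‖)]
    exact hP.sr.lower hξ v

lemma volume_Opn_lt_top : volume P.Opn < ⊤ :=
  (measure_mono P.Opn_subset_cube).trans_lt isCompact_cube.measure_lt_top

lemma integrableOn_Opn {g : E d → ℝ} (hg : ContinuousOn g P.Reg)
    (hb : ∃ B, ∀ ξ ∈ P.Reg, |g ξ| ≤ B) : IntegrableOn g P.Opn := by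
  obtain ⟨B, hB⟩ := hb
  exact IntegrableOn.of_bound volume_Opn_lt_top
    ((hg.mono P.Opn_subset_Reg).aestronglyMeasurable P.measurableSet_Opn) B
    ((ae_restrict_mem P.measurableSet_Opn).mono fun ξ hξ => hB ξ (P.Opn_subset_Reg hξ))

lemma Good.integrableOn_dom (hP : P.Good κ) {g : E d → ℝ}
    (hg : ContinuousOn (fun ξ => g (P.G ξ)) P.Reg)
    (hb : ∃ B, ∀ ξ ∈ P.Reg, |g (P.G ξ)| ≤ B) : IntegrableOn g P.dom := by
  rw [hP.integrableOn_dom_iff]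
  refine integrableOn_Opn ?_ ?_
  · exact ((ContinuousLinearMap.continuous_det.comp_continuousOn P.continuousOn_jac).abs).mul hg
  · obtain ⟨B, hB⟩ := hb
    refine ⟨(κ * P.H) ^ d * B, fun ξ hξ => ?_⟩
    rw [abs_mul, abs_abs]
    exact mul_le_mul (hP.abs_det_le hξ) (hB ξ hξ) (abs_nonneg _)
      (pow_nonneg (mul_nonneg hP.κ_pos.le hP.H_pos.le) _)

lemma Good.integrableOn_inner_grad (hP : P.Good κ) {u v : E d → ℝ} (hu : u ∈ P.V)
    (hv : v ∈ P.V) : IntegrableOn (fun x => ⟪P.grad u x, P.grad v x⟫) P.dom := by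
  refine hP.integrableOn_dom ((hP.continuousOn_grad hu).inner (hP.continuousOn_grad hv)) ?_
  obtain ⟨B, hB⟩ := hP.exists_bound_grad hu
  obtain ⟨B', hB'⟩ := hP.exists_bound_grad hv
  refine ⟨B * B', fun ξ hξ => (abs_real_inner_le_norm _ _).trans ?_⟩
  exact mul_le_mul (hB ξ hξ) (hB' ξ hξ) (norm_nonneg _) ((norm_nonneg _).trans (hB ξ hξ))

/-- Two functions on the patch which coincide at the regular points have the same integral. -/
lemma Good.integral_dom_congr (hP : P.Good κ) {g g' : E d → ℝ}
    (h : ∀ ξ ∈ P.Reg, g (P.G ξ) = g' (P.G ξ)) : ∫ x in P.dom, g x = ∫ x in P.dom, g' x := by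
  rw [hP.integral_dom, hP.integral_dom]
  refine setIntegral_congr_fun P.measurableSet_Opn fun ξ hξ => ?_
  simp only [h ξ (P.Opn_subset_Reg hξ)]

lemma Good.le_volume_image (hP : P.Good κ) {S : Set (E d)} (hS : S ⊆ P.Opn)
    (hm : MeasurableSet S) : ENNReal.ofReal ((P.H / κ) ^ d) * volume S ≤ volume (P.G '' S) := by
  rw [← lintegral_abs_det_fderiv_eq_addHaar_image volume hm (hasFDerivWithinAt_G_Opn hS)
    (hP.inj.mono (hS.trans P.Opn_subset_cube)), ← setLIntegral_const]
  exact setLIntegral_mono' hm fun ξ hξ =>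
    ENNReal.ofReal_le_ofReal (hP.le_abs_det (P.Opn_subset_Reg (hS hξ)))

/-- The energy of a spline on the parameter domain is bounded by the energy on the patch. -/
lemma Good.integral_dspl_sq_le (hP : P.Good κ) {c : P.Idx → ℝ} {u : E d → ℝ} (hu : u ∈ P.V)
    (hc : P.Represents c u) :
    (P.H / κ) ^ d * ∫ ξ in P.Opn, ‖P.dspl c ξ‖ ^ 2 ≤
      (κ * P.H) ^ 2 * ∫ x in P.dom, ⟪P.grad u x, P.grad u x⟫ := by
  have h1 := (hP.integrableOn_dom_iff _).1 (hP.integrableOn_inner_grad hu hu)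
  rw [hP.integral_dom, ← integral_const_mul, ← integral_const_mul]
  have h2 : IntegrableOn (fun ξ => ‖P.dspl c ξ‖ ^ 2) P.Opn := by
    refine integrableOn_Opn ((P.continuousOn_dspl c).norm.pow 2) ?_
    obtain ⟨B, hB⟩ := P.exists_bound_dspl c
    refine ⟨B ^ 2, fun ξ hξ => ?_⟩
    rw [abs_of_nonneg (by positivity)]
    exact pow_le_pow_left₀ (norm_nonneg _) (hB ξ hξ) 2
  refine setIntegral_mono_on (h2.const_mul _) (h1.const_mul _) P.measurableSet_Opn fun ξ hξ => ?_
  have hr := P.Opn_subset_Reg hξ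
  have hn : 0 ≤ P.H / κ := div_nonneg hP.H_pos.le hP.κ_pos.le
  rw [real_inner_self_eq_norm_sq]
  calc (P.H / κ) ^ d * ‖P.dspl c ξ‖ ^ 2
      ≤ |(P.jac ξ).det| * (κ * P.H * ‖P.grad u (P.G ξ)‖) ^ 2 := by
        gcongr
        · exact hP.le_abs_det hr
        · exact hP.norm_dspl_le hc hr
    _ = (κ * P.H) ^ 2 * (|(P.jac ξ).det| * ‖P.grad u (P.G ξ)‖ ^ 2) := by ring

end Patch

/-! ## Coordinates with respect to a face -/

section Face

variable {d : ℕ} (f : Face d)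

/-- The point with tangential coordinates `η` and normal coordinate `s`. -/
def Face.pt (η : {i : Fin d // i ≠ f.1} → ℝ) (s : ℝ) : E d :=
  WithLp.toLp 2 fun i => if h : i = f.1 then s else η ⟨i, h⟩

lemma Face.point_eq_pt (η : {i : Fin d // i ≠ f.1} → ℝ) : f.point η = f.pt η f.coord := rfl

@[simp] lemma Face.pt_apply_self (η : {i : Fin d // i ≠ f.1} → ℝ) (s : ℝ) :
    f.pt η s f.1 = s := by simp [Face.pt]

lemma Face.pt_apply_ne (η : {i : Fin d // i ≠ f.1} → ℝ) (s : ℝ) {i : Fin d} (h : i ≠ f.1) :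
    f.pt η s i = η ⟨i, h⟩ := by simp [Face.pt, h]

lemma Face.forall_pt {p : Fin d → ℝ → Prop} {η : {i : Fin d // i ≠ f.1} → ℝ} {s : ℝ} :
    (∀ i, p i (f.pt η s i)) ↔ (∀ i, p i.1 (η i)) ∧ p f.1 s := by
  constructor
  · intro h
    refine ⟨fun i => ?_, ?_⟩
    · have := h i
      rwa [f.pt_apply_ne η s i.2] at this
    · have := h f.1
      rwa [f.pt_apply_self] at this
  · rintro ⟨h1, h2⟩ i
    by_cases hi : i = f.1
    · subst hi
      rwa [f.pt_apply_self]
    · rw [f.pt_apply_ne η s hi]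
      exact h1 ⟨i, hi⟩

lemma Face.coord_mem_Icc : f.coord ∈ Icc (0 : ℝ) 1 := by
  unfold Face.coord; split_ifs <;> simp

lemma Face.point_mem_closedSet {η : {i : Fin d // i ≠ f.1} → ℝ} (hη : ∀ i, η i ∈ Icc (0 : ℝ) 1) :
    f.point η ∈ f.closedSet :=
  ⟨f.forall_pt (p := fun _ x => x ∈ Icc (0 : ℝ) 1) (η := η) (s := f.coord) |>.2
    ⟨hη, f.coord_mem_Icc⟩, f.pt_apply_self η _⟩

lemma Face.continuous_point : Continuous f.point := by
  unfold Face.point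
  refine (PiLp.continuous_toLp 2 _).comp (continuous_pi fun i => ?_)
  split_ifs
  · exact continuous_const
  · exact continuous_apply _

/-- This splitting into tangential and normal coordinates lets Fubini reduce the trace inequality to
lines normal to the face. -/
lemma Face.exists_measurePreserving : ∃ e : ({i : Fin d // i ≠ f.1} → ℝ) × ℝ ≃ᵐ E d,
    MeasurePreserving e (volume.prod volume) volume ∧ ∀ η s, e (η, s) = f.pt η s := by
  let U : Unique {i : Fin d // ¬ i ≠ f.1} :=
    ⟨⟨⟨f.1, by simp⟩⟩, fun i => Subtype.ext (not_not.1 i.2)⟩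
  let e₁ : ({i : Fin d // i ≠ f.1} → ℝ) × ℝ ≃ᵐ
      ({i : Fin d // i ≠ f.1} → ℝ) × ({i : Fin d // ¬ i ≠ f.1} → ℝ) :=
    MeasurableEquiv.prodCongr (MeasurableEquiv.refl _)
      (MeasurableEquiv.funUnique {i : Fin d // ¬ i ≠ f.1} ℝ).symm
  have h₀ : MeasurePreserving (MeasurableEquiv.funUnique {i : Fin d // ¬ i ≠ f.1} ℝ).symm
      volume volume := by
    convert (volume_preserving_funUnique {i : Fin d // ¬ i ≠ f.1} ℝ).symm
  have h₁ : MeasurePreserving e₁ (volume.prod volume) (volume.prod volume) :=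
    (MeasurePreserving.id _).prod h₀
  let e₂ := (MeasurableEquiv.piEquivPiSubtypeProd (fun _ : Fin d => ℝ) (fun i => i ≠ f.1)).symm
  have h₂ : MeasurePreserving e₂ (volume.prod volume) volume :=
    (volume_preserving_piEquivPiSubtypeProd (fun _ : Fin d => ℝ) (fun i => i ≠ f.1)).symm
  have h₃ := (EuclideanSpace.volume_preserving_symm_measurableEquiv_toLp (Fin d)).symm
  refine ⟨(e₁.trans e₂).trans (MeasurableEquiv.toLp 2 (Fin d → ℝ)), h₃.comp (h₂.comp h₁),
    fun η s => ?_⟩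
  ext i
  change (if h : i ≠ f.1 then η ⟨i, h⟩ else s) = f.pt η s i
  by_cases hi : i = f.1
  · rw [dif_neg (not_not.2 hi), hi, f.pt_apply_self]
  · rw [dif_pos hi, f.pt_apply_ne η s hi]

/-- The squared operator norm of a derivative becomes a sum over partial derivatives, to each of
which the polynomial inequality applies. -/
lemma norm_sq_functional (L : E d →L[ℝ] ℝ) :
    ‖L‖ ^ 2 = ∑ j, (L (EuclideanSpace.single j 1)) ^ 2 := by
  obtain ⟨w, rfl⟩ := (InnerProductSpace.toDual ℝ (E d)).surjective L
  rw [LinearIsometryEquiv.norm_map, EuclideanSpace.norm_sq_eq]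
  refine Finset.sum_congr rfl fun j _ => ?_
  rw [InnerProductSpace.toDual_apply_apply, EuclideanSpace.inner_single_right]
  simp

end Face

lemma KnotVector.measurableSet_Reg (K : KnotVector) : MeasurableSet K.Reg := by
  have h : K.Reg = Icc 0 1 \ (range K.t \ {0, 1}) := by
    ext x
    simp only [KnotVector.Reg, mem_ofPred_eq, Set.mem_sdiff, mem_range, mem_insert_iff,
      mem_singleton_iff, not_and, not_not, forall_exists_index]
  rw [h]
  exact measurableSet_Icc.diff ((countable_range _).mono sdiff_subset).measurableSet

namespace Patch

variable {d : ℕ} {P : Patch d} {κ : ℝ}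

variable (P) in
/-- The tangential coordinates of the regular points of a face. -/
def FReg (f : Face d) : Set ({i : Fin d // i ≠ f.1} → ℝ) :=
  Set.univ.pi fun i => (P.knots i.1).Reg

lemma measurableSet_FReg (f : Face d) : MeasurableSet (P.FReg f) :=
  MeasurableSet.univ_pi fun i => (P.knots i.1).measurableSet_Reg

lemma FReg_subset (f : Face d) : P.FReg f ⊆ Set.univ.pi fun _ => Icc 0 1 :=
  pi_mono fun _ _ _ hx => hx.1

lemma FReg_ae_eq (f : Face d) : (Set.univ.pi fun _ => Icc (0 : ℝ) 1) =ᵐ[volume] P.FReg f := by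
  refine eventuallyLE_antisymm_iff.2 ⟨?_, (FReg_subset f).eventuallyLE⟩
  have : ∀ᵐ η : {i : Fin d // i ≠ f.1} → ℝ, ∀ i a, η i ≠ (P.knots i.1).t a := by
    rw [ae_all_iff]; intro i
    rw [ae_all_iff]; intro a
    exact Measure.ae_eval_ne (μ := fun _ => volume) i _
  filter_upwards [this] with η hη h i hi
  exact ⟨h i hi, fun a ha => absurd ha.symm (hη i a)⟩

lemma volume_FReg_lt_top (f : Face d) : volume (P.FReg f) < ⊤ :=
  (measure_mono (FReg_subset f)).trans_lt
    (isCompact_univ_pi fun _ => isCompact_Icc).measure_lt_top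

/-- The normal coordinate of a face point is 0 or 1, and these are the two knots admitted as
regular. -/
lemma point_mem_Reg {f : Face d} {η : {i : Fin d // i ≠ f.1} → ℝ} (hη : η ∈ P.FReg f) :
    f.point η ∈ P.Reg := by
  rw [f.point_eq_pt]
  refine f.forall_pt (p := fun i x => x ∈ (P.knots i).Reg) |>.2 ⟨fun i => hη i (mem_univ _), ?_⟩
  unfold Face.coord
  split_ifs
  · exact (P.knots f.1).one_mem_Reg
  · exact (P.knots f.1).zero_mem_Reg

lemma continuousOn_comp_point {X : Type*} [TopologicalSpace X] {f : Face d} {g : E d → X}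
    (hg : ContinuousOn g P.Reg) : ContinuousOn (fun η => g (f.point η)) (P.FReg f) :=
  hg.comp f.continuous_point.continuousOn fun _ hη => point_mem_Reg hη

lemma integrableOn_FReg {f : Face d} {g : ({i : Fin d // i ≠ f.1} → ℝ) → ℝ}
    (hg : ContinuousOn g (P.FReg f)) (hb : ∃ B, ∀ η ∈ P.FReg f, |g η| ≤ B) :
    IntegrableOn g (P.FReg f) := by
  obtain ⟨B, hB⟩ := hb
  exact IntegrableOn.of_bound (volume_FReg_lt_top f)
    (hg.aestronglyMeasurable (measurableSet_FReg f)) B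
    ((ae_restrict_mem (measurableSet_FReg f)).mono fun η hη => hB η hη)

lemma faceIntegral_eq (f : Face d) (g : E d → E d → ℝ) :
    P.faceIntegral f g = ∫ η in P.FReg f,
      g (P.G (f.point η)) (P.normal f (f.point η)) * P.surfaceDensity f (f.point η) :=
  setIntegral_congr_set (FReg_ae_eq f)

/-! ## Normal vector and surface density -/

lemma norm_normal_le (f : Face d) (ξ : E d) : ‖P.normal f ξ‖ ≤ 1 := by
  unfold normal
  simp only [norm_smul, norm_inv, norm_norm]
  exact inv_mul_le_one

lemma Good.continuousOn_normal (hP : P.Good κ) (f : Face d) :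
    ContinuousOn (P.normal f) P.Reg := by
  have h1 : ContinuousOn (fun ξ => ContinuousLinearMap.adjoint
      (ContinuousLinearMap.inverse (P.jac ξ)) f.refNormal) P.Reg := by
    refine ContinuousOn.clm_apply ?_ continuousOn_const
    exact (LinearIsometryEquiv.continuous _).comp_continuousOn hP.continuousOn_jac_inverse
  refine ContinuousOn.smul (h1.norm.inv₀ fun ξ hξ h => ?_) h1
  obtain ⟨e, he⟩ := hP.exists_equiv hξ
  rw [norm_eq_zero, ← he, ContinuousLinearMap.inverse_equiv] at h
  -- The vector to be normalized cannot vanish: its inner product with `e f.refNormal` is the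
  -- squared norm of the reference normal.
  have h2 := ContinuousLinearMap.adjoint_inner_left (e.symm : E d →L[ℝ] E d) (e f.refNormal)
    f.refNormal
  rw [h, inner_zero_left] at h2
  simp only [ContinuousLinearEquiv.coe_coe, ContinuousLinearEquiv.symm_apply_apply] at h2
  have h3 : f.refNormal = 0 := inner_self_eq_zero.1 h2.symm
  have h4 := congrArg (fun v : E d => v f.1) h3
  simp only [Face.refNormal, PiLp.single_apply, PiLp.zero_apply, if_true] at h4
  split_ifs at h4 <;> norm_num at h4

lemma continuousOn_surfaceDensity (f : Face d) : ContinuousOn (P.surfaceDensity f) P.Reg := by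
  refine ContinuousOn.sqrt ?_
  refine (continuous_id.matrix_det).comp_continuousOn ?_
  refine continuousOn_pi.2 fun i => continuousOn_pi.2 fun j => ?_
  exact (P.continuousOn_jac.clm_apply continuousOn_const).inner
    (P.continuousOn_jac.clm_apply continuousOn_const)

lemma surfaceDensity_nonneg (f : Face d) (ξ : E d) : 0 ≤ P.surfaceDensity f ξ :=
  Real.sqrt_nonneg _

/-- The Leibniz formula bounds the Gram determinant by its number of terms times the product of the
largest entries. -/
lemma Good.surfaceDensity_le (hP : P.Good κ) (f : Face d) {ξ : E d} (hξ : ξ ∈ P.Reg) :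
    P.surfaceDensity f ξ ≤ (Nat.factorial (d - 1)) * (κ * P.H) ^ (d - 1) := by
  have hκH : 0 ≤ κ * P.H := mul_nonneg hP.κ_pos.le hP.H_pos.le
  refine Real.sqrt_le_iff.2 ⟨by positivity, ?_⟩
  have hc : Fintype.card {i : Fin d // i ≠ f.1} = d - 1 := by simp
  have h := Matrix.det_le (abv := AbsoluteValue.abs) (x := (κ * P.H) ^ 2)
    (A := Matrix.of fun i j : {i : Fin d // i ≠ f.1} =>
      (⟪P.jac ξ (EuclideanSpace.single i.1 1), P.jac ξ (EuclideanSpace.single j.1 1)⟫ : ℝ))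
    fun i j => by
      refine (abs_real_inner_le_norm (P.jac ξ (EuclideanSpace.single i.1 1))
        (P.jac ξ (EuclideanSpace.single j.1 1))).trans ?_
      rw [sq]
      have h1 := hP.sr.upper hξ (EuclideanSpace.single i.1 1)
      have h2 := hP.sr.upper hξ (EuclideanSpace.single j.1 1)
      simp only [PiLp.norm_single, norm_one, mul_one] at h1 h2
      exact mul_le_mul h1 h2 (norm_nonneg _) hκH
  rw [hc, nsmul_eq_mul] at h
  refine (le_abs_self _).trans (h.trans ?_)
  rw [mul_pow ((Nat.factorial (d - 1) : ℕ) : ℝ) _ 2, pow_right_comm]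
  refine mul_le_mul_of_nonneg_right ?_ (by positivity)
  have : (1 : ℝ) ≤ Nat.factorial (d - 1) := by exact_mod_cast Nat.factorial_pos _
  nlinarith

/-! ## The discrete trace inequality -/

lemma exists_end_span (f : Face d) : ∃ a, (P.knots f.1).t a < (P.knots f.1).t (a + 1) ∧
    Icc ((P.knots f.1).t a) ((P.knots f.1).t (a + 1)) ∈ 𝓝[Icc (0 : ℝ) 1] f.coord := by
  unfold Face.coord
  split_ifs
  · exact ⟨_, (P.knots f.1).last_span.2, (P.knots f.1).span_nhdsWithin_one⟩
  · exact ⟨_, (P.knots f.1).first_span.2, (P.knots f.1).span_nhdsWithin_zero⟩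

/-- In the direction normal to a face, the partial derivatives of a spline are polynomials. -/
lemma exists_polynomial_dspl (c : P.Idx → ℝ) (f : Face d) {a : ℕ}
    (ha : (P.knots f.1).t a < (P.knots f.1).t (a + 1))
    (hf : Icc ((P.knots f.1).t a) ((P.knots f.1).t (a + 1)) ∈ 𝓝[Icc (0 : ℝ) 1] f.coord)
    (η : {i : Fin d // i ≠ f.1} → ℝ) (j : Fin d) :
    ∃ Q : ℝ[X], Q.natDegree ≤ (P.knots f.1).p ∧
      P.dspl c (f.point η) (EuclideanSpace.single j 1) = Q.eval f.coord ∧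
      ∀ s ∈ Ioo ((P.knots f.1).t a) ((P.knots f.1).t (a + 1)),
        P.dspl c (f.pt η s) (EuclideanSpace.single j 1) = Q.eval s := by
  let B : P.Idx → ℝ[X] := fun i => bsplinePiece (P.knots f.1).t a (P.knots f.1).p (i f.1)
  let R : P.Idx → ℝ[X] := fun i => if f.1 = j then derivative (B i) else B i
  let w : P.Idx → ℝ := fun i => ∏ m ∈ Finset.univ.erase f.1,
    if m = j then (P.knots m).dN (i m) (f.pt η 0 m) else (P.knots m).N (i m) (f.pt η 0 m)
  have hpd : ∀ (i : P.Idx) (s : ℝ), P.pd i j (f.pt η s) =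
      (if f.1 = j then (P.knots f.1).dN (i f.1) s else (P.knots f.1).N (i f.1) s) * w i := by
    intro i s
    rw [pd, ← Finset.mul_prod_erase _ _ (Finset.mem_univ f.1), f.pt_apply_self]
    congr 1
    refine Finset.prod_congr rfl fun m hm => ?_
    have hm' := Finset.ne_of_mem_erase hm
    rw [f.pt_apply_ne η s hm', f.pt_apply_ne η 0 hm']
  have key : ∀ s, (∀ i : P.Idx, (P.knots f.1).dN (i f.1) s = (derivative (B i)).eval s) →
      (∀ i : P.Idx, (P.knots f.1).N (i f.1) s = (B i).eval s) →
      P.dspl c (f.pt η s) (EuclideanSpace.single j 1) =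
        (∑ i, C (w i * c i) * R i).eval s := by
    intro s h1 h2
    rw [dspl_apply_single, eval_finsetSum]
    refine Finset.sum_congr rfl fun i _ => ?_
    rw [hpd, h1, h2, eval_mul, eval_C, smul_eq_mul]
    simp only [R]
    split_ifs <;> ring
  refine ⟨∑ i, C (w i * c i) * R i, ?_, ?_, ?_⟩
  · refine natDegree_sum_le_of_forall_le _ _ fun i _ => (natDegree_C_mul_le _ _).trans ?_
    have hB : (B i).natDegree ≤ (P.knots f.1).p := natDegree_bsplinePiece_le _ _ _ _
    simp only [R]
    split_ifs
    · exact (natDegree_derivative_le _).trans ((Nat.sub_le _ _).trans hB)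
    · exact hB
  · exact key _ (fun i => ((P.knots f.1).eventually_dN_eq (i f.1) ha hf).self_of_nhdsWithin
      f.coord_mem_Icc) fun i => (P.knots f.1).N_eq_eval _ ha
        (mem_of_mem_nhdsWithin f.coord_mem_Icc hf)
  · exact fun s hs => key s (fun i => (P.knots f.1).dN_eq_of_mem_Ioo _ hs)
      fun i => (P.knots f.1).N_eq_eval _ ha (Ioo_subset_Icc_self hs)

/-- The discrete trace inequality on the parameter domain. -/
lemma integral_face_dspl_sq_le {m : ℕ} {C : ℝ}
    (hC : ∀ Q : ℝ[X], Q.natDegree ≤ m → ∀ a b : ℝ, a < b → ∀ x ∈ Icc a b,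
      (b - a) * (Q.eval x) ^ 2 ≤ C * ∫ s in a..b, (Q.eval s) ^ 2)
    (hC0 : 0 ≤ C) (c : P.Idx → ℝ) (f : Face d) (hm : (P.knots f.1).p ≤ m) {a : ℕ}
    (ha : (P.knots f.1).t a < (P.knots f.1).t (a + 1))
    (hf : Icc ((P.knots f.1).t a) ((P.knots f.1).t (a + 1)) ∈ 𝓝[Icc (0 : ℝ) 1] f.coord) :
    ((P.knots f.1).t (a + 1) - (P.knots f.1).t a) *
        ∫ η in P.FReg f, ‖P.dspl c (f.point η)‖ ^ 2 ≤
      C * ∫ ξ in P.Opn, ‖P.dspl c ξ‖ ^ 2 := by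
  set t₀ := (P.knots f.1).t a
  set t₁ := (P.knots f.1).t (a + 1)
  obtain ⟨e, he, hept⟩ := f.exists_measurePreserving
  set q : E d → ℝ := fun ξ => ‖P.dspl c ξ‖ ^ 2 with hq
  have hqc : ContinuousOn q P.Reg := (P.continuousOn_dspl c).norm.pow 2
  have hqb : ∃ B, ∀ ξ ∈ P.Reg, |q ξ| ≤ B := by
    obtain ⟨B, hB⟩ := P.exists_bound_dspl c
    refine ⟨B ^ 2, fun ξ hξ => ?_⟩
    rw [abs_of_nonneg (by positivity)]
    exact pow_le_pow_left₀ (norm_nonneg _) (hB ξ hξ) 2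
  have hq0 : ∀ ξ, 0 ≤ q ξ := fun ξ => sq_nonneg _
  have hqi : IntegrableOn q (cube d) :=
    (integrableOn_congr_set_ae P.Opn_ae_eq_cube).1 (integrableOn_Opn hqc hqb)
  rw [setIntegral_congr_set P.Opn_ae_eq_cube,
    ← he.setIntegral_preimage_emb e.measurableEmbedding q (cube d)]
  have hqi' : IntegrableOn (q ∘ e) (e ⁻¹' cube d) (volume.prod volume) :=
    (he.integrableOn_comp_preimage e.measurableEmbedding).2 hqi
  have hsub : P.FReg f ×ˢ Ioo t₀ t₁ ⊆ e ⁻¹' cube d := by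
    rintro ⟨η, s⟩ ⟨h1, h2⟩
    rw [mem_preimage, hept]
    refine f.forall_pt (p := fun i x => x ∈ Icc (0 : ℝ) 1) |>.2 ⟨fun i => FReg_subset f h1 i
      (mem_univ _), ((P.knots f.1).t_nonneg _).trans h2.1.le, h2.2.le.trans
      ((P.knots f.1).t_le_one _)⟩
  have hqi'' := hqi'.mono_set hsub
  -- Only the layer of cells next to the face is kept; the discarded part of the integral is
  -- nonnegative.
  have h1 : ∫ z in P.FReg f ×ˢ Ioo t₀ t₁, q (e z) ∂(volume.prod volume) ≤
      ∫ z in e ⁻¹' cube d, q (e z) ∂(volume.prod volume) :=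
    setIntegral_mono_set hqi' (Eventually.of_forall fun z => hq0 _) hsub.eventuallyLE
  rw [setIntegral_prod (fun z => q (e z)) hqi''] at h1
  refine le_trans ?_ (mul_le_mul_of_nonneg_left h1 hC0)
  rw [← integral_const_mul, ← integral_const_mul]
  have hqi3 : Integrable (fun z => q (e z))
      ((volume.restrict (P.FReg f)).prod (volume.restrict (Ioo t₀ t₁))) := by
    rw [Measure.prod_restrict]; exact hqi''
  refine setIntegral_mono_on ?_ (hqi3.integral_prod_left.const_mul C) (measurableSet_FReg f)
    fun η hη => ?_
  · refine Integrable.const_mul ?_ _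
    refine integrableOn_FReg (continuousOn_comp_point hqc) ?_
    obtain ⟨B, hB⟩ := hqb
    exact ⟨B, fun η hη => hB _ (point_mem_Reg hη)⟩
  -- With the tangential coordinates fixed, the integrand is a sum of squares of polynomials in the
  -- normal coordinate.
  · choose Q hQ1 hQ2 hQ3 using fun j => exists_polynomial_dspl c f ha hf η j
    have h2 : ∫ s in Ioo t₀ t₁, q (e (η, s)) = ∑ j, ∫ s in t₀..t₁, ((Q j).eval s) ^ 2 := by
      have h3 : ∫ s in Ioo t₀ t₁, q (e (η, s)) =
          ∫ s in Ioo t₀ t₁, ∑ j, ((Q j).eval s) ^ 2 := by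
        refine setIntegral_congr_fun measurableSet_Ioo fun s hs => ?_
        simp only [hq, hept, norm_sq_functional]
        exact Finset.sum_congr rfl fun j _ => by rw [hQ3 j s hs]
      rw [h3, ← integral_Ioc_eq_integral_Ioo, ← intervalIntegral.integral_of_le ha.le,
        intervalIntegral.integral_finsetSum]
      exact fun j _ => ((Q j).continuous.pow 2).intervalIntegrable _ _
    rw [h2, norm_sq_functional, Finset.mul_sum, Finset.mul_sum]
    refine Finset.sum_le_sum fun j _ => ?_
    rw [hQ2 j]
    exact hC _ ((hQ1 j).trans hm) _ _ ha _ (mem_of_mem_nhdsWithin f.coord_mem_Icc hf)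

end Patch

namespace Patch

variable {d : ℕ} {P : Patch d} {κ : ℝ}

/-! ## The mesh size -/

lemma norm_le_of_forall_coord_le {v : E d} {L : ℝ} (hL : 0 ≤ L) (h : ∀ j, |v j| ≤ L) :
    ‖v‖ ≤ d * L := by
  refine (pow_le_pow_iff_left₀ (norm_nonneg _) (by positivity) two_ne_zero).1 ?_
  rw [EuclideanSpace.norm_sq_eq]
  have h1 : ∀ j ∈ (Finset.univ : Finset (Fin d)), ‖v j‖ ^ 2 ≤ L ^ 2 := fun j _ =>
    pow_le_pow_left₀ (norm_nonneg _) (h j) 2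
  refine (Finset.sum_le_card_nsmul _ _ _ h1).trans ?_
  rw [Finset.card_univ, Fintype.card_fin, nsmul_eq_mul, mul_pow]
  refine mul_le_mul_of_nonneg_right ?_ (by positivity)
  exact_mod_cast Nat.le_self_pow two_ne_zero d

/-- By quasi-uniformity a single nonempty span bounds the sides of every cell, and the mapping is
Lipschitz on each cell. The trace inequality uses it with the span adjacent to the face. -/
lemma Good.h_le (hP : P.Good κ) {θ : ℝ} (hq : P.QuasiUniform θ) {j : Fin d} {a : ℕ}
    (ha : (P.knots j).t a < (P.knots j).t (a + 1)) :
    P.h ≤ κ * P.H * (d * (θ * ((P.knots j).t (a + 1) - (P.knots j).t a))) := by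
  set ℓ := (P.knots j).t (a + 1) - (P.knots j).t a
  have hκH : 0 ≤ κ * P.H := mul_nonneg hP.κ_pos.le hP.H_pos.le
  have hL : 0 ≤ θ * ℓ := le_trans (sub_pos.2 ha).le (hq j j a a ha)
  refine Real.sSup_le ?_ (mul_nonneg hκH (by positivity))
  rintro _ ⟨c, hc, rfl⟩
  refine Metric.diam_le_of_forall_dist_le (mul_nonneg hκH (by positivity)) ?_
  rintro _ ⟨x, hx, rfl⟩ _ ⟨y, hy, rfl⟩
  rw [dist_eq_norm]
  refine (hP.sr.norm_sub_le_of_mem_cell hP.κ_pos.le hc hx hy).trans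
    (mul_le_mul_of_nonneg_left (norm_le_of_forall_coord_le hL fun i => ?_) hκH)
  have h1 := hq i j (c i) a ha
  have h2 := hx i
  have h3 := hy i
  rw [PiLp.sub_apply, abs_le]
  constructor <;> linarith [h2.1, h2.2, h3.1, h3.2]

lemma Good.h_pos (hP : P.Good κ) : 0 < P.h := by
  let c : Fin d → ℕ := fun j => (P.knots j).p
  have hc : c ∈ P.cellIdx := fun j => (P.knots j).first_span.2
  have h1 : 0 < Metric.diam (P.G '' P.cell c) := by
    refine diam_pos_of_injOn hP.inj (P.cell_subset_cube c)
      ⟨WithLp.toLp 2 fun i => (P.knots i).t (c i), fun i => ⟨le_rfl, (hc i).le⟩,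
        WithLp.toLp 2 fun i => (P.knots i).t (c i + 1), fun i => ⟨(hc i).le, le_rfl⟩, fun h => ?_⟩
    have := congrArg (fun v : E d => v ⟨0, hP.d_pos⟩) h
    exact (hc ⟨0, hP.d_pos⟩).ne this
  refine h1.trans_le (le_csSup ⟨P.H, ?_⟩ ⟨c, hc, rfl⟩)
  rintro _ ⟨c, hc, rfl⟩
  rw [← diam_closedDom]
  exact Metric.diam_mono (image_mono (P.cell_subset_cube c)) isCompact_closedDom.isBounded

/-! ## The inverse trace inequality -/

lemma Good.integrableOn_inner_normal_mul (hP : P.Good κ) (f : Face d) {u : E d → ℝ}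
    (hu : u ∈ P.V) {w : ({i : Fin d // i ≠ f.1} → ℝ) → ℝ} (hw : ContinuousOn w (P.FReg f))
    (hb : ∃ B, ∀ η ∈ P.FReg f, |w η| ≤ B) :
    IntegrableOn (fun η => ⟪P.grad u (P.G (f.point η)), P.normal f (f.point η)⟫ * w η *
      P.surfaceDensity f (f.point η)) (P.FReg f) := by
  refine integrableOn_FReg ?_ ?_
  · exact ((((continuousOn_comp_point (hP.continuousOn_grad hu)).inner
      (continuousOn_comp_point (hP.continuousOn_normal f)))).mul hw).mul
        (continuousOn_comp_point (continuousOn_surfaceDensity f))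
  · obtain ⟨B, hB⟩ := hP.exists_bound_grad hu
    obtain ⟨B', hB'⟩ := hb
    refine ⟨B * B' * ((Nat.factorial (d - 1)) * (κ * P.H) ^ (d - 1)), fun η hη => ?_⟩
    have hr := point_mem_Reg hη
    have hB0 : 0 ≤ B := (norm_nonneg _).trans (hB _ hr)
    have hB0' : 0 ≤ B' := (abs_nonneg _).trans (hB' _ hη)
    rw [abs_mul, abs_mul, abs_of_nonneg (surfaceDensity_nonneg f _)]
    refine mul_le_mul (mul_le_mul ?_ (hB' η hη) (abs_nonneg _) hB0) (hP.surfaceDensity_le f hr)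
      (surfaceDensity_nonneg f _) (mul_nonneg hB0 hB0')
    refine (abs_real_inner_le_norm _ _).trans ?_
    calc _ ≤ B * 1 := mul_le_mul (hB _ hr) (norm_normal_le f _) (norm_nonneg _) hB0
      _ = B := mul_one _

lemma Good.abs_normal_derivative_le (hP : P.Good κ) (f : Face d) {u : E d → ℝ} (hu : u ∈ P.V) :
    ∃ B, ∀ η ∈ P.FReg f,
      |⟪P.grad u (P.G (f.point η)), P.normal f (f.point η)⟫| ≤ B := by
  obtain ⟨B, hB⟩ := hP.exists_bound_grad hu
  refine ⟨B, fun η hη => ?_⟩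
  have hr := point_mem_Reg hη
  refine (abs_real_inner_le_norm _ _).trans ?_
  calc _ ≤ B * 1 := mul_le_mul (hB _ hr) (norm_normal_le f _) (norm_nonneg _)
        ((norm_nonneg _).trans (hB _ hr))
    _ = B := mul_one _

lemma Good.integrableOn_normal_derivative_sq (hP : P.Good κ) (f : Face d) {u : E d → ℝ}
    (hu : u ∈ P.V) :
    IntegrableOn (fun η => ⟪P.grad u (P.G (f.point η)), P.normal f (f.point η)⟫ ^ 2 *
      P.surfaceDensity f (f.point η)) (P.FReg f) := by
  simp only [sq]
  exact hP.integrableOn_inner_normal_mul f hu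
    ((continuousOn_comp_point (hP.continuousOn_grad hu)).inner
      (continuousOn_comp_point (hP.continuousOn_normal f))) (hP.abs_normal_derivative_le f hu)

/-- The inverse trace inequality for splines on a patch. -/
lemma exists_inverse_trace (d m : ℕ) (κ θ : ℝ) : ∃ C : ℝ, 0 < C ∧ ∀ P : Patch d, P.Good κ →
    (∀ i, (P.knots i).p ≤ m) → P.QuasiUniform θ → ∀ (f : Face d), ∀ u ∈ P.V,
      P.h * P.faceIntegral f (fun x ν => ⟪P.grad u x, ν⟫ ^ 2) ≤
        C * ∫ x in P.dom, ⟪P.grad u x, P.grad u x⟫ := by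
  obtain ⟨C, hC, hpoly⟩ := exists_eval_sq_le_integral m
  -- The absolute value and the summand 1 keep the constant positive for all real `κ` and `θ`, which
  -- are fixed before any patch is given.
  refine ⟨|κ ^ (2 * d + 4) * d * θ * Nat.factorial (d - 1) * C| + 1, by positivity,
    fun P hP hm hq f u hu => ?_⟩
  obtain ⟨c, hc⟩ := hP.exists_represents hu
  obtain ⟨a, ha, hf⟩ := P.exists_end_span f
  have htr := integral_face_dspl_sq_le hpoly hC.le c f (hm f.1) ha hf
  have hh := hP.h_le hq ha
  have hθ : 0 ≤ θ * ((P.knots f.1).t (a + 1) - (P.knots f.1).t a) :=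
    le_trans (sub_pos.2 ha).le (hq f.1 f.1 a a ha)
  have hen := hP.integral_dspl_sq_le hu hc
  set ℓ := (P.knots f.1).t (a + 1) - (P.knots f.1).t a with hℓ
  have hℓ0 : 0 < ℓ := sub_pos.2 ha
  have hθ0 : 0 ≤ θ := nonneg_of_mul_nonneg_left hθ hℓ0
  set A := ∫ x in P.dom, ⟪P.grad u x, P.grad u x⟫
  set I := ∫ ξ in P.Opn, ‖P.dspl c ξ‖ ^ 2
  set J := ∫ η in P.FReg f, ‖P.dspl c (f.point η)‖ ^ 2
  have hA : 0 ≤ A := integral_nonneg fun x => real_inner_self_nonneg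
  have hJ0 : 0 ≤ J := integral_nonneg fun x => sq_nonneg _
  have hκ := hP.κ_pos
  have hH := hP.H_pos
  set D : ℝ := (Nat.factorial (d - 1)) * (κ * P.H) ^ (d - 1) with hD
  have hD0 : 0 ≤ D := by positivity
  have hface : P.faceIntegral f (fun x ν => ⟪P.grad u x, ν⟫ ^ 2) ≤ (κ / P.H) ^ 2 * D * J := by
    rw [faceIntegral_eq, ← integral_const_mul]
    refine setIntegral_mono_on (hP.integrableOn_normal_derivative_sq f hu) ?_
      (measurableSet_FReg f) fun η hη => ?_
    · refine Integrable.const_mul ?_ _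
      refine integrableOn_FReg (continuousOn_comp_point ((P.continuousOn_dspl c).norm.pow 2)) ?_
      obtain ⟨B, hB⟩ := P.exists_bound_dspl c
      refine ⟨B ^ 2, fun η hη => ?_⟩
      rw [abs_of_nonneg (by positivity)]
      exact pow_le_pow_left₀ (norm_nonneg _) (hB _ (point_mem_Reg hη)) 2
    · have hr := point_mem_Reg hη
      have h1 : |⟪P.grad u (P.G (f.point η)), P.normal f (f.point η)⟫| ≤
          κ / P.H * ‖P.dspl c (f.point η)‖ := by
        refine (abs_real_inner_le_norm _ _).trans ((mul_le_mul_of_nonneg_left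
          (norm_normal_le f _) (norm_nonneg _)).trans ?_)
        rw [mul_one]
        exact hP.norm_grad_le hc hr
      have h2 : ⟪P.grad u (P.G (f.point η)), P.normal f (f.point η)⟫ ^ 2 ≤
          (κ / P.H * ‖P.dspl c (f.point η)‖) ^ 2 := sq_le_sq' (abs_le.1 h1).1 (abs_le.1 h1).2
      calc _ ≤ (κ / P.H * ‖P.dspl c (f.point η)‖) ^ 2 * D :=
            mul_le_mul h2 (hP.surfaceDensity_le f hr) (surfaceDensity_nonneg f _) (sq_nonneg _)
        _ = _ := by ring
  have hI : I ≤ (κ / P.H) ^ d * (κ * P.H) ^ 2 * A := by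
    have h3 : (κ / P.H) ^ d * ((P.H / κ) ^ d * I) = I := by
      rw [← mul_assoc, ← mul_pow]
      have : κ / P.H * (P.H / κ) = 1 := by field_simp
      rw [this, one_pow, one_mul]
    rw [← h3, mul_assoc]
    exact mul_le_mul_of_nonneg_left hen (by positivity)
  have hd1 : (κ * P.H) ^ (d - 1) * (κ * P.H) = (κ * P.H) ^ d := by
    rw [← pow_succ, Nat.sub_add_cancel hP.d_pos]
  calc P.h * P.faceIntegral f (fun x ν => ⟪P.grad u x, ν⟫ ^ 2)
      ≤ (κ * P.H * (d * (θ * ℓ))) * ((κ / P.H) ^ 2 * D * J) := by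
        refine mul_le_mul hh hface ?_ (by positivity)
        rw [faceIntegral_eq]
        exact integral_nonneg fun η => mul_nonneg (sq_nonneg _) (surfaceDensity_nonneg f _)
    _ = (κ * P.H * (d * θ)) * ((κ / P.H) ^ 2 * D) * (ℓ * J) := by ring
    _ ≤ (κ * P.H * (d * θ)) * ((κ / P.H) ^ 2 * D) *
        (C * ((κ / P.H) ^ d * (κ * P.H) ^ 2 * A)) := by
        refine mul_le_mul_of_nonneg_left (htr.trans ?_) (by positivity)
        exact mul_le_mul_of_nonneg_left hI hC.le
    -- Pairing each `κ * P.H` with a `κ / P.H` cancels all powers of the patch size and leaves `2 *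
    -- d + 4` factors `κ`.
    _ = ((κ * P.H) ^ (d - 1) * (κ * P.H)) * (κ / P.H) ^ d * (κ / P.H) ^ 2 * (κ * P.H) ^ 2 *
          (d * θ * Nat.factorial (d - 1) * C) * A := by
        rw [hD]; ring
    _ = (κ ^ (2 * d + 4) * d * θ * Nat.factorial (d - 1) * C) * A := by
        rw [hd1, ← mul_pow, mul_assoc _ (_ ^ 2) (_ ^ 2), ← mul_pow]
        have h4 : κ * P.H * (κ / P.H) = κ ^ 2 := by field_simp
        have h5 : κ / P.H * (κ * P.H) = κ ^ 2 := by field_simp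
        rw [h4, h5, ← pow_mul, ← pow_mul]
        ring
    _ ≤ _ := by
        refine mul_le_mul_of_nonneg_right ?_ hA
        linarith [le_abs_self (κ ^ (2 * d + 4) * d * θ * Nat.factorial (d - 1) * C)]

/-! ## The number of the patches at a face -/

/-- Consecutive spans are chained at their common knots, and the estimates add up without loss in
the constant. -/
lemma norm_sub_le_of_spans {F : Type*} [NormedAddCommGroup F] {K : KnotVector} {g : ℝ → F} {C : ℝ}
    (hg : ∀ a, K.t a < K.t (a + 1) → ∀ s ∈ Icc (K.t a) (K.t (a + 1)),
      ∀ s' ∈ Icc (K.t a) (K.t (a + 1)), ‖g s - g s'‖ ≤ C * |s - s'|) :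
    ∀ s ∈ Icc (0 : ℝ) 1, ∀ s' ∈ Icc (0 : ℝ) 1, ‖g s - g s'‖ ≤ C * |s - s'| := by
  have key : ∀ a, ∀ s ∈ Icc 0 (K.t a), ∀ s' ∈ Icc 0 s, ‖g s - g s'‖ ≤ C * (s - s') := by
    intro a
    induction a with
    | zero =>
      intro s hs s' hs'
      rw [K.t_first 0 (Nat.zero_le _)] at hs
      have h1 : s = 0 := le_antisymm hs.2 hs.1
      have h2 : s' = s := by
        rw [h1] at hs' ⊢
        exact le_antisymm hs'.2 hs'.1
      simp [h2]
    | succ a ih =>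
      intro s hs s' hs'
      by_cases hsa : s ≤ K.t a
      · exact ih s ⟨hs.1, hsa⟩ s' hs'
      push Not at hsa
      have hlt : K.t a < K.t (a + 1) := hsa.trans_le hs.2
      have hsm : s ∈ Icc (K.t a) (K.t (a + 1)) := ⟨hsa.le, hs.2⟩
      by_cases hsa' : s' ≤ K.t a
      · have h1 := hg a hlt s hsm (K.t a) ⟨le_rfl, hlt.le⟩
        have h2 := ih (K.t a) ⟨K.t_nonneg a, le_rfl⟩ s' ⟨hs'.1, hsa'⟩
        rw [abs_of_nonneg (by linarith)] at h1
        calc ‖g s - g s'‖ ≤ ‖g s - g (K.t a)‖ + ‖g (K.t a) - g s'‖ :=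
              norm_sub_le_norm_sub_add_norm_sub _ _ _
          _ ≤ C * (s - K.t a) + C * (K.t a - s') := add_le_add h1 h2
          _ = C * (s - s') := by ring
      · push Not at hsa'
        have h1 := hg a hlt s hsm s' ⟨hsa'.le, hs'.2.trans hs.2⟩
        rwa [abs_of_nonneg (by linarith [hs'.2])] at h1
  have key' := key K.n
  rw [K.t_last _ le_rfl] at key'
  intro s hs s' hs'
  rcases le_total s' s with h | h
  · rw [abs_of_nonneg (by linarith)]
    exact key' s hs s' ⟨hs'.1, h⟩
  · rw [norm_sub_rev, abs_sub_comm, abs_of_nonneg (by linarith)]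
    exact key' s' hs' s ⟨hs.1, h⟩

/-- The geometrical mapping is Lipschitz continuous along the lines orthogonal to a face. -/
lemma Good.norm_G_pt_sub_le (hP : P.Good κ) (f : Face d) {η : {i : Fin d // i ≠ f.1} → ℝ}
    (hη : ∀ i, η i ∈ Icc (0 : ℝ) 1) : ∀ s ∈ Icc (0 : ℝ) 1, ∀ s' ∈ Icc (0 : ℝ) 1,
      ‖P.G (f.pt η s) - P.G (f.pt η s')‖ ≤ κ * P.H * |s - s'| := by
  refine norm_sub_le_of_spans (K := P.knots f.1) (g := fun s => P.G (f.pt η s)) ?_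
  intro a ha s hs s' hs'
  choose c hc1 hc2 using fun i : {i : Fin d // i ≠ f.1} => (P.knots i.1).exists_span_mem (hη i)
  -- While the normal coordinate stays in the span `a`, the whole segment lies in this one cell,
  -- where the Lipschitz bound is known.
  let c' : Fin d → ℕ := fun i => if h : i = f.1 then a else c ⟨i, h⟩
  have hcf : c' f.1 = a := by simp [c']
  have hcn : ∀ i : {i : Fin d // i ≠ f.1}, c' i.1 = c i := fun i => by simp [c', i.2]
  have hc' : c' ∈ P.cellIdx := by
    intro i
    by_cases hi : i = f.1
    · subst hi; rw [hcf]; exact ha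
    · have := hcn ⟨i, hi⟩
      rw [this]; exact hc1 ⟨i, hi⟩
  have hmem : ∀ s ∈ Icc ((P.knots f.1).t a) ((P.knots f.1).t (a + 1)), f.pt η s ∈ P.cell c' := by
    intro s hs
    refine f.forall_pt (p := fun i x => x ∈ Icc ((P.knots i).t (c' i))
      ((P.knots i).t (c' i + 1))) |>.2 ⟨fun i => ?_, ?_⟩
    · rw [hcn]; exact hc2 i
    · rw [hcf]; exact hs
  refine (hP.sr.norm_sub_le_of_mem_cell hP.κ_pos.le hc' (hmem s hs) (hmem s' hs')).trans ?_
  have : f.pt η s - f.pt η s' = EuclideanSpace.single f.1 (s - s') := by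
    ext i
    by_cases hi : i = f.1
    · subst hi; simp
    · simp [f.pt_apply_ne _ _ hi, hi]
  rw [this]
  simp

/-- Up to a null set the slab is a box with one side of length `r` and all others of length one. -/
lemma volume_slab {f : Face d} {r : ℝ} (hr0 : 0 ≤ r) (hr1 : r ≤ 1) :
    volume {ξ ∈ P.Opn | |ξ f.1 - f.coord| ≤ r} = ENNReal.ofReal r := by
  have h1 : ({ξ ∈ P.Opn | |ξ f.1 - f.coord| ≤ r} : Set (E d)) =ᵐ[volume]
      box fun i => if i = f.1 then {x ∈ Icc (0 : ℝ) 1 | |x - f.coord| ≤ r} else Icc 0 1 := by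
    have h2 : (box fun i => if i = f.1 then {x ∈ Icc (0 : ℝ) 1 | |x - f.coord| ≤ r} else Icc 0 1)
        = cube d ∩ {ξ : E d | |ξ f.1 - f.coord| ≤ r} := by
      ext ξ
      constructor
      · intro h
        refine ⟨fun i => ?_, ?_⟩
        · have := h i
          simp only at this
          split_ifs at this
          · exact this.1
          · exact this
        · have := h f.1
          simp only [if_true] at this
          exact this.2
      · intro h i
        simp only
        split_ifs with hi
        · subst hi; exact ⟨h.1 _, h.2⟩
        · exact h.1 i
    rw [h2]
    exact P.Opn_ae_eq_cube.inter (EventuallyEq.refl _ _)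
  have h3 : volume {x ∈ Icc (0 : ℝ) 1 | |x - f.coord| ≤ r} = ENNReal.ofReal r := by
    unfold Face.coord
    split_ifs
    · have : {x ∈ Icc (0 : ℝ) 1 | |x - 1| ≤ r} = Icc (1 - r) 1 := by
        ext x
        simp only [mem_ofPred_eq, mem_Icc, abs_le]
        constructor
        · rintro ⟨⟨h1, h2⟩, h3, h4⟩; constructor <;> linarith
        · rintro ⟨h1, h2⟩; refine ⟨⟨?_, ?_⟩, ?_, ?_⟩ <;> linarith
      rw [this, Real.volume_Icc]; congr 1; ring
    · have : {x ∈ Icc (0 : ℝ) 1 | |x - 0| ≤ r} = Icc 0 r := by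
        ext x
        simp only [mem_ofPred_eq, mem_Icc, abs_le]
        constructor
        · rintro ⟨⟨h1, h2⟩, h3, h4⟩; constructor <;> linarith
        · rintro ⟨h1, h2⟩; refine ⟨⟨?_, ?_⟩, ?_, ?_⟩ <;> linarith
      rw [this, Real.volume_Icc]; congr 1; ring
  rw [measure_congr h1, volume_box, ← Finset.mul_prod_erase _ _ (Finset.mem_univ f.1), if_pos rfl,
    h3, Finset.prod_congr rfl (g := fun _ => 1), Finset.prod_const_one, mul_one]
  intro i hi
  rw [if_neg (Finset.ne_of_mem_erase hi), Real.volume_Icc]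
  simp

lemma face_subset_closedDom (f : Face d) : P.face f ⊆ P.closedDom := image_mono fun _ hξ => hξ.1

/-- For `d ≥ 2` a face has a tangential direction, hence two distinct points, and the mapping is
injective. -/
lemma Good.diam_face_pos (hP : P.Good κ) (hd : 2 ≤ d) (f : Face d) :
    0 < Metric.diam (P.face f) := by
  have : Nontrivial (Fin d) := Fin.nontrivial_iff_two_le.2 hd
  obtain ⟨i, hi⟩ := exists_ne f.1
  refine diam_pos_of_injOn hP.inj (fun _ hξ => hξ.1)
    ⟨f.point fun _ => 0, f.point_mem_closedSet fun _ => by simp,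
      f.point fun _ => 1, f.point_mem_closedSet fun _ => by simp, fun h => ?_⟩
  have h1 := congrArg (fun v : E d => v i) h
  simp only [Face.point_eq_pt, f.pt_apply_ne _ _ hi] at h1
  norm_num at h1

/-- Near every face, a patch contains a set whose volume is bounded from below in terms of the
diameter of the face. -/
lemma Good.exists_volume_near_face (hP : P.Good κ) (hd : 2 ≤ d) (f : Face d) {x₀ : E d}
    (hx₀ : x₀ ∈ P.face f) : ∃ Z ⊆ P.dom, MeasurableSet Z ∧
      Z ⊆ Metric.closedBall x₀ (2 * Metric.diam (P.face f)) ∧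
      ENNReal.ofReal (Metric.diam (P.face f) ^ d / κ ^ (d + 1)) ≤ volume Z := by
  have hε := hP.diam_face_pos hd f
  have hεH : Metric.diam (P.face f) ≤ P.H := by
    rw [← diam_closedDom]
    exact Metric.diam_mono (face_subset_closedDom f) isCompact_closedDom.isBounded
  set ε := Metric.diam (P.face f) with hεdef
  have hκ := hP.κ_pos
  have hH := hP.H_pos
  -- With this thickness the image of the slab stays within distance `ε` of the face. It is at most
  -- 1 because `ε ≤ H` and `κ ≥ 1`.
  set r := ε / (κ * P.H) with hr
  have hr0 : 0 ≤ r := by positivity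
  have hr1 : r ≤ 1 := by
    rw [hr, div_le_one (by positivity)]
    nlinarith [hP.one_le]
  set S : Set (E d) := {ξ ∈ P.Opn | |ξ f.1 - f.coord| ≤ r} with hS
  have hSO : S ⊆ P.Opn := fun _ h => h.1
  have hSm : MeasurableSet S := P.measurableSet_Opn.inter
    (isClosed_le (f := fun ξ : E d => |ξ f.1 - f.coord|) (by fun_prop)
      continuous_const).measurableSet
  refine ⟨P.G '' S, image_mono (hSO.trans P.Opn_subset_openCube),
    measurable_image_of_fderivWithin hSm (hasFDerivWithinAt_G_Opn hSO)
      (hP.inj.mono (hSO.trans P.Opn_subset_cube)), ?_, ?_⟩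
  · rintro _ ⟨ξ, hξ, rfl⟩
    have hc := P.Opn_subset_cube hξ.1
    let η : {i : Fin d // i ≠ f.1} → ℝ := fun i => ξ i
    have hpt : f.pt η (ξ f.1) = ξ := by
      ext i
      by_cases hi : i = f.1
      · subst hi; simp
      · rw [f.pt_apply_ne _ _ hi]
    have h1 := hP.norm_G_pt_sub_le f (η := η) (fun i => hc i) (ξ f.1) (hc _) f.coord
      f.coord_mem_Icc
    rw [hpt] at h1
    have h2 : P.G (f.pt η f.coord) ∈ P.face f :=
      ⟨_, f.point_mem_closedSet (η := η) fun i => hc i, rfl⟩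
    have h3 := Metric.dist_le_diam_of_mem
      (isCompact_closedDom.isBounded.subset (face_subset_closedDom f)) h2 hx₀
    rw [Metric.mem_closedBall]
    have h4 : κ * P.H * |ξ f.1 - f.coord| ≤ ε := by
      calc _ ≤ κ * P.H * r := mul_le_mul_of_nonneg_left hξ.2 (by positivity)
        _ = ε := by rw [hr]; field_simp
    rw [← dist_eq_norm] at h1
    have h5 := dist_triangle (P.G ξ) (P.G (f.pt η f.coord)) x₀
    linarith
  · refine le_trans ?_ (hP.le_volume_image hSO hSm)
    rw [volume_slab hr0 hr1, ← ENNReal.ofReal_mul (by positivity)]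
    refine ENNReal.ofReal_le_ofReal ?_
    obtain ⟨n, rfl⟩ : ∃ n, d = n + 1 := ⟨d - 1, by omega⟩
    -- After this only `ε ^ n ≤ P.H ^ n` is needed, so the bound involves the diameter of the face
    -- and no longer the patch size.
    have h6 : (P.H / κ) ^ (n + 1) * r = P.H ^ n * ε / κ ^ (n + 1 + 1) := by
      rw [hr, div_pow]; field_simp; ring
    rw [h6, pow_succ ε]
    gcongr

end Patch

namespace MultiPatch

/-- The number of the patches which contain a given face is bounded. -/
lemma exists_card_le (d : ℕ) (hd : 2 ≤ d) (κ : ℝ) : ∃ C : ℝ, 0 < C ∧ ∀ (N : ℕ)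
    (M : MultiPatch d N), (∀ k, (M.patch k).Good κ) → ∀ (F : Set (E d)) (S : Finset (Fin N)),
      (∀ l ∈ S, ∃ f : Face d, F = (M.patch l).face f) → (S.card : ℝ) ≤ C := by
  set V₁ := (volume (Metric.ball (0 : E d) 1)).toReal with hV₁
  -- The first summand is the volume of the ball of radius `2 * ε` divided by the guaranteed volume
  -- per patch; the power of `ε` cancels.
  refine ⟨2 ^ d * |κ| ^ (d + 1) * V₁ + 1, by positivity, fun N M hM F S hS => ?_⟩
  rcases S.eq_empty_or_nonempty with rfl | ⟨l₀, hl₀⟩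
  · simp only [Finset.card_empty, Nat.cast_zero]; positivity
  have hκ := (hM l₀).κ_pos
  obtain ⟨f₀, hf₀⟩ := hS l₀ hl₀
  have hε : 0 < Metric.diam F := by rw [hf₀]; exact (hM l₀).diam_face_pos hd f₀
  obtain ⟨x₀, hx₀⟩ : F.Nonempty := by
    by_contra h
    rw [not_nonempty_iff_eq_empty] at h
    rw [h, Metric.diam_empty] at hε
    exact lt_irrefl _ hε
  set ε := Metric.diam F with hεdef
  -- Since the faces of all patches in `S` equal `F`, one centre and one radius serve them all. The
  -- empty set outside `S` makes the choice total.
  have hex : ∀ l, ∃ Z ⊆ (M.patch l).dom, MeasurableSet Z ∧ (l ∈ S →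
      Z ⊆ Metric.closedBall x₀ (2 * ε) ∧ ENNReal.ofReal (ε ^ d / κ ^ (d + 1)) ≤ volume Z) := by
    intro l
    by_cases hl : l ∈ S
    · obtain ⟨f, hf⟩ := hS l hl
      obtain ⟨Z, h1, h2, h3, h4⟩ := (hM l).exists_volume_near_face hd f (x₀ := x₀) (hf ▸ hx₀)
      rw [← hf] at h3 h4
      exact ⟨Z, h1, h2, fun _ => ⟨h3, h4⟩⟩
    · exact ⟨∅, empty_subset _, MeasurableSet.empty, fun h => absurd h hl⟩
  choose Z hZ1 hZ2 hZ3 using hex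
  have hdisj : (S : Set (Fin N)).PairwiseDisjoint Z := fun k _ l _ hkl =>
    (M.disjoint k l hkl).mono (hZ1 k) (hZ1 l)
  have h1 : ∑ l ∈ S, volume (Z l) ≤ volume (Metric.closedBall x₀ (2 * ε)) := by
    rw [← measure_biUnion_finset hdisj fun l _ => hZ2 l]
    exact measure_mono (iUnion₂_subset fun l hl => (hZ3 l hl).1)
  have h2 : (S.card : ENNReal) * ENNReal.ofReal (ε ^ d / κ ^ (d + 1)) ≤
      ∑ l ∈ S, volume (Z l) := by
    rw [← nsmul_eq_mul]
    exact Finset.card_nsmul_le_sum _ _ _ fun l hl => (hZ3 l hl).2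
  have h3 := h2.trans h1
  rw [Measure.addHaar_closedBall _ _ (by positivity), finrank_euclideanSpace_fin,
    ← ENNReal.ofReal_toReal (a := volume (Metric.ball (0 : E d) 1)) measure_ball_lt_top.ne,
    ← hV₁, ← ENNReal.ofReal_mul (by positivity), ← ENNReal.ofReal_natCast,
    ← ENNReal.ofReal_mul (by positivity), ENNReal.ofReal_le_ofReal_iff (by positivity)] at h3
  have h4 : (S.card : ℝ) ≤ 2 ^ d * κ ^ (d + 1) * V₁ := by
    rw [mul_pow, mul_div_assoc', div_le_iff₀ (by positivity)] at h3
    have hεd : 0 < ε ^ d := by positivity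
    refine le_of_mul_le_mul_right ?_ hεd
    linarith
  rw [abs_of_pos hκ]
  linarith

end MultiPatch

/-! ## Semidefinite forms and harmonic extensions -/

/-- `B` restricts to a symmetric positive semidefinite bilinear form on the subspace `X`. -/
structure PSDOn {V : Type*} [AddCommGroup V] [Module ℝ V] (X : Submodule ℝ V) (B : V → V → ℝ) :
    Prop where
  symm : ∀ u v, B u v = B v u
  add : ∀ u ∈ X, ∀ u' ∈ X, ∀ v ∈ X, B (u + u') v = B u v + B u' v
  smul : ∀ (r : ℝ), ∀ u ∈ X, ∀ v ∈ X, B (r • u) v = r * B u v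
  nonneg : ∀ u ∈ X, 0 ≤ B u u

/-- The bilinear form on the subspace. -/
def PSDOn.form {V : Type*} [AddCommGroup V] [Module ℝ V] {X : Submodule ℝ V} {B : V → V → ℝ}
    (h : PSDOn X B) : LinearMap.BilinForm ℝ X :=
  LinearMap.mk₂ ℝ (fun u v : X => B u v)
    (fun u u' v => h.add u u.2 u' u'.2 v v.2)
    (fun r u v => h.smul r u u.2 v v.2)
    (fun u v v' => by
      rw [h.symm u, Submodule.coe_add, h.add v v.2 v' v'.2 u u.2, h.symm u, h.symm u])
    (fun r u v => by
      rw [h.symm u, Submodule.coe_smul, h.smul r v v.2 u u.2, h.symm u, smul_eq_mul])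

namespace MultiPatch

variable {d N : ℕ} {M : MultiPatch d N}

section extension

variable {k : Fin N}

lemma mem_Vext_iff {u : Fin N → E d → ℝ} : u ∈ M.Vext k ↔
    u k ∈ (M.patch k).V ∧ (∀ l ∈ M.nbrs k, u l ∈ (M.patch l).VOn (M.interface l k)) ∧
      ∀ l, l ≠ k → l ∉ M.nbrs k → u l = 0 := by
  have hk : k ∉ M.nbrs k := by simp [nbrs]
  rw [Vext, Submodule.mem_pi]
  constructor
  · intro h
    refine ⟨by simpa using h k (mem_univ _), fun l hl => ?_, fun l hlk hl => ?_⟩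
    · have hlk : l ≠ k := fun h => hk (h ▸ hl)
      simpa [hlk, hl] using h l (mem_univ _)
    · simpa [hlk, hl] using h l (mem_univ _)
  · rintro ⟨h1, h2, h3⟩ l -
    split_ifs with h h'
    · subst h; exact h1
    · exact h2 l h'
    · exact (Submodule.mem_bot ℝ).2 (h3 l h h')

lemma mem_V_of_mem_Vext {u : Fin N → E d → ℝ} (hu : u ∈ M.Vext k) : u k ∈ (M.patch k).V :=
  (mem_Vext_iff.1 hu).1

lemma mem_V_of_mem_Vext_of_mem_nbrs {u : Fin N → E d → ℝ} (hu : u ∈ M.Vext k) {l : Fin N}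
    (hl : l ∈ M.nbrs k) : u l ∈ (M.patch l).V :=
  Patch.VOn_le_V _ ((mem_Vext_iff.1 hu).2.1 l hl)

lemma W_le_Vext : M.W k ≤ M.Vext k := by
  refine Submodule.pi_mono fun l _ => ?_
  split_ifs with h
  · subst h; exact Patch.VOn_le_V _
  · exact le_rfl
  · exact le_rfl

lemma finiteDimensional_pi {ι : Type*} [Finite ι] {V : ι → Type*} [∀ i, AddCommGroup (V i)]
    [∀ i, Module ℝ (V i)] (p : ∀ i, Submodule ℝ (V i)) [∀ i, FiniteDimensional ℝ (p i)] :
    FiniteDimensional ℝ (Submodule.pi Set.univ p) := by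
  let f : Submodule.pi Set.univ p →ₗ[ℝ] ∀ i, p i :=
    { toFun := fun u i => ⟨u.1 i, u.2 i (mem_univ _)⟩
      map_add' := fun _ _ => rfl
      map_smul' := fun _ _ => rfl }
  refine FiniteDimensional.of_injective f fun u v h => ?_
  ext1
  funext i
  exact congrArg Subtype.val (congrFun h i)

instance : FiniteDimensional ℝ (M.Vext k) := by
  refine @finiteDimensional_pi (Fin N) _ (fun _ => E d → ℝ) _ _ _ (fun l => ?_)
  by_cases h : l = k
  · rw [if_pos h]
    exact FiniteDimensional.span_of_finite ℝ ((toFinite (M.patch k).freeIdx).image _)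
  by_cases h' : l ∈ M.nbrs k
  · rw [if_neg h, if_pos h']
    exact FiniteDimensional.span_of_finite ℝ ((toFinite _).image _)
  · rw [if_neg h, if_neg h']
    infer_instance

/-- The functions on the extended patch which vanish on the extended interface form a subspace. -/
def VISub (M : MultiPatch d N) (k : Fin N) : Submodule ℝ (M.Vext k) where
  carrier := {v | M.AgreeOnInterface k v 0}
  add_mem' := by
    rintro u v ⟨h1, h2⟩ ⟨h3, h4⟩
    refine ⟨fun x hx => ?_, fun l hl x hx => ?_⟩
    · simpa using congrArg₂ (· + ·) (h1 hx) (h3 hx)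
    · simpa using congrArg₂ (· + ·) (h2 l hl hx) (h4 l hl hx)
  zero_mem' := ⟨fun _ _ => rfl, fun _ _ _ _ => rfl⟩
  smul_mem' := by
    rintro c u ⟨h1, h2⟩
    refine ⟨fun x hx => ?_, fun l hl x hx => ?_⟩
    · have := h1 hx
      simp only [Pi.zero_apply] at this
      simp [this]
    · have := h2 l hl hx
      simp only [Pi.zero_apply] at this
      simp [this]

/-- The correction is taken from the finite-dimensional space of functions vanishing on the extended
interface, so it leaves the prescribed values unchanged. Semidefiniteness suffices; uniqueness is
not claimed. -/
lemma exists_isHarmonicExt {B : (Fin N → E d → ℝ) → (Fin N → E d → ℝ) → ℝ}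
    (hB : PSDOn (M.Vext k) B) {u : Fin N → E d → ℝ} (hu : u ∈ M.Vext k) :
    ∃ w, M.IsHarmonicExt k B u w := by
  obtain ⟨y, hy, h⟩ := exists_add_orthogonal hB.form (fun x y => hB.symm x y)
    (fun x => hB.nonneg x x.2) (M.VISub k) ⟨u, hu⟩
  refine ⟨u + y, (M.Vext k).add_mem hu y.2, fun v hv => h ⟨v, hv.1⟩ hv.2, ?_, ?_⟩
  · intro x hx
    have := hy.1 hx
    simp only [Pi.zero_apply] at this
    simp [this]
  · intro l hl x hx
    have := hy.2 l hl hx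
    simp only [Pi.zero_apply] at this
    simp [this]

lemma AgreeOnInterface.trans_symm {u v w : Fin N → E d → ℝ} (h1 : M.AgreeOnInterface k u w)
    (h2 : M.AgreeOnInterface k v w) : M.AgreeOnInterface k u v :=
  ⟨h1.1.trans h2.1.symm, fun l hl => (h1.2 l hl).trans (h2.2 l hl).symm⟩

/-- Harmonic extensions have minimal energy. -/
lemma IsHarmonicExt.le {B : (Fin N → E d → ℝ) → (Fin N → E d → ℝ) → ℝ}
    (hB : PSDOn (M.Vext k) B) {u w w' : Fin N → E d → ℝ} (hw : M.IsHarmonicExt k B u w)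
    (hw' : w' ∈ M.Vext k) (ha : M.AgreeOnInterface k w' u) : B w w ≤ B w' w' := by
  have hz : w' - w ∈ M.Vext k := (M.Vext k).sub_mem hw' hw.mem
  have hag := ha.trans_symm hw.agree
  have hzI : w' - w ∈ M.VI k := by
    refine ⟨hz, fun x hx => ?_, fun l hl x hx => ?_⟩
    · simpa using sub_eq_zero.2 (hag.1 hx)
    · simpa using sub_eq_zero.2 (hag.2 l hl hx)
  have h0 := hw.orthogonal _ hzI
  have h1 : w' = w + (w' - w) := by abel
  -- The difference is an admissible test function, so the cross term drops out and the last term is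
  -- nonnegative.
  have h2 : B w' w' = B w w + 2 * B w (w' - w) + B (w' - w) (w' - w) := by
    have e1 := hB.add w hw.mem (w' - w) hz w' hw'
    rw [← h1, hB.symm w w', hB.symm (w' - w) w'] at e1
    have e2 := hB.add w hw.mem (w' - w) hz w hw.mem
    have e3 := hB.add w hw.mem (w' - w) hz (w' - w) hz
    rw [← h1] at e2 e3
    rw [e1, e2, e3, hB.symm (w' - w) w]
    ring
  rw [h2, h0]
  linarith [hB.nonneg _ hz]

end extension

/-! ## The forms on the extended patch -/

section forms

variable {κ : ℝ} {k : Fin N}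

lemma mem_commonFaces_symm {l : Fin N} {f : Face d} (hf : f ∈ M.commonFaces k l) :
    ∃ f' ∈ M.commonFaces l k, (M.patch k).face f = (M.patch l).face f' := by
  simp only [commonFaces, Finset.mem_filter, Finset.mem_univ, true_and] at hf ⊢
  obtain ⟨f', h⟩ := hf
  exact ⟨f', ⟨f, h.symm⟩, h⟩

lemma face_subset_interface {l : Fin N} {f : Face d} (hf : f ∈ M.commonFaces k l) :
    (M.patch k).face f ⊆ M.interface k l :=
  subset_biUnion_of_mem (u := fun f => (M.patch k).face f) hf

lemma face_subset_interface_symm {l : Fin N} {f : Face d} (hf : f ∈ M.commonFaces k l) :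
    (M.patch k).face f ⊆ M.interface l k := by
  obtain ⟨f', hf', h⟩ := mem_commonFaces_symm hf
  rw [h]
  exact face_subset_interface hf'

lemma face_subset_Γ {l : Fin N} (hl : l ∈ M.nbrs k) {f : Face d} (hf : f ∈ M.commonFaces k l) :
    (M.patch k).face f ⊆ M.Γ k :=
  (face_subset_interface hf).trans (subset_biUnion_of_mem (u := fun l => M.interface k l) hl)

variable (M) in
/-- The jump of a function across a face, in tangential coordinates. -/
def jump (k l : Fin N) (f : Face d) (u : Fin N → E d → ℝ) (η : {i : Fin d // i ≠ f.1} → ℝ) : ℝ :=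
  u l ((M.patch k).G (f.point η)) - u k ((M.patch k).G (f.point η))

variable (M) in
/-- The normal derivative of a function on a face, in tangential coordinates. -/
def dnormal (k : Fin N) (f : Face d) (u : Fin N → E d → ℝ) (η : {i : Fin d // i ≠ f.1} → ℝ) : ℝ :=
  ⟪(M.patch k).grad (u k) ((M.patch k).G (f.point η)), (M.patch k).normal f (f.point η)⟫

lemma a_eq (α : Fin N → ℝ) (u v : Fin N → E d → ℝ) : M.a α k u v =
    α k * ∫ x in (M.patch k).dom, ⟪(M.patch k).grad (u k) x, (M.patch k).grad (v k) x⟫ :=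
  integral_const_mul _ _

lemma s_eq (α : Fin N → ℝ) (u v : Fin N → E d → ℝ) : M.s α k u v =
    ∑ l ∈ M.nbrs k, ∑ f ∈ M.commonFaces k l, ∫ η in (M.patch k).FReg f,
      (α k / 2 * (M.dnormal k f u η * M.jump k l f v η + M.dnormal k f v η * M.jump k l f u η)) *
        (M.patch k).surfaceDensity f (f.point η) :=
  Finset.sum_congr rfl fun _ _ => Finset.sum_congr rfl fun f _ => Patch.faceIntegral_eq f _

lemma pen_eq (α : Fin N → ℝ) (δ : ℝ) (u v : Fin N → E d → ℝ) : M.pen α δ k u v =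
    ∑ l ∈ M.nbrs k, ∑ f ∈ M.commonFaces k l, ∫ η in (M.patch k).FReg f,
      (δ * α k / (2 * M.hAvg k l) * (M.jump k l f u η * M.jump k l f v η)) *
        (M.patch k).surfaceDensity f (f.point η) :=
  Finset.sum_congr rfl fun _ _ => Finset.sum_congr rfl fun f _ => Patch.faceIntegral_eq f _

lemma jump_add (l : Fin N) (f : Face d) (u v : Fin N → E d → ℝ)
    (η : {i : Fin d // i ≠ f.1} → ℝ) :
    M.jump k l f (u + v) η = M.jump k l f u η + M.jump k l f v η := by
  simp only [jump, Pi.add_apply]; ring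

lemma jump_smul (l : Fin N) (f : Face d) (r : ℝ) (u : Fin N → E d → ℝ)
    (η : {i : Fin d // i ≠ f.1} → ℝ) :
    M.jump k l f (r • u) η = r * M.jump k l f u η := by
  simp only [jump, Pi.smul_apply, smul_eq_mul]; ring

lemma dnormal_add (hM : ∀ k, (M.patch k).Good κ)
    {u v : Fin N → E d → ℝ} (hu : u ∈ M.Vext k) (hv : v ∈ M.Vext k) (f : Face d)
    {η : {i : Fin d // i ≠ f.1} → ℝ} (hη : η ∈ (M.patch k).FReg f) :
    M.dnormal k f (u + v) η = M.dnormal k f u η + M.dnormal k f v η := by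
  simp only [dnormal, Pi.add_apply]
  rw [(hM k).grad_add (mem_V_of_mem_Vext hu) (mem_V_of_mem_Vext hv) (Patch.point_mem_Reg hη),
    inner_add_left]

lemma dnormal_smul (hM : ∀ k, (M.patch k).Good κ)
    (r : ℝ) {u : Fin N → E d → ℝ} (hu : u ∈ M.Vext k) (f : Face d)
    {η : {i : Fin d // i ≠ f.1} → ℝ} (hη : η ∈ (M.patch k).FReg f) :
    M.dnormal k f (r • u) η = r * M.dnormal k f u η := by
  simp only [dnormal, Pi.smul_apply]
  rw [(hM k).grad_smul r (mem_V_of_mem_Vext hu) (Patch.point_mem_Reg hη), real_inner_smul_left]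

lemma continuousOn_jump (hM : ∀ k, (M.patch k).Good κ)
    {u : Fin N → E d → ℝ} (hu : u ∈ M.Vext k) {l : Fin N}
    (hl : l ∈ M.nbrs k) {f : Face d} (hf : f ∈ M.commonFaces k l) :
    ContinuousOn (M.jump k l f u) (Set.univ.pi fun _ => Icc 0 1) := by
  have hmaps : MapsTo (fun η => (M.patch k).G (f.point η))
      (Set.univ.pi fun _ : {i : Fin d // i ≠ f.1} => Icc (0 : ℝ) 1) ((M.patch k).face f) :=
    fun η hη => ⟨_, f.point_mem_closedSet fun i => hη i (mem_univ _), rfl⟩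
  have hG : ContinuousOn (fun η => (M.patch k).G (f.point η))
      (Set.univ.pi fun _ : {i : Fin d // i ≠ f.1} => Icc (0 : ℝ) 1) :=
    (M.patch k).continuousOn_G.comp f.continuous_point.continuousOn fun η hη =>
      (f.point_mem_closedSet fun i => hη i (mem_univ _)).1
  obtain ⟨f', -, hf'⟩ := mem_commonFaces_symm hf
  refine ContinuousOn.sub ?_ ?_
  · refine ((hM l).continuousOn_of_mem_V (mem_V_of_mem_Vext_of_mem_nbrs hu hl)).comp hG ?_
    exact fun η hη => Patch.face_subset_closedDom f' (hf' ▸ hmaps hη)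
  · refine ((hM k).continuousOn_of_mem_V (mem_V_of_mem_Vext hu)).comp hG ?_
    exact fun η hη => Patch.face_subset_closedDom f (hmaps hη)

lemma exists_bound_jump (hM : ∀ k, (M.patch k).Good κ)
    {u : Fin N → E d → ℝ} (hu : u ∈ M.Vext k) {l : Fin N}
    (hl : l ∈ M.nbrs k) {f : Face d} (hf : f ∈ M.commonFaces k l) :
    ∃ B, ∀ η ∈ (M.patch k).FReg f, |M.jump k l f u η| ≤ B := by
  obtain ⟨B, hB⟩ := (isCompact_univ_pi fun _ : {i : Fin d // i ≠ f.1} =>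
    isCompact_Icc (a := (0 : ℝ)) (b := 1)).exists_bound_of_continuousOn
      (continuousOn_jump hM hu hl hf)
  exact ⟨B, fun η hη => hB η (Patch.FReg_subset f hη)⟩

lemma integrableOn_dnormal_jump (hM : ∀ k, (M.patch k).Good κ)
    {u v : Fin N → E d → ℝ} (hu : u ∈ M.Vext k) (hv : v ∈ M.Vext k)
    {l : Fin N} (hl : l ∈ M.nbrs k) {f : Face d} (hf : f ∈ M.commonFaces k l) :
    IntegrableOn (fun η => M.dnormal k f u η * M.jump k l f v η *
      (M.patch k).surfaceDensity f (f.point η)) ((M.patch k).FReg f) :=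
  (hM k).integrableOn_inner_normal_mul f (mem_V_of_mem_Vext hu)
    ((continuousOn_jump hM hv hl hf).mono (Patch.FReg_subset f)) (exists_bound_jump hM hv hl hf)

lemma integrableOn_s (hM : ∀ k, (M.patch k).Good κ)
    {u v : Fin N → E d → ℝ} (hu : u ∈ M.Vext k) (hv : v ∈ M.Vext k)
    {l : Fin N} (hl : l ∈ M.nbrs k) {f : Face d} (hf : f ∈ M.commonFaces k l) (c : ℝ) :
    IntegrableOn (fun η =>
      (c * (M.dnormal k f u η * M.jump k l f v η + M.dnormal k f v η * M.jump k l f u η)) *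
        (M.patch k).surfaceDensity f (f.point η)) ((M.patch k).FReg f) := by
  refine (((integrableOn_dnormal_jump hM hu hv hl hf).add
    (integrableOn_dnormal_jump hM hv hu hl hf)).const_mul c).congr ?_
  exact Eventually.of_forall fun η => by simp only [Pi.add_apply]; ring

lemma integrableOn_jump_mul_jump (hM : ∀ k, (M.patch k).Good κ)
    {u v : Fin N → E d → ℝ} (hu : u ∈ M.Vext k) (hv : v ∈ M.Vext k)
    {l : Fin N} (hl : l ∈ M.nbrs k) {f : Face d} (hf : f ∈ M.commonFaces k l) (c : ℝ) :
    IntegrableOn (fun η => (c * (M.jump k l f u η * M.jump k l f v η)) *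
      (M.patch k).surfaceDensity f (f.point η)) ((M.patch k).FReg f) := by
  have hsub := Patch.FReg_subset (P := M.patch k) f
  refine Patch.integrableOn_FReg ((continuousOn_const.mul
    (((continuousOn_jump hM hu hl hf).mono hsub).mul
      ((continuousOn_jump hM hv hl hf).mono hsub))).mul
        (Patch.continuousOn_comp_point (Patch.continuousOn_surfaceDensity f))) ?_
  obtain ⟨B, hB⟩ := exists_bound_jump hM hu hl hf
  obtain ⟨B', hB'⟩ := exists_bound_jump hM hv hl hf
  refine ⟨|c| * (B * B') *
    ((Nat.factorial (d - 1)) * (κ * (M.patch k).H) ^ (d - 1)), fun η hη => ?_⟩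
  have hB0 : 0 ≤ B := (abs_nonneg _).trans (hB _ hη)
  have hB0' : 0 ≤ B' := (abs_nonneg _).trans (hB' _ hη)
  rw [abs_mul, abs_mul, abs_mul, abs_of_nonneg (Patch.surfaceDensity_nonneg f _)]
  refine mul_le_mul (mul_le_mul_of_nonneg_left (mul_le_mul (hB η hη) (hB' η hη) (abs_nonneg _)
    hB0) (abs_nonneg _)) ((hM k).surfaceDensity_le f (Patch.point_mem_Reg hη))
    (Patch.surfaceDensity_nonneg f _) (by positivity)

lemma psdOn_a (hM : ∀ k, (M.patch k).Good κ)
    {α : Fin N → ℝ} (hα : ∀ k, 0 < α k) : PSDOn (M.Vext k) (M.a α k) where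
  symm u v := by simp only [a_eq, real_inner_comm]
  add u hu u' hu' v hv := by
    have h1 := mem_V_of_mem_Vext hu
    have h2 := mem_V_of_mem_Vext hu'
    have h3 := mem_V_of_mem_Vext hv
    rw [a_eq, a_eq, a_eq, ← mul_add, ← integral_add ((hM k).integrableOn_inner_grad h1 h3)
      ((hM k).integrableOn_inner_grad h2 h3)]
    congr 1
    refine (hM k).integral_dom_congr fun ξ hξ => ?_
    rw [Pi.add_apply, (hM k).grad_add h1 h2 hξ, inner_add_left]
  smul r u hu v hv := by
    rw [a_eq, a_eq, mul_left_comm]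
    congr 1
    rw [← integral_const_mul]
    refine (hM k).integral_dom_congr fun ξ hξ => ?_
    rw [Pi.smul_apply, (hM k).grad_smul r (mem_V_of_mem_Vext hu) hξ, real_inner_smul_left]
  nonneg u _ := by
    rw [a_eq]
    exact mul_nonneg (hα k).le (integral_nonneg fun x => real_inner_self_nonneg)

lemma s_symm (α : Fin N → ℝ) (u v : Fin N → E d → ℝ) : M.s α k u v = M.s α k v u := by
  simp only [s_eq, add_comm]

lemma pen_symm (α : Fin N → ℝ) (δ : ℝ) (u v : Fin N → E d → ℝ) :
    M.pen α δ k u v = M.pen α δ k v u := by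
  simp only [pen_eq, mul_comm (M.jump k _ _ u _)]

lemma s_add (hM : ∀ k, (M.patch k).Good κ)
    (α : Fin N → ℝ) {u u' v : Fin N → E d → ℝ} (hu : u ∈ M.Vext k)
    (hu' : u' ∈ M.Vext k) (hv : v ∈ M.Vext k) :
    M.s α k (u + u') v = M.s α k u v + M.s α k u' v := by
  rw [s_eq, s_eq, s_eq, ← Finset.sum_add_distrib]
  refine Finset.sum_congr rfl fun l hl => ?_
  rw [← Finset.sum_add_distrib]
  refine Finset.sum_congr rfl fun f hf => ?_
  rw [← integral_add (integrableOn_s hM hu hv hl hf _) (integrableOn_s hM hu' hv hl hf _)]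
  refine setIntegral_congr_fun (Patch.measurableSet_FReg f) fun η hη => ?_
  simp only [dnormal_add hM hu hu' f hη, jump_add]
  ring

lemma s_smul (hM : ∀ k, (M.patch k).Good κ)
    (α : Fin N → ℝ) (r : ℝ) {u v : Fin N → E d → ℝ} (hu : u ∈ M.Vext k) :
    M.s α k (r • u) v = r * M.s α k u v := by
  rw [s_eq, s_eq, Finset.mul_sum]
  refine Finset.sum_congr rfl fun l hl => ?_
  rw [Finset.mul_sum]
  refine Finset.sum_congr rfl fun f hf => ?_
  rw [← integral_const_mul]
  refine setIntegral_congr_fun (Patch.measurableSet_FReg f) fun η hη => ?_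
  simp only [dnormal_smul hM r hu f hη, jump_smul]
  ring

lemma pen_add (hM : ∀ k, (M.patch k).Good κ)
    (α : Fin N → ℝ) (δ : ℝ) {u u' v : Fin N → E d → ℝ} (hu : u ∈ M.Vext k)
    (hu' : u' ∈ M.Vext k) (hv : v ∈ M.Vext k) :
    M.pen α δ k (u + u') v = M.pen α δ k u v + M.pen α δ k u' v := by
  rw [pen_eq, pen_eq, pen_eq, ← Finset.sum_add_distrib]
  refine Finset.sum_congr rfl fun l hl => ?_
  rw [← Finset.sum_add_distrib]
  refine Finset.sum_congr rfl fun f hf => ?_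
  rw [← integral_add (integrableOn_jump_mul_jump hM hu hv hl hf _)
    (integrableOn_jump_mul_jump hM hu' hv hl hf _)]
  congr 1
  funext η
  simp only [jump_add]
  ring

lemma pen_smul (α : Fin N → ℝ) (δ r : ℝ) (u v : Fin N → E d → ℝ) :
    M.pen α δ k (r • u) v = r * M.pen α δ k u v := by
  rw [pen_eq, pen_eq, Finset.mul_sum]
  refine Finset.sum_congr rfl fun l hl => ?_
  rw [Finset.mul_sum]
  refine Finset.sum_congr rfl fun f hf => ?_
  rw [← integral_const_mul]
  congr 1
  funext η
  simp only [jump_smul]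
  ring

lemma hAvg_pos (hM : ∀ k, (M.patch k).Good κ)
    (k l : Fin N) : 0 < M.hAvg k l := by
  have h1 := (hM k).h_pos
  have h2 := (hM l).h_pos
  unfold hAvg
  positivity

/-- This makes the penalty weight `1 / hAvg` at least a fixed multiple of `1 / h` for the own patch,
however the neighbour is meshed. -/
lemma hAvg_le (hM : ∀ k, (M.patch k).Good κ)
    (k l : Fin N) : M.hAvg k l ≤ 2 * (M.patch k).h := by
  have h1 := (hM k).h_pos
  have h2 := (hM l).h_pos
  unfold hAvg
  rw [div_le_iff₀ (by positivity)]
  nlinarith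

lemma pen_nonneg (hM : ∀ k, (M.patch k).Good κ)
    {α : Fin N → ℝ} (hα : ∀ k, 0 < α k) {δ : ℝ} (hδ : 0 ≤ δ)
    (u : Fin N → E d → ℝ) : 0 ≤ M.pen α δ k u u := by
  rw [pen_eq]
  refine Finset.sum_nonneg fun l _ => Finset.sum_nonneg fun f _ => integral_nonneg fun η => ?_
  have := hAvg_pos hM k l
  have := hα k
  exact mul_nonneg (mul_nonneg (by positivity) (mul_self_nonneg _))
    (Patch.surfaceDensity_nonneg f _)

/-- The penalty form depends on the values on the extended interface only. -/
lemma pen_congr (α : Fin N → ℝ) (δ : ℝ) {u v : Fin N → E d → ℝ}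
    (h : M.AgreeOnInterface k u v) : M.pen α δ k u u = M.pen α δ k v v := by
  rw [pen_eq, pen_eq]
  refine Finset.sum_congr rfl fun l hl => Finset.sum_congr rfl fun f hf => ?_
  refine setIntegral_congr_fun (Patch.measurableSet_FReg f) fun η hη => ?_
  have hx : (M.patch k).G (f.point η) ∈ (M.patch k).face f :=
    ⟨_, f.point_mem_closedSet fun i => Patch.FReg_subset f hη i (mem_univ _), rfl⟩
  have hj : M.jump k l f u η = M.jump k l f v η := by
    rw [jump, jump, h.1 (face_subset_Γ hl hf hx), h.2 l hl (face_subset_interface_symm hf hx)]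
  simp only [hj]

end forms

end MultiPatch

/-! ### Absorbing the consistency terms into the energy and the penalty. -/

namespace MultiPatch

variable {d N : ℕ} {M : MultiPatch d N} {κ : ℝ} {k : Fin N}

/-- The number of the pairs of a neighbour and a common face is bounded. -/
lemma sum_commonFaces_le {c C : ℝ} (hc : 0 ≤ c)
    (hC : ∀ (F : Set (E d)) (S : Finset (Fin N)),
      (∀ l ∈ S, ∃ f : Face d, F = (M.patch l).face f) → (S.card : ℝ) ≤ C) :
    ∑ l ∈ M.nbrs k, ∑ _f ∈ M.commonFaces k l, c ≤ 2 * d * C * c := by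
  classical
  -- Summing over the `2 * d` faces first leaves, for each of them, only the neighbours that contain
  -- this face.
  rw [Finset.sum_comm' (t' := Finset.univ)
    (s' := fun f => (M.nbrs k).filter fun l => f ∈ M.commonFaces k l) (by simp)]
  have h : ∀ f ∈ (Finset.univ : Finset (Face d)),
      ∑ _l ∈ (M.nbrs k).filter fun l => f ∈ M.commonFaces k l, c ≤ C * c := by
    intro f _
    rw [Finset.sum_const, nsmul_eq_mul]
    refine mul_le_mul_of_nonneg_right (hC ((M.patch k).face f) _ fun l hl => ?_) hc
    obtain ⟨f', -, h⟩ := mem_commonFaces_symm (Finset.mem_filter.1 hl).2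
    exact ⟨f', h⟩
  refine (Finset.sum_le_card_nsmul _ _ _ h).trans (le_of_eq ?_)
  rw [Finset.card_univ, Fintype.card_prod, Fintype.card_fin, Fintype.card_bool, nsmul_eq_mul]
  push_cast
  ring

/-- Young's inequality: the discriminant condition makes both quadratic forms `p X² ± X Y + q Y²`
nonnegative. -/
lemma abs_mul_le_add_sq {X Y p q : ℝ} (hp : 0 < p) (hpq : 1 ≤ 4 * p * q) :
    |X * Y| ≤ p * X ^ 2 + q * Y ^ 2 := by
  have h1 : 4 * p * (X * Y) ≤ 4 * p * (p * X ^ 2 + q * Y ^ 2) := by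
    nlinarith [sq_nonneg (2 * p * X - Y), mul_le_mul_of_nonneg_right hpq (sq_nonneg Y)]
  have h2 : 4 * p * (-(X * Y)) ≤ 4 * p * (p * X ^ 2 + q * Y ^ 2) := by
    nlinarith [sq_nonneg (2 * p * X + Y), mul_le_mul_of_nonneg_right hpq (sq_nonneg Y)]
  exact abs_le'.2 ⟨le_of_mul_le_mul_left h1 (by positivity),
    le_of_mul_le_mul_left h2 (by positivity)⟩

/-- The consistency terms are controlled by the energy and the penalty terms. -/
lemma abs_s_le (hM : ∀ k, (M.patch k).Good κ) {CT Cp : ℝ} (hCT : 0 < CT) (hCp : 0 < Cp)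
    (hT : ∀ (f : Face d), ∀ u ∈ (M.patch k).V,
      (M.patch k).h * (M.patch k).faceIntegral f (fun x ν => ⟪(M.patch k).grad u x, ν⟫ ^ 2) ≤
        CT * ∫ x in (M.patch k).dom, ⟪(M.patch k).grad u x, (M.patch k).grad u x⟫)
    (hC : ∀ (F : Set (E d)) (S : Finset (Fin N)),
      (∀ l ∈ S, ∃ f : Face d, F = (M.patch l).face f) → (S.card : ℝ) ≤ Cp)
    {α : Fin N → ℝ} (hα : ∀ k, 0 < α k) {δ : ℝ} (hδ : 8 * d * Cp * CT ≤ δ)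
    {u : Fin N → E d → ℝ} (hu : u ∈ M.Vext k) :
    |M.s α k u u| ≤ 1 / 2 * (M.a α k u u + M.pen α δ k u u) := by
  have hd : (0 : ℝ) < d := by exact_mod_cast (hM k).d_pos
  have hαk := hα k
  have hh := (hM k).h_pos
  have hδ0 : 0 < δ := lt_of_lt_of_le (by positivity) hδ
  -- Chosen so that the at most `2 * d * Cp` gradient contributions, each with factor `ε * CT`, sum
  -- to half the energy. The threshold for `δ` is `2 / ε`, which gives the factor one half in front
  -- of the penalty.
  set ε : ℝ := 1 / (4 * d * Cp * CT) with hε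
  have hε0 : 0 < ε := by positivity
  have hεδ : 1 / (ε * δ) ≤ 1 / 2 := by
    rw [one_div_le_one_div (by positivity) (by norm_num), hε, div_mul_eq_mul_div, one_mul,
      le_div_iff₀ (by positivity)]
    linarith
  have ha0 : 0 ≤ M.a α k u u := (psdOn_a hM hα).nonneg u hu
  have hterm : ∀ l ∈ M.nbrs k, ∀ f ∈ M.commonFaces k l,
      |∫ η in (M.patch k).FReg f,
        (α k / 2 * (M.dnormal k f u η * M.jump k l f u η
          + M.dnormal k f u η * M.jump k l f u η)) * (M.patch k).surfaceDensity f (f.point η)| ≤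
      ε * CT * M.a α k u u + 1 / (ε * δ) * ∫ η in (M.patch k).FReg f,
        (δ * α k / (2 * M.hAvg k l) * (M.jump k l f u η * M.jump k l f u η)) *
          (M.patch k).surfaceDensity f (f.point η) := by
    intro l hl f hf
    have hav := hAvg_pos hM k l
    have hav' := hAvg_le hM k l
    have hi1 := ((hM k).integrableOn_normal_derivative_sq f (mem_V_of_mem_Vext hu)).const_mul
      (α k * ε * (M.patch k).h)
    have hi2 := (integrableOn_jump_mul_jump hM hu hu hl hf
      (δ * α k / (2 * M.hAvg k l))).const_mul (1 / (ε * δ))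
    have h1 := norm_integral_le_of_norm_le (hi1.add hi2) (f := fun η =>
      (α k / 2 * (M.dnormal k f u η * M.jump k l f u η
        + M.dnormal k f u η * M.jump k l f u η)) * (M.patch k).surfaceDensity f (f.point η))
      (Eventually.of_forall fun η => by
        have hσ := (M.patch k).surfaceDensity_nonneg f (f.point η)
        -- The weight `ε * h` fits the inverse trace inequality and the other weight fits the
        -- penalty. Their product condition reduces to `hAvg ≤ 2 * h`.
        have h2 := abs_mul_le_add_sq (X := M.dnormal k f u η) (Y := M.jump k l f u η)
          (p := ε * (M.patch k).h) (q := 1 / (2 * ε * M.hAvg k l)) (by positivity) (by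
            rw [mul_one_div, le_div_iff₀ (by positivity)]
            nlinarith)
        rw [Real.norm_eq_abs, abs_mul, abs_of_nonneg hσ, abs_mul,
          abs_of_pos (by positivity : 0 < α k / 2), ← two_mul, abs_mul 2, abs_two, Pi.add_apply]
        calc α k / 2 * (2 * |M.dnormal k f u η * M.jump k l f u η|) *
              (M.patch k).surfaceDensity f (f.point η)
            = α k * |M.dnormal k f u η * M.jump k l f u η| *
              (M.patch k).surfaceDensity f (f.point η) := by ring
          _ ≤ α k * (ε * (M.patch k).h * M.dnormal k f u η ^ 2 +
              1 / (2 * ε * M.hAvg k l) * M.jump k l f u η ^ 2) *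
              (M.patch k).surfaceDensity f (f.point η) := by gcongr
          _ = α k * ε * (M.patch k).h * (M.dnormal k f u η ^ 2 *
                (M.patch k).surfaceDensity f (f.point η)) +
              1 / (ε * δ) * (δ * α k / (2 * M.hAvg k l) *
                (M.jump k l f u η * M.jump k l f u η) *
                (M.patch k).surfaceDensity f (f.point η)) := by
            field_simp)
    rw [Real.norm_eq_abs] at h1
    refine h1.trans ?_
    rw [integral_add' hi1 hi2, integral_const_mul, integral_const_mul]
    refine add_le_add ?_ le_rfl
    have h3 := hT f (u k) (mem_V_of_mem_Vext hu)
    rw [Patch.faceIntegral_eq] at h3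
    rw [a_eq]
    calc _ = α k * ε * ((M.patch k).h * _) := by ring
      _ ≤ α k * ε * (CT * _) := mul_le_mul_of_nonneg_left h3 (by positivity)
      _ = _ := by ring
  calc |M.s α k u u| ≤ ∑ l ∈ M.nbrs k, ∑ f ∈ M.commonFaces k l,
        (ε * CT * M.a α k u u + 1 / (ε * δ) * ∫ η in (M.patch k).FReg f,
        (δ * α k / (2 * M.hAvg k l) * (M.jump k l f u η * M.jump k l f u η)) *
          (M.patch k).surfaceDensity f (f.point η)) := by
        rw [s_eq]
        exact (Finset.abs_sum_le_sum_abs _ _).trans (Finset.sum_le_sum fun l hl =>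
          (Finset.abs_sum_le_sum_abs _ _).trans (Finset.sum_le_sum fun f hf => hterm l hl f hf))
    _ = (∑ l ∈ M.nbrs k, ∑ _f ∈ M.commonFaces k l, ε * CT * M.a α k u u) +
        1 / (ε * δ) * M.pen α δ k u u := by
        simp only [Finset.sum_add_distrib, pen_eq, Finset.mul_sum]
    _ ≤ 2 * d * Cp * (ε * CT * M.a α k u u) + 1 / 2 * M.pen α δ k u u :=
        add_le_add (sum_commonFaces_le (by positivity) hC)
          (mul_le_mul_of_nonneg_right hεδ (pen_nonneg hM hα hδ0.le u))
    _ = 1 / 2 * (M.a α k u u + M.pen α δ k u u) := by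
        rw [hε]; field_simp; ring

/-- For nonnegativity, the bound on s leaves at least half of a + p. -/
lemma psdOn_ae (hM : ∀ k, (M.patch k).Good κ) {α : Fin N → ℝ} (hα : ∀ k, 0 < α k) {δ : ℝ}
    (hδ : 0 ≤ δ) (hs : ∀ u ∈ M.Vext k,
      |M.s α k u u| ≤ 1 / 2 * (M.a α k u u + M.pen α δ k u u)) :
    PSDOn (M.Vext k) (M.ae α δ k) where
  symm u v := by
    rw [ae, ae, (psdOn_a hM hα).symm u v, s_symm, pen_symm]
  add u hu u' hu' v hv := by
    rw [ae, ae, ae, (psdOn_a hM hα).add u hu u' hu' v hv, s_add hM α hu hu' hv,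
      pen_add hM α δ hu hu' hv]
    ring
  smul r u hu v hv := by
    rw [ae, ae, (psdOn_a hM hα).smul r u hu v hv, s_smul hM α r hu, pen_smul]
    ring
  nonneg u hu := by
    have h1 := (abs_le.1 (hs u hu)).1
    have h2 := (psdOn_a hM hα).nonneg u hu
    have h3 := pen_nonneg (k := k) hM hα hδ u
    rw [ae]
    linarith

end MultiPatch

end DGIgA

end

/-! ### Comparison of the two harmonic extensions. -/

theorem corollary1 (d : ℕ) (hd : d = 2 ∨ d = 3) (pmax : ℕ) (κ θ : ℝ) :
    ∃ δ₀ C₀ C₁ : ℝ, 0 < δ₀ ∧ 0 < C₀ ∧ 0 < C₁ ∧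
      ∀ (N : ℕ) (M : DGIgA.MultiPatch d N),
        (∀ k i, ((M.patch k).knots i).p ≤ pmax) →
        (∀ k, (M.patch k).ShapeRegular κ) →
        (∀ k, (M.patch k).QuasiUniform θ) →
        ∀ (α : Fin N → ℝ), (∀ k, 0 < α k) → ∀ (δ : ℝ), δ₀ ≤ δ →
        ∀ (k : Fin N), ∀ u ∈ M.W k,
          (∃ w, M.IsHarmonicExt k (M.a α k) u w) ∧
          (∃ we, M.IsHarmonicExt k (M.ae α δ k) u we) ∧
          ∀ w we, M.IsHarmonicExt k (M.a α k) u w → M.IsHarmonicExt k (M.ae α δ k) u we →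
            (C₀ * M.dNorm α δ k w w ≤ M.ae α δ k we we ∧
              M.ae α δ k we we ≤ C₁ * M.dNorm α δ k w w) ∧
            (C₀ * M.dPlus α δ k w w ≤ M.ae α δ k we we ∧
              M.ae α δ k we we ≤ C₁ * M.dPlus α δ k w w) := by
  have hd2 : 2 ≤ d := by rcases hd with rfl | rfl <;> norm_num
  have hd0 : (0 : ℝ) < d := by exact_mod_cast (by omega : 0 < d)
  obtain ⟨CT, hCT, hT⟩ := DGIgA.Patch.exists_inverse_trace d pmax κ θ
  obtain ⟨Cp, hCp, hC⟩ := DGIgA.MultiPatch.exists_card_le d hd2 κ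
  -- The energy of `we` is at least ½ (a + p) at `w`, while a + 2p ≤ 2 (a + p) and a_e + p ≤ 5/2 (a
  -- + p); the second comparison is the worse one and gives 1/5. The upper constant comes from a_e ≤
  -- 3/2 (a + p).
  refine ⟨8 * d * Cp * CT, 1 / 5, 3 / 2, by positivity, by norm_num, by norm_num, ?_⟩
  intro N M hp hsr hqu α hα δ hδ k u hu
  have hM : ∀ k, (M.patch k).Good κ := fun k =>
    DGIgA.Patch.Good.mk' (by omega) (M.injOn k) (hsr k)
  have hδ0 : 0 ≤ δ := le_trans (by positivity) hδ
  have hs : ∀ v ∈ M.Vext k, |M.s α k v v| ≤ 1 / 2 * (M.a α k v v + M.pen α δ k v v) :=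
    fun v hv => DGIgA.MultiPatch.abs_s_le hM hCT hCp
      (fun f v hv => hT _ (hM k) (hp k) (hqu k) f v hv) (hC N M hM) hα hδ hv
  have hA := DGIgA.MultiPatch.psdOn_a (k := k) hM hα
  have hE := DGIgA.MultiPatch.psdOn_ae hM hα hδ0 hs
  have huV := DGIgA.MultiPatch.W_le_Vext hu
  refine ⟨DGIgA.MultiPatch.exists_isHarmonicExt hA huV,
    DGIgA.MultiPatch.exists_isHarmonicExt hE huV, fun w we hw hwe => ?_⟩
  -- Each extension is a competitor in the minimization problem of the other.
  have e1 : M.a α k w w ≤ M.a α k we we := hw.le hA hwe.mem hwe.agree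
  have e2 : M.ae α δ k we we ≤ M.ae α δ k w w := hwe.le hE hw.mem hw.agree
  have e3 : M.pen α δ k w w = M.pen α δ k we we :=
    DGIgA.MultiPatch.pen_congr α δ (hw.agree.trans_symm hwe.agree)
  have e4 := abs_le.1 (hs w hw.mem)
  have e5 := abs_le.1 (hs we hwe.mem)
  have e6 := DGIgA.MultiPatch.pen_nonneg (k := k) hM hα hδ0 w
  have e7 := hA.nonneg w hw.mem
  simp only [DGIgA.MultiPatch.dNorm, DGIgA.MultiPatch.dPlus, DGIgA.MultiPatch.ae] at e2 ⊢
  refine ⟨⟨?_, ?_⟩, ?_, ?_⟩ <;> linarith [e4.1, e4.2, e5.1, e5.2]
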